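/- Let $d\ge 1$, let $M$ be an integer $d\times d$ dilation matrix (all eigenvalues have modulus $>1$), $m=|\det M|$, and let $H$ be a finite abelian group of integer $d\times d$ matrices of determinant $\pm1$ with $M^{-1}EM\in H$ for all $E\in H$. $H$ acts on the cosets $\langle s\rangle=s+M\mathbb Z^d$ by $E\langle s\rangle=\langle Es\rangle$. Let $s_{0,0}=0,s_{1,0},\dots,s_{q,0}\in\mathbb Z^d$ be representatives of cosets, one from each orbit; let $H_p=\{F\in H:F\langle s_{p,0}\rangle=\langle s_{p,0}\rangle\}$ and let $\Gamma_p\ni I_d$ be a complete set of representatives of the cosets of $H$ modulo $H_p$. For $F\in H_p$ put $r_{p,0}^F=M^{-1}(Fs_{p,0}-s_{p,0})\in\mathbb Z^d$, and assume that $r_{p,0}^F=M^{-1}EMr_{p,0}^F$ for all $p=1,\dots,q$, $F\in H_p$, $E\in\Gamma_p$. For each $p=1,\dots,q$ the group $H/H_p$ is a direct product of cyclic groups of prime power orders. Fix any decomposition of $H/H_p$ into cyclic groups of orders $N_{p,1},\dots,N_{p,\gamma_p}$, number the elements $E^{(i)}$ of $\Gamma_p$ accordingly by $i=(i_1,\dots,i_{\gamma_p})$,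 $i_j\in\mathbb Z/N_{p,j}$, so that $E^{(i)}E^{(k)}\in E^{(i+k)}H_p$, and take the digits $0$ and $s_{p,i}=E^{(i)}s_{p,0}$, $p\ge1$. Let $\mathcal W_p$ be the Kronecker product of the unitary discrete Fourier transform matrices of orders $N_{p,1},\dots,N_{p,\gamma_p}$ and let $\mathcal W=\mathrm{diag}(\mathcal W_1,\dots,\mathcal W_q)$. Let $n\ge1$ and let $m_0$ be a trigonometric polynomial on $\mathbb R^d$ with $m_0(0)=1$ that is interpolatory ($\sum_{s}m_0(\xi+M^{*-1}s)\equiv1$, $s$ running over a set $D(M^*)\ni 0$ of representatives of $\mathbb Z^d/M^*\mathbb Z^d$), $H$-symmetric with respect to the origin ($m_0(E^*\xi)=m_0(\xi)$ for $E\in H$) and has sum rule of order $n$ ($D^\beta[m_0(M^{*-1}\cdot)](s)=0$ for $s\in D(M^*)\setminus\{0\}$, $|\beta|<n$). Polyphase components $\tau_k$ of a trigonometric polynomial $t$ with respect to digits $s_k$ are the trigonometric polynomials with $t(\xi)=m^{-1/2}\sum_k e^{2\pi i(s_k,\xi)}\tau_k(M^*\xi)$. Let $P$ be the row of the polyphase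 components of $m_0$ for the digits other than $0$, and let $\widetilde m_0$ be the mask with the polyphase components $(\sqrt m(1-PP^*),P)$; it is a trigonometric polynomial with $\widetilde m_0(0)=1$, $H$-symmetric with respect to the origin. Let $$\mathcal N=\begin{pmatrix}\frac1{\sqrt m}&P\\-\mathcal W^*P^*&\sqrt m(\mathcal W^*-\mathcal W^*P^*P)\end{pmatrix},\qquad \widetilde{\mathcal N}=\begin{pmatrix}\sqrt m(1-PP^*)&P\\-\mathcal W^*P^*&\frac1{\sqrt m}\mathcal W^*\end{pmatrix}$$ (the matrix extension with $U=\widetilde U=\mathcal W^*$). Then $\mathcal N^*\widetilde{\mathcal N}=I_m$, and $\mathcal N,\widetilde{\mathcal N}$ are the polyphase matrices of $m_0,\widetilde m_0$ (first rows) and of wavelet masks $m_{(p,i)},\widetilde m_{(p,i)}$ (other rows), all of which are trigonometric polynomials $t$ with vanishing moments of order $n$ ($D^\beta t(0)=0$ for $|\beta|<n$) and with the $H$-symmetry property: for each $E\in H$ there are $\varepsilon\in\mathbb C$, $|\varepsilon|=1$, and $r\in\mathbb Z^d$ with $t(E^*\xi)=\varepsilon e^{2\pi i(r,\xi)}t(\xi)$.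 If the refinable functions $\phi,\widetilde\phi$ given by $\widehat\phi(\xi)=\prod_{j\ge1}m_0(M^{*-j}\xi)$ and $\widehat{\widetilde\phi}(\xi)=\prod_{j\ge1}\widetilde m_0(M^{*-j}\xi)$ are in $L_2(\mathbb R^d)$, then the functions $\psi^{(p,i)},\widetilde\psi^{(p,i)}$ given by $\widehat{\psi^{(p,i)}}(\xi)=m_{(p,i)}(M^{*-1}\xi)\widehat\phi(M^{*-1}\xi)$ and $\widehat{\widetilde\psi^{(p,i)}}(\xi)=\widetilde m_{(p,i)}(M^{*-1}\xi)\widehat{\widetilde\phi}(M^{*-1}\xi)$ are in $L_2(\mathbb R^d)$, and the systems $m^{j/2}\psi^{(p,i)}(M^jx+k)$ and $m^{j/2}\widetilde\psi^{(p,i)}(M^jx+k)$, $j\in\mathbb Z$, $k\in\mathbb Z^d$, $p=1,\dots,q$, are a pair of dual frames of $L_2(\mathbb R^d)$. -/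

import Mathlib

open MeasureTheory Matrix
open scoped FourierTransform

noncomputable section

namespace SymFrame

/-- The space `ℝ^d`. -/
abbrev V (d : ℕ) := EuclideanSpace ℝ (Fin d)

/-- An integer matrix as a real matrix. -/
def toReal {d : ℕ} (A : Matrix (Fin d) (Fin d) ℤ) : Matrix (Fin d) (Fin d) ℝ :=
  A.map (fun a : ℤ => (a : ℝ))

/-- An integer vector as a point of `ℝ^d`. -/
def intVec {d : ℕ} (k : Fin d → ℤ) : V d := WithLp.toLp 2 (fun j => (k j : ℝ))

/-- The matrix-vector product `A x` for `x ∈ ℝ^d`. -/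
def act {d : ℕ} (A : Matrix (Fin d) (Fin d) ℝ) (x : V d) : V d := WithLp.toLp 2 (A *ᵥ x.ofLp)

/-- The exponential `exp (2 π i (k, ξ))`, `k ∈ ℤ^d`. -/
def expo {d : ℕ} (k : Fin d → ℤ) (ξ : V d) : ℂ :=
  Complex.exp (2 * Real.pi * Complex.I * ((∑ j, (k j : ℝ) * ξ j : ℝ) : ℂ))

/-- Trigonometric polynomials: finite linear combinations of `exp (2 π i (k, ξ))`, `k ∈ ℤ^d`. -/
def IsTrigPoly {d : ℕ} (t : V d → ℂ) : Prop :=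
  ∃ h : (Fin d → ℤ) →₀ ℂ, ∀ ξ, t ξ = h.sum (fun k a => a * expo k ξ)

/-- A refinable mask: a trigonometric polynomial with value `1` at the origin. -/
def IsRefinableMask {d : ℕ} (t : V d → ℂ) : Prop := IsTrigPoly t ∧ t 0 = 1

/-- A dilation matrix: all (complex) eigenvalues are bigger than `1` in modulus. -/
def IsDilation {d : ℕ} (M : Matrix (Fin d) (Fin d) ℤ) : Prop :=
  ∀ z ∈ spectrum ℂ (M.map (fun a : ℤ => (a : ℂ))), 1 < ‖z‖

/-- `m = |det M|`. -/
def absDet {d : ℕ} (M : Matrix (Fin d) (Fin d) ℤ) : ℝ := |(M.det : ℝ)|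

/-- Congruence of integer vectors modulo `M`. -/
def Congr {d : ℕ} (M : Matrix (Fin d) (Fin d) ℤ) (α β : Fin d → ℤ) : Prop :=
  ∃ γ : Fin d → ℤ, α - β = M *ᵥ γ

/-- A set of digits of `A`: one representative of each coset of `ℤ^d` modulo `A`, with `0` as
representative of its coset. -/
def IsDigitSet {d : ℕ} (A : Matrix (Fin d) (Fin d) ℤ) (D : Finset (Fin d → ℤ)) : Prop :=
  0 ∈ D ∧ ∀ α : Fin d → ℤ, ∃! s, s ∈ D ∧ Congr A α s

/-- The first order partial derivative in the `j`-th coordinate. -/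
def pderiv {d : ℕ} (j : Fin d) (f : V d → ℂ) : V d → ℂ :=
  fun x => lineDeriv ℝ f x (EuclideanSpace.single j (1 : ℝ))

/-- The mixed partial derivative `D^β f` for a multi-index `β`. -/
def multiDeriv {d : ℕ} (β : Fin d → ℕ) (f : V d → ℂ) : V d → ℂ :=
  (List.finRange d).foldr (fun j g => (pderiv j)^[β j] g) f

/-- `t` is interpolatory; `Dst` is a set of digits of `M^*`. -/
def IsInterpolatory {d : ℕ} (M : Matrix (Fin d) (Fin d) ℤ) (Dst : Finset (Fin d → ℤ))
    (t : V d → ℂ) : Prop :=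
  ∀ ξ, ∑ s ∈ Dst, t (ξ + act (toReal M)ᵀ⁻¹ (intVec s)) = 1

/-- `t` has sum rule of order `n`; `Dst` is a set of digits of `M^*`. -/
def HasSumRule {d : ℕ} (M : Matrix (Fin d) (Fin d) ℤ) (Dst : Finset (Fin d → ℤ)) (n : ℕ)
    (t : V d → ℂ) : Prop :=
  ∀ s ∈ Dst, s ≠ 0 → ∀ β : Fin d → ℕ, ∑ j, β j < n →
    multiDeriv β (fun ξ => t (act (toReal M)ᵀ⁻¹ ξ)) (intVec s) = 0

/-- `t` has vanishing moments of order `n`. -/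
def HasVanishingMoments {d : ℕ} (n : ℕ) (t : V d → ℂ) : Prop :=
  ∀ β : Fin d → ℕ, ∑ j, β j < n → multiDeriv β t 0 = 0

/-- `H` is a symmetry group with respect to `M`: a finite group of unimodular integer matrices with
`M⁻¹ E M ∈ H` for all `E ∈ H`. -/
def IsSymmetryGroup {d : ℕ} (M : Matrix (Fin d) (Fin d) ℤ) (H : Subgroup (GL (Fin d) ℤ)) : Prop :=
  Finite H ∧ ∀ E ∈ H, ∃ E' ∈ H, E.val * M = M * E'.val

/-- `t` is `H`-symmetric with respect to the center `c`: for all `E ∈ H`, `c - E c ∈ ℤ^d` and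
`t ξ = exp (2 π i (c - E c, ξ)) t (E^* ξ)`. -/
def IsHSymmetric {d : ℕ} (H : Subgroup (GL (Fin d) ℤ)) (c : V d) (t : V d → ℂ) : Prop :=
  ∀ E ∈ H, ∃ k : Fin d → ℤ, c - act (toReal E.val) c = intVec k ∧
    ∀ ξ, t ξ = expo k ξ * t (act (toReal E.val)ᵀ ξ)

/-- The `H`-symmetry property: for each `E ∈ H`, `t (E^* ξ) = ε exp (2 π i (r, ξ)) t ξ` with
`|ε| = 1` and `r ∈ ℤ^d`. -/
def HasHSymmetryProperty {d : ℕ} (H : Subgroup (GL (Fin d) ℤ)) (t : V d → ℂ) : Prop :=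
  ∀ E ∈ H, ∃ (ε : ℂ) (r : Fin d → ℤ), ‖ε‖ = 1 ∧
    ∀ ξ, t (act (toReal E.val)ᵀ ξ) = ε * expo r ξ * t ξ

/-- The stabilizer in `H` of the coset of `s` modulo `M`, for the action `E⟨s⟩ = ⟨E s⟩`. -/
def stabilizer {d : ℕ} (M : Matrix (Fin d) (Fin d) ℤ) (H : Subgroup (GL (Fin d) ℤ))
    (s : Fin d → ℤ) : Set (GL (Fin d) ℤ) :=
  {F | F ∈ H ∧ Congr M (F.val *ᵥ s) s}

/-- For `F` in the stabilizer of `⟨s⟩`: the integer vector `r` with `F s = M r + s`, written as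
`M⁻¹ (F s - s)`. -/
def stabShift {d : ℕ} (M : Matrix (Fin d) (Fin d) ℤ) (s : Fin d → ℤ) (F : GL (Fin d) ℤ) : V d :=
  act (toReal M)⁻¹ (intVec (F.val *ᵥ s - s))

/-- A choice of representatives: `rep p` (that is, `s_{p,0}`) are digits whose cosets represent the
`H`-orbits on the set of cosets of `ℤ^d` modulo `M`, with `s_{0,0} = 0`; `Γ p` is a complete set of
representatives, containing the identity, of the cosets of `H` modulo the stabilizer of
`⟨s_{p,0}⟩`. The number of orbits is `q + 1`. -/
structure OrbitSystem {d : ℕ} (M : Matrix (Fin d) (Fin d) ℤ) (H : Subgroup (GL (Fin d) ℤ)) where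
  q : ℕ
  rep : Fin (q + 1) → Fin d → ℤ
  rep_zero : rep 0 = 0
  covers : ∀ α : Fin d → ℤ, ∃! p, ∃ E ∈ H, Congr M α (E.val *ᵥ rep p)
  Γ : Fin (q + 1) → Set (GL (Fin d) ℤ)
  one_mem : ∀ p, 1 ∈ Γ p
  subset : ∀ p, Γ p ⊆ H
  transversal : ∀ p, ∀ K ∈ H, ∃! x : GL (Fin d) ℤ × GL (Fin d) ℤ,
    x.1 ∈ Γ p ∧ x.2 ∈ stabilizer M H (rep p) ∧ K = x.1 * x.2

/-- The special assumption `r = M⁻¹ E M r` for `r = r_{p,0}^F`, all `p ≠ 0`, all `F` in the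
stabilizer of `⟨s_{p,0}⟩` and all `E ∈ Γ p`. -/
def SpecialAssumption {d : ℕ} {M : Matrix (Fin d) (Fin d) ℤ} {H : Subgroup (GL (Fin d) ℤ)}
    (S : OrbitSystem M H) : Prop :=
  ∀ p, p ≠ 0 → ∀ F ∈ stabilizer M H (S.rep p), ∀ E ∈ S.Γ p,
    stabShift M (S.rep p) F =
      act ((toReal M)⁻¹ * toReal E.val * toReal M) (stabShift M (S.rep p) F)

/-- A numbering of the representatives `Γ p`, `p ≠ 0`, by the mixed radix digits
`k = (k_1, …, k_γ)`, `k_j ∈ ℤ / N_j`, which expresses `H` modulo the stabilizer of `⟨s_{p,0}⟩` as a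
direct product of cyclic groups of orders `N_j`: `E^(k) E^(l)` and `E^(k ⊕ l)` lie in the same coset
of the stabilizer. -/
structure CyclicNumbering {d : ℕ} {M : Matrix (Fin d) (Fin d) ℤ} {H : Subgroup (GL (Fin d) ℤ)}
    (S : OrbitSystem M H) where
  γ : Fin S.q → ℕ
  N : (p : Fin S.q) → Fin (γ p) → ℕ+
  E : (p : Fin S.q) → ((j : Fin (γ p)) → ZMod (N p j)) → GL (Fin d) ℤ
  bij : ∀ p, Set.BijOn (E p) Set.univ (S.Γ p.succ)
  add : ∀ p k l, (E p (k + l))⁻¹ * (E p k * E p l) ∈ stabilizer M H (S.rep p.succ)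

/-- The matrix of the discrete Fourier transform of order `N`. -/
def dft (N : ℕ+) : Matrix (ZMod N) (ZMod N) ℂ :=
  Matrix.of fun k l => (1 / Real.sqrt (N : ℕ) : ℂ) *
    Complex.exp (2 * Real.pi * Complex.I / (N : ℕ)) ^ (k.val * l.val)

/-- `m₀` recovered from polyphase components `τ` with respect to the digits `s`:
`m^{-1/2} ∑ exp (2 π i (s_i, ξ)) τ_i (M^* ξ)`. -/
def fromPolyphase {d : ℕ} {J : Type} [Fintype J] (M : Matrix (Fin d) (Fin d) ℤ)
    (s : J → Fin d → ℤ) (τ : J → V d → ℂ) : V d → ℂ :=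
  fun ξ => (1 / Real.sqrt (absDet M) : ℂ) * ∑ i, expo (s i) ξ * τ i (act (toReal M)ᵀ ξ)

/-- `τ` are the polyphase components of `t` with respect to the digits `s`. -/
def IsPolyphase {d : ℕ} {J : Type} [Fintype J] (M : Matrix (Fin d) (Fin d) ℤ)
    (s : J → Fin d → ℤ) (t : V d → ℂ) (τ : J → V d → ℂ) : Prop :=
  (∀ i, IsTrigPoly (τ i)) ∧ ∀ ξ, t ξ = fromPolyphase M s τ ξ

/-- The polyphase components of the dual mask `m̃₀` of an interpolatory mask with polyphase
components `μ`; the digit `0` has the index `Sum.inl ()`. -/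
def dualPolyphase {d : ℕ} {I : Type} [Fintype I] (M : Matrix (Fin d) (Fin d) ℤ)
    (μ : Unit ⊕ I → V d → ℂ) : Unit ⊕ I → V d → ℂ :=
  Sum.elim (fun _ ξ => (Real.sqrt (absDet M) : ℂ) * (1 - ∑ i, (‖μ (Sum.inr i) ξ‖ ^ 2 : ℂ)))
    (fun i => μ (Sum.inr i))

/-- The row `P` of the polyphase components of a mask other than the one for the digit `0`. -/
def rowP {d : ℕ} {I : Type} (μ : Unit ⊕ I → V d → ℂ) (ξ : V d) : Matrix Unit I ℂ :=
  Matrix.of fun _ i => μ (Sum.inr i) ξ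

/-- The matrix extension
`[1/√m, P; -U P^*, √m (U - U P^* P)]`. -/
def extN {d : ℕ} {I : Type} [Fintype I] [DecidableEq I] (M : Matrix (Fin d) (Fin d) ℤ)
    (μ : Unit ⊕ I → V d → ℂ) (U : Matrix I I ℂ) (ξ : V d) : Matrix (Unit ⊕ I) (Unit ⊕ I) ℂ :=
  Matrix.fromBlocks ((1 / Real.sqrt (absDet M) : ℂ) • (1 : Matrix Unit Unit ℂ)) (rowP μ ξ)
    (-(U * (rowP μ ξ)ᴴ))
    ((Real.sqrt (absDet M) : ℂ) • (U - U * (rowP μ ξ)ᴴ * rowP μ ξ))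

/-- The dual matrix extension
`[√m (1 - P P^*), P; -Ũ P^*, (1/√m) Ũ]`. -/
def extNDual {d : ℕ} {I : Type} [Fintype I] [DecidableEq I] (M : Matrix (Fin d) (Fin d) ℤ)
    (μ : Unit ⊕ I → V d → ℂ) (U : Matrix I I ℂ) (ξ : V d) : Matrix (Unit ⊕ I) (Unit ⊕ I) ℂ :=
  Matrix.fromBlocks ((Real.sqrt (absDet M) : ℂ) • (1 - rowP μ ξ * (rowP μ ξ)ᴴ)) (rowP μ ξ)
    (-(U * (rowP μ ξ)ᴴ)) ((1 / Real.sqrt (absDet M) : ℂ) • U)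

/-- Masks `t₀, t_1, …` form with masks `t̃₀, t̃_1, …` a pair as required in the Mixed Extension
Principle, with polyphase matrices `A` and `B`: the rows of `A` and `B` are the polyphase
components of the masks, and `A^* B = I_m`. -/
def IsMEPPair {d : ℕ} {J : Type} [Fintype J] [DecidableEq J] (M : Matrix (Fin d) (Fin d) ℤ)
    (s : J → Fin d → ℤ) (t t' : J → V d → ℂ) (A B : V d → Matrix J J ℂ) : Prop :=
  (∀ ν, IsPolyphase M s (t ν) (fun i ξ => A ξ ν i)) ∧
  (∀ ν, IsPolyphase M s (t' ν) (fun i ξ => B ξ ν i)) ∧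
  ∀ ξ, (A ξ)ᴴ * B ξ = 1

namespace CyclicNumbering

variable {d : ℕ} {M : Matrix (Fin d) (Fin d) ℤ} {H : Subgroup (GL (Fin d) ℤ)}
  {S : OrbitSystem M H}

/-- The numbers of the representatives in `Γ p`. -/
abbrev Idx (C : CyclicNumbering S) (p : Fin S.q) : Type := (j : Fin (C.γ p)) → ZMod (C.N p j)

/-- The indices `(p, i)`, `p ≠ 0`, of the nonzero digits and of the wavelet masks. -/
abbrev WIdx (C : CyclicNumbering S) : Type := Σ p : Fin S.q, C.Idx p

/-- The digits: `0` and `s_{p,i} = E^(i) s_{p,0}`, `p ≠ 0`. -/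
def digit (C : CyclicNumbering S) : Unit ⊕ C.WIdx → Fin d → ℤ :=
  Sum.elim (fun _ => 0) (fun i => (C.E i.1 i.2).val *ᵥ S.rep i.1.succ)

/-- `𝒲_p`, the Kronecker product of the matrices of the discrete Fourier transforms of orders
`N_{p,j}`. -/
def kronDFT (C : CyclicNumbering S) (p : Fin S.q) : Matrix (C.Idx p) (C.Idx p) ℂ :=
  Matrix.of fun k l => ∏ j, dft (C.N p j) (k j) (l j)

/-- The block diagonal matrix `𝒲` with the blocks `𝒲_p`. -/
def blockW (C : CyclicNumbering S) : Matrix C.WIdx C.WIdx ℂ :=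
  Matrix.blockDiagonal' C.kronDFT

/-- The dual refinable mask `m̃₀` of the mask with polyphase components `μ`. -/
def dualMask (C : CyclicNumbering S) (μ : Unit ⊕ C.WIdx → V d → ℂ) : V d → ℂ :=
  fromPolyphase M C.digit (dualPolyphase M μ)

/-- The wavelet masks `m_{(p,i)}` from the matrix extension with `U = 𝒲^*`. -/
def waveletMask (C : CyclicNumbering S) (μ : Unit ⊕ C.WIdx → V d → ℂ) (ν : C.WIdx) : V d → ℂ :=
  fromPolyphase M C.digit (fun i ξ => extN M μ C.blockWᴴ ξ (Sum.inr ν) i)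

/-- The dual wavelet masks `m̃_{(p,i)}` from the matrix extension with `Ũ = 𝒲^*`. -/
def dualWaveletMask (C : CyclicNumbering S) (μ : Unit ⊕ C.WIdx → V d → ℂ) (ν : C.WIdx) :
    V d → ℂ :=
  fromPolyphase M C.digit (fun i ξ => extNDual M μ C.blockWᴴ ξ (Sum.inr ν) i)

end CyclicNumbering

/-- The space `L₂(ℝ^d)`. -/
abbrev L2 (d : ℕ) := Lp ℂ 2 (volume : Measure (V d))

/-- The Fourier transform `∏_{j ≥ 1} t (M^{*-j} ξ)` of the refinable function with mask `t`. -/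
def refinableHat {d : ℕ} (M : Matrix (Fin d) (Fin d) ℤ) (t : V d → ℂ) (ξ : V d) : ℂ :=
  ∏' j : ℕ, t (act ((toReal M)ᵀ⁻¹ ^ (j + 1)) ξ)

/-- `φ ∈ L₂` is the refinable function with mask `t`. -/
def IsRefinableFunction {d : ℕ} (M : Matrix (Fin d) (Fin d) ℤ) (t : V d → ℂ) (φ : L2 d) : Prop :=
  (𝓕 φ : L2 d) =ᵐ[volume] refinableHat M t

/-- `ψ ∈ L₂` is the wavelet function with wavelet mask `w` for the refinable function with mask `t`:
`ψ̂ ξ = w (M^{*-1} ξ) φ̂ (M^{*-1} ξ)`. -/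
def IsWaveletFunction {d : ℕ} (M : Matrix (Fin d) (Fin d) ℤ) (t w : V d → ℂ) (ψ : L2 d) : Prop :=
  (𝓕 ψ : L2 d) =ᵐ[volume] fun ξ =>
    w (act (toReal M)ᵀ⁻¹ ξ) * refinableHat M t (act (toReal M)ᵀ⁻¹ ξ)

/-- `Ψ` is the wavelet system `ψ^(ν)_{jk} = m^{j/2} ψ^(ν) (M^j · + k)`. -/
def IsWaveletSystem {d : ℕ} {I : Type} (M : Matrix (Fin d) (Fin d) ℤ) (ψ : I → L2 d)
    (Ψ : I × ℤ × (Fin d → ℤ) → L2 d) : Prop :=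
  ∀ ν j k, Ψ (ν, j, k) =ᵐ[volume] fun x =>
    ((absDet M ^ ((j : ℝ) / 2) : ℝ) : ℂ) * ψ ν (act (toReal M ^ j) x + intVec k)

/-- Frames in a Hilbert space. -/
def IsFrame {X : Type*} [NormedAddCommGroup X] [InnerProductSpace ℂ X] {A : Type*}
    (f : A → X) : Prop :=
  ∃ a b : ℝ, 0 < a ∧ 0 < b ∧ ∀ x : X, Summable (fun i => ‖inner ℂ (f i) x‖ ^ 2) ∧
    a * ‖x‖ ^ 2 ≤ ∑' i, ‖inner ℂ (f i) x‖ ^ 2 ∧ ∑' i, ‖inner ℂ (f i) x‖ ^ 2 ≤ b * ‖x‖ ^ 2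

/-- A pair of dual frames: both are frames, and `x = ∑ ⟨x, f̃_i⟩ f_i` for all `x`. -/
def IsDualFramePair {X : Type*} [NormedAddCommGroup X] [InnerProductSpace ℂ X] {A : Type*}
    (f f' : A → X) : Prop :=
  IsFrame f ∧ IsFrame f' ∧ ∀ x : X, HasSum (fun i => inner ℂ (f' i) x • f i) x

/-- Wavelet masks `w`, `w'` and refinable masks `t`, `t'` give wavelet functions in `L₂` whose
wavelet systems form a dual wavelet frame of `L₂(ℝ^d)`. -/
def GivesDualWaveletFrame {d : ℕ} {I : Type} (M : Matrix (Fin d) (Fin d) ℤ) (t t' : V d → ℂ)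
    (w w' : I → V d → ℂ) : Prop :=
  ∃ (ψ ψ' : I → L2 d) (Ψ Ψ' : I × ℤ × (Fin d → ℤ) → L2 d),
    (∀ ν, IsWaveletFunction M t (w ν) (ψ ν)) ∧ (∀ ν, IsWaveletFunction M t' (w' ν) (ψ' ν)) ∧
    IsWaveletSystem M ψ Ψ ∧ IsWaveletSystem M ψ' Ψ' ∧ IsDualFramePair Ψ Ψ'

end SymFrame

end

/-! The algebraic half is explicit. Since `m₀` is interpolatory, its polyphase component for the
digit `0` is the constant `1/√m`, and the two matrix extensions multiply to the identity for every
unitary `U`, with no condition on the row `P`. With `c_j = conj μ_j(M^*·)`, the wavelet masks are `∑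
U_νj e(s_j) - √m (∑ U_νj c_j) m₀` and `(1/m) ∑ U_νj (e(s_j) - √m c_j)`. Inversion of the polyphase
decomposition, interpolation and the sum rule make `e(s_j) - √m c_j` and `1 - m₀` vanish to order
`n` at the origin, which gives the vanishing moments (`vanishesTo_expo_sub`,
`hasVanishingMoments_extN`).

For the symmetry, the special assumption and the finiteness of `H` give `E s_{p,i} = s_{p,i+k} + M
r` with `k` and `r` independent of `i` (`CyclicNumbering.exists_shift`). So `E` acts on the digits
of an orbit by a translation of the index group followed by one common shift. The rows of `𝒲^*` are
characters of the index groups, hence eigenvectors of these translations, and `E` multiplies each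
wavelet mask by a unimodular constant and an exponential.

The analytic half is a Mixed Extension Principle for refinable functions that are merely in `L₂`,
with wavelet masks that vanish at the origin (`givesDualWaveletFrame`). The difficulty is the Bessel
property without any decay assumption on `φ̂`. The finite products of the mask have frequencies in
one bounded set, so the Fourier transform of `|φ̂|²` has bounded support. Insert the weight
`latticeGap (M^{*-i} ξ)`, a trigonometric polynomial of `M^{*-i} ξ` that vanishes exactly when this
point is in the lattice. The integer correlations of the weighted `|φ̂|²` live on a finite set
independent of `i`; they are iterates of one linear map (the transfer operator of `|m₀|²`, or of the
dual mask), and they tend to zero by dominated convergence. In finite dimension this forces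
geometric decay (`exists_geometric_bound`, `IsRefinableMask.exists_gapCorr_decay`). Summing the
weights with factors `s^i`, `s > 1`, yields a weight `W` for which the shifts of `φ` still satisfy a
Bessel inequality and which grows geometrically along dilation orbits away from the origin. Near the
origin the zero of the wavelet mask supplies the decay. Together they bound the sum over all scales
(`exists_wavelet_bessel`).

For the expansion, the polyphase identity `A^* B = I` says that the wavelet sum on scale `j` is the
difference of the refinable sums on scales `j + 1` and `j` (`sum_latticePairing`,
`refinable_sum_succ`). The series telescopes: on fine scales Parseval's identity gives the inner
product of band-limited functions, and on coarse scales the weight `W` makes the sums vanish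
(`hasSum_waveletHat`). Two Bessel families which reproduce inner products on a dense set are dual
frames (`isDualFramePair_of_bessel`). -/

noncomputable section

namespace SymFrame

/-! ### Matrix action on `ℝ^d`, integer vectors and exponentials. -/

section Basic

variable {d : ℕ}

lemma act_eq_clm (A : Matrix (Fin d) (Fin d) ℝ) (x : V d) :
    act A x = Matrix.toEuclideanCLM (n := Fin d) (𝕜 := ℝ) A x := rfl

lemma act_add (A : Matrix (Fin d) (Fin d) ℝ) (x y : V d) : act A (x + y) = act A x + act A y := by
  simp [act_eq_clm]

lemma act_neg (A : Matrix (Fin d) (Fin d) ℝ) (x : V d) : act A (-x) = -act A x := by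
  simp [act_eq_clm]

lemma act_zero (A : Matrix (Fin d) (Fin d) ℝ) : act A (0 : V d) = 0 := by
  simp [act_eq_clm]

lemma act_mul (A B : Matrix (Fin d) (Fin d) ℝ) (x : V d) : act (A * B) x = act A (act B x) := by
  simp [act_eq_clm]

lemma act_one (x : V d) : act 1 x = x := by
  simp [act_eq_clm]

@[fun_prop]
lemma continuous_act (A : Matrix (Fin d) (Fin d) ℝ) : Continuous (act A) :=
  (Matrix.toEuclideanCLM (n := Fin d) (𝕜 := ℝ) A).continuous

lemma toReal_mul (A B : Matrix (Fin d) (Fin d) ℤ) : toReal (A * B) = toReal A * toReal B := by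
  simpa [toReal] using Matrix.map_mul (M := B) (L := A) (f := Int.castRingHom ℝ)

lemma toReal_transpose (A : Matrix (Fin d) (Fin d) ℤ) : toReal Aᵀ = (toReal A)ᵀ := rfl

lemma toReal_det (A : Matrix (Fin d) (Fin d) ℤ) : (toReal A).det = (A.det : ℝ) := by
  simpa [toReal, RingHom.mapMatrix_apply] using ((Int.castRingHom ℝ).map_det A).symm

lemma intVec_mulVec (A : Matrix (Fin d) (Fin d) ℤ) (k : Fin d → ℤ) :
    intVec (A *ᵥ k) = act (toReal A) (intVec k) := by
  ext i
  simp [intVec, act, toReal, Matrix.mulVec, dotProduct]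

lemma intVec_add (k l : Fin d → ℤ) : intVec (k + l) = intVec k + intVec l := by
  ext i; simp [intVec]

lemma intVec_neg (k : Fin d → ℤ) : intVec (-k) = -intVec k := by
  ext i; simp [intVec]

lemma intVec_zero : intVec (0 : Fin d → ℤ) = 0 := by
  ext i; simp [intVec]

lemma intVec_injective : Function.Injective (intVec : (Fin d → ℤ) → V d) := by
  intro k l h
  ext i
  have := congrArg (fun v : V d => v i) h
  simpa [intVec] using this

/-- The exponential `exp (2 π i (x, ξ))`, `x ∈ ℝ^d`. -/
def ex (x ξ : V d) : ℂ := Complex.exp (2 * Real.pi * Complex.I * ((inner ℝ x ξ : ℝ) : ℂ))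

lemma expo_eq_ex (k : Fin d → ℤ) (ξ : V d) : expo k ξ = ex (intVec k) ξ := by
  simp only [expo, ex, intVec, PiLp.inner_apply]
  congr 3
  exact Finset.sum_congr rfl fun i _ => by simp [mul_comm]

lemma ex_add_left (x y ξ : V d) : ex (x + y) ξ = ex x ξ * ex y ξ := by
  simp only [ex, inner_add_left, Complex.ofReal_add, mul_add, Complex.exp_add]

lemma ex_add_right (x ξ η : V d) : ex x (ξ + η) = ex x ξ * ex x η := by
  simp only [ex, inner_add_right, Complex.ofReal_add, mul_add, Complex.exp_add]

lemma ex_zero_left (ξ : V d) : ex 0 ξ = 1 := by simp [ex]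

lemma ex_zero_right (x : V d) : ex x 0 = 1 := by simp [ex]

lemma ex_comm (x ξ : V d) : ex x ξ = ex ξ x := by simp [ex, real_inner_comm]

lemma norm_ex (x ξ : V d) : ‖ex x ξ‖ = 1 := by
  rw [ex, Complex.norm_exp]; simp

lemma conj_ex (x ξ : V d) : (starRingEnd ℂ) (ex x ξ) = ex (-x) ξ := by
  simp only [ex, ← Complex.exp_conj]
  simp [Complex.conj_ofNat]

lemma ex_neg_right (x ξ : V d) : ex x (-ξ) = ex (-x) ξ := by
  simp [ex]

lemma ex_act (A : Matrix (Fin d) (Fin d) ℝ) (x ξ : V d) : ex (act A x) ξ = ex x (act Aᵀ ξ) := by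
  simp only [ex]
  congr 3
  rw [act_eq_clm, act_eq_clm, real_inner_comm, Matrix.inner_toEuclideanCLM,
    Matrix.inner_toEuclideanCLM, Matrix.dotProduct_mulVec, ← Matrix.mulVec_transpose,
    dotProduct_comm]

@[fun_prop]
lemma continuous_ex (x : V d) : Continuous (ex x) := by
  unfold ex; fun_prop

lemma ex_intVec_intVec (k l : Fin d → ℤ) : ex (intVec k) (intVec l) = 1 := by
  rw [← expo_eq_ex, expo]
  rw [Complex.exp_eq_one_iff]
  refine ⟨∑ j, k j * l j, ?_⟩
  simp only [intVec]
  push_cast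
  ring

lemma expo_add (k l : Fin d → ℤ) (ξ : V d) : expo (k + l) ξ = expo k ξ * expo l ξ := by
  simp only [expo_eq_ex, intVec_add, ex_add_left]

lemma expo_zero (ξ : V d) : expo 0 ξ = 1 := by
  simp only [expo_eq_ex, intVec_zero, ex_zero_left]

lemma expo_add_right (k : Fin d → ℤ) (ξ η : V d) : expo k (ξ + η) = expo k ξ * expo k η := by
  simp only [expo_eq_ex, ex_add_right]

lemma expo_zero_right (k : Fin d → ℤ) : expo k (0 : V d) = 1 := by
  simp only [expo_eq_ex, ex_zero_right]

lemma norm_expo (k : Fin d → ℤ) (ξ : V d) : ‖expo k ξ‖ = 1 := by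
  rw [expo_eq_ex, norm_ex]

lemma conj_expo (k : Fin d → ℤ) (ξ : V d) : (starRingEnd ℂ) (expo k ξ) = expo (-k) ξ := by
  simp only [expo_eq_ex, conj_ex, intVec_neg]

lemma expo_mul_neg (k : Fin d → ℤ) (ξ : V d) : expo k ξ * expo (-k) ξ = 1 := by
  rw [← expo_add, add_neg_cancel, expo_zero]

lemma expo_mulVec (A : Matrix (Fin d) (Fin d) ℤ) (k : Fin d → ℤ) (ξ : V d) :
    expo (A *ᵥ k) ξ = expo k (act (toReal A)ᵀ ξ) := by
  rw [expo_eq_ex, expo_eq_ex, intVec_mulVec, ex_act]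

lemma expo_intVec (k l : Fin d → ℤ) : expo k (intVec l) = 1 := by
  rw [expo_eq_ex, ex_intVec_intVec]

@[fun_prop]
lemma continuous_expo (k : Fin d → ℤ) : Continuous (expo k : V d → ℂ) := by
  unfold expo; fun_prop

end Basic

/-! ### The algebra of trigonometric polynomials. -/

section TrigPoly

variable {d : ℕ}

lemma isTrigPoly_iff_mem_span {t : V d → ℂ} :
    IsTrigPoly t ↔ t ∈ Submodule.span ℂ (Set.range (expo : (Fin d → ℤ) → V d → ℂ)) := by
  rw [Finsupp.mem_span_range_iff_exists_finsupp]
  constructor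
  · rintro ⟨h, hh⟩
    refine ⟨h, ?_⟩
    ext ξ
    rw [hh]
    simp [Finsupp.sum]
  · rintro ⟨h, hh⟩
    refine ⟨h, fun ξ => ?_⟩
    rw [← hh]
    simp [Finsupp.sum]

lemma isTrigPoly_expo (k : Fin d → ℤ) : IsTrigPoly (expo k : V d → ℂ) :=
  isTrigPoly_iff_mem_span.2 (Submodule.subset_span ⟨k, rfl⟩)

lemma IsTrigPoly.add {f g : V d → ℂ} (hf : IsTrigPoly f) (hg : IsTrigPoly g) :
    IsTrigPoly (fun ξ => f ξ + g ξ) :=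
  isTrigPoly_iff_mem_span.2
    (Submodule.add_mem _ (isTrigPoly_iff_mem_span.1 hf) (isTrigPoly_iff_mem_span.1 hg))

lemma IsTrigPoly.const_mul {f : V d → ℂ} (a : ℂ) (hf : IsTrigPoly f) :
    IsTrigPoly (fun ξ => a * f ξ) :=
  isTrigPoly_iff_mem_span.2 (Submodule.smul_mem _ a (isTrigPoly_iff_mem_span.1 hf))

/-- Induction principle for trigonometric polynomials. -/
@[elab_as_elim]
lemma IsTrigPoly.induction {P : (t : V d → ℂ) → IsTrigPoly t → Prop}
    (he : ∀ k, P (expo k) (isTrigPoly_expo k))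
    (hs : ∀ (a : ℂ) f (hf : IsTrigPoly f), P f hf → P (fun ξ => a * f ξ) (hf.const_mul a))
    (ha : ∀ f g (hf : IsTrigPoly f) (hg : IsTrigPoly g), P f hf → P g hg →
      P (fun ξ => f ξ + g ξ) (hf.add hg))
    {t : V d → ℂ} (ht : IsTrigPoly t) : P t ht := by
  have ht' := isTrigPoly_iff_mem_span.1 ht
  induction ht' using Submodule.span_induction with
  | mem x hx => obtain ⟨k, rfl⟩ := hx; exact he k
  | zero =>
    -- The induction principle has no case for zero, which is obtained as `0` times an exponential.
    have := hs 0 (expo 0) (isTrigPoly_expo 0) (he 0)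
    have h0 : (fun ξ : V d => 0 * expo 0 ξ) = 0 := by ext; simp
    simp only [h0] at this
    exact this
  | add f g hf hg ihf ihg =>
    have hf' := isTrigPoly_iff_mem_span.2 hf
    have hg' := isTrigPoly_iff_mem_span.2 hg
    exact ha f g hf' hg' (ihf hf') (ihg hg')
  | smul a f hf ih =>
    have hf' := isTrigPoly_iff_mem_span.2 hf
    exact hs a f hf' (ih hf')

lemma isTrigPoly_const (a : ℂ) : IsTrigPoly (fun _ : V d => a) := by
  have := Submodule.smul_mem _ a (isTrigPoly_iff_mem_span.1 (isTrigPoly_expo (d := d) 0))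
  refine isTrigPoly_iff_mem_span.2 ?_
  convert this using 1
  ext ξ
  simp [expo_zero]

lemma IsTrigPoly.neg {f : V d → ℂ} (hf : IsTrigPoly f) : IsTrigPoly (fun ξ => - f ξ) := by
  simpa using hf.const_mul (-1)

lemma IsTrigPoly.sub {f g : V d → ℂ} (hf : IsTrigPoly f) (hg : IsTrigPoly g) :
    IsTrigPoly (fun ξ => f ξ - g ξ) := by
  simpa [sub_eq_add_neg] using hf.add hg.neg

lemma IsTrigPoly.mul_expo {f : V d → ℂ} (k : Fin d → ℤ) (hf : IsTrigPoly f) :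
    IsTrigPoly (fun ξ => expo k ξ * f ξ) := by
  induction hf using IsTrigPoly.induction with
  | he l =>
    rw [← funext (expo_add k l)]
    exact isTrigPoly_expo (k + l)
  | hs a f hf ih => simpa [mul_left_comm] using ih.const_mul a
  | ha f g hf hg ihf ihg => simpa [mul_add] using ihf.add ihg

lemma IsTrigPoly.mul {f g : V d → ℂ} (hf : IsTrigPoly f) (hg : IsTrigPoly g) :
    IsTrigPoly (fun ξ => f ξ * g ξ) := by
  induction hf using IsTrigPoly.induction with
  | he l => exact hg.mul_expo l
  | hs a f hf ih => simpa [mul_assoc] using ih.const_mul a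
  | ha f f' hf hf' ihf ihg => simpa [add_mul] using ihf.add ihg

lemma IsTrigPoly.conj {f : V d → ℂ} (hf : IsTrigPoly f) :
    IsTrigPoly (fun ξ => (starRingEnd ℂ) (f ξ)) := by
  induction hf using IsTrigPoly.induction with
  | he l => simpa [conj_expo] using isTrigPoly_expo (-l)
  | hs a f hf ih => simpa using ih.const_mul _
  | ha f g hf hg ihf ihg => simpa using ihf.add ihg

lemma IsTrigPoly.sum {J : Type*} (s : Finset J) {f : J → V d → ℂ} (hf : ∀ j ∈ s, IsTrigPoly (f j)) :
    IsTrigPoly (fun ξ => ∑ j ∈ s, f j ξ) := by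
  rw [isTrigPoly_iff_mem_span]
  have := Submodule.sum_mem (Submodule.span ℂ (Set.range (expo : (Fin d → ℤ) → V d → ℂ)))
    (fun j hj => isTrigPoly_iff_mem_span.1 (hf j hj))
  convert this using 1
  ext ξ
  simp

lemma IsTrigPoly.normSq {f : V d → ℂ} (hf : IsTrigPoly f) :
    IsTrigPoly (fun ξ => ((‖f ξ‖ : ℂ)) ^ 2) := by
  have := hf.mul hf.conj
  simpa [Complex.mul_conj'] using this

/-- Integer linear substitutions preserve trigonometric polynomials. -/
lemma IsTrigPoly.comp_act {f : V d → ℂ} (hf : IsTrigPoly f) (A : Matrix (Fin d) (Fin d) ℤ) :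
    IsTrigPoly (fun ξ => f (act (toReal A)ᵀ ξ)) := by
  induction hf using IsTrigPoly.induction with
  | he l => simpa [← expo_mulVec] using isTrigPoly_expo (A *ᵥ l)
  | hs a f hf ih => exact ih.const_mul a
  | ha f g hf hg ihf ihg => exact ihf.add ihg

lemma IsTrigPoly.add_intVec {f : V d → ℂ} (hf : IsTrigPoly f) (k : Fin d → ℤ) (ξ : V d) :
    f (ξ + intVec k) = f ξ := by
  induction hf using IsTrigPoly.induction with
  | he l => simp [expo_add_right, expo_intVec]
  | hs a f hf ih => simp [ih]
  | ha f g hf hg ihf ihg => simp [ihf, ihg]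

lemma IsTrigPoly.continuous {f : V d → ℂ} (hf : IsTrigPoly f) : Continuous f := by
  induction hf using IsTrigPoly.induction with
  | he l => fun_prop
  | hs a f hf ih => fun_prop
  | ha f g hf hg ihf ihg => fun_prop

lemma IsTrigPoly.contDiff {f : V d → ℂ} (hf : IsTrigPoly f) : ContDiff ℝ (⊤ : ℕ∞) f := by
  induction hf using IsTrigPoly.induction with
  | he l =>
    have : (expo l : V d → ℂ) = fun ξ => Complex.exp (2 * Real.pi * Complex.I *
        (Complex.ofRealCLM (inner ℝ (intVec l) ξ))) := by
      ext ξ; rw [expo_eq_ex]; rfl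
    rw [this]
    exact (contDiff_const.mul (Complex.ofRealCLM.contDiff.comp
      (contDiff_const.inner ℝ contDiff_id))).cexp
  | hs a f hf ih => fun_prop
  | ha f g hf hg ihf ihg => fun_prop

lemma IsTrigPoly.bounded {f : V d → ℂ} (hf : IsTrigPoly f) : ∃ K, 0 ≤ K ∧ ∀ ξ, ‖f ξ‖ ≤ K := by
  induction hf using IsTrigPoly.induction with
  | he l => exact ⟨1, zero_le_one, fun ξ => by rw [norm_expo]⟩
  | hs a f hf ih =>
    obtain ⟨K, hK, h⟩ := ih
    refine ⟨‖a‖ * K, by positivity, fun ξ => ?_⟩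
    rw [norm_mul]
    exact mul_le_mul_of_nonneg_left (h ξ) (norm_nonneg a)
  | ha f g hf hg ihf ihg =>
    obtain ⟨K, hK, h⟩ := ihf
    obtain ⟨L, hL, h'⟩ := ihg
    exact ⟨K + L, by positivity, fun ξ => (norm_add_le _ _).trans (add_le_add (h ξ) (h' ξ))⟩

/-- Trigonometric polynomials are Lipschitz at the origin. -/
lemma IsTrigPoly.lipschitz_zero {f : V d → ℂ} (hf : IsTrigPoly f) :
    ∃ L, 0 ≤ L ∧ ∀ ξ, ‖f ξ - f 0‖ ≤ L * ‖ξ‖ := by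
  induction hf using IsTrigPoly.induction with
  | he l =>
    refine ⟨2 * Real.pi * ‖intVec l‖, by positivity, fun ξ => ?_⟩
    rw [expo_zero_right, expo_eq_ex, ex]
    have h : (2 * Real.pi * Complex.I * ((inner ℝ (intVec l) ξ : ℝ) : ℂ)) =
        Complex.I * ((2 * Real.pi * inner ℝ (intVec l) ξ : ℝ) : ℂ) := by push_cast; ring
    rw [h]
    refine (Real.norm_exp_I_mul_ofReal_sub_one_le).trans ?_
    rw [norm_mul, Real.norm_of_nonneg (by positivity), mul_assoc _ ‖intVec l‖]
    exact mul_le_mul_of_nonneg_left (norm_inner_le_norm _ _) (by positivity)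
  | hs a f hf ih =>
    obtain ⟨K, hK, h⟩ := ih
    refine ⟨‖a‖ * K, by positivity, fun ξ => ?_⟩
    rw [← mul_sub, norm_mul, mul_assoc]
    exact mul_le_mul_of_nonneg_left (h ξ) (norm_nonneg a)
  | ha f g hf hg ihf ihg =>
    obtain ⟨K, hK, h⟩ := ihf
    obtain ⟨L, hL, h'⟩ := ihg
    refine ⟨K + L, by positivity, fun ξ => ?_⟩
    rw [add_sub_add_comm, add_mul]
    exact (norm_add_le _ _).trans (add_le_add (h ξ) (h' ξ))

end TrigPoly

/-! ### Representatives modulo an integer matrix and orthogonality of characters. -/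

section Digits

variable {d : ℕ} {J : Type*}

/-- The `s_j` are representatives of the cosets of `ℤ^d` modulo `A`. -/
def IsDigits (A : Matrix (Fin d) (Fin d) ℤ) (s : J → Fin d → ℤ) : Prop :=
  ∀ α : Fin d → ℤ, ∃! j, Congr A α (s j)

lemma congr_refl (A : Matrix (Fin d) (Fin d) ℤ) (α : Fin d → ℤ) : Congr A α α := ⟨0, by simp⟩

lemma Congr.symm {A : Matrix (Fin d) (Fin d) ℤ} {α β : Fin d → ℤ} (h : Congr A α β) :
    Congr A β α := by
  obtain ⟨γ, h⟩ := h
  exact ⟨-γ, by rw [Matrix.mulVec_neg, ← h, neg_sub]⟩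

lemma Congr.trans {A : Matrix (Fin d) (Fin d) ℤ} {α β δ : Fin d → ℤ} (h : Congr A α β)
    (h' : Congr A β δ) : Congr A α δ := by
  obtain ⟨γ, h⟩ := h
  obtain ⟨γ', h'⟩ := h'
  exact ⟨γ + γ', by rw [Matrix.mulVec_add, ← h, ← h']; abel⟩

lemma IsDigitSet.isDigits {A : Matrix (Fin d) (Fin d) ℤ} {D : Finset (Fin d → ℤ)}
    (h : IsDigitSet A D) : IsDigits A (fun s : D => (s : Fin d → ℤ)) := by
  intro α
  obtain ⟨s, ⟨hs, hc⟩, hu⟩ := h.2 α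
  exact ⟨⟨s, hs⟩, hc, fun t ht => Subtype.ext (hu t ⟨t.2, ht⟩)⟩

/-- The bijection of representatives with the quotient. -/
def IsDigits.equivQuot {A : Matrix (Fin d) (Fin d) ℤ} {s : J → Fin d → ℤ} (h : IsDigits A s) :
    J ≃ (Fin d → ℤ) ⧸ LinearMap.range A.mulVecLin :=
  Equiv.ofBijective (fun j => Submodule.Quotient.mk (s j)) <| by
    have key : ∀ α β : Fin d → ℤ, (Submodule.Quotient.mk (p := LinearMap.range A.mulVecLin) α =
        Submodule.Quotient.mk β) ↔ Congr A α β := by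
      intro α β
      rw [Submodule.Quotient.eq, LinearMap.mem_range]
      exact ⟨fun ⟨γ, hγ⟩ => ⟨γ, hγ.symm⟩, fun ⟨γ, hγ⟩ => ⟨γ, hγ.symm⟩⟩
    constructor
    · intro i j hij
      exact (h (s i)).unique (congr_refl A _) ((key _ _).1 hij)
    · intro x
      obtain ⟨α, rfl⟩ := Submodule.Quotient.mk_surjective _ x
      obtain ⟨j, hj, -⟩ := h α
      exact ⟨j, (key _ _).2 hj.symm⟩

/-- The number of cosets is `|det A|`. -/
lemma IsDigits.card [Fintype J] {A : Matrix (Fin d) (Fin d) ℤ} {s : J → Fin d → ℤ}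
    (h : IsDigits A s) (hA : A.det ≠ 0) : (Fintype.card J : ℝ) = |(A.det : ℝ)| := by
  have hinj : Function.Injective A.mulVecLin := by
    rw [← LinearMap.ker_eq_bot, LinearMap.ker_eq_bot']
    intro v hv
    exact Matrix.eq_zero_of_mulVec_eq_zero hA hv
  -- The index of the sublattice `A ℤ^d` is the modulus of the determinant of `A`.
  have := Submodule.natAbs_det_equiv _ (LinearEquiv.ofInjective A.mulVecLin hinj)
  rw [← Nat.card_congr h.equivQuot, Nat.card_eq_fintype_card] at this
  rw [← this, Nat.cast_natAbs, Int.cast_abs]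
  congr 2
  have e : (Submodule.subtype _ ∘ₗ ((LinearEquiv.ofInjective A.mulVecLin hinj :
      (Fin d → ℤ) ≃ₗ[ℤ] _) : (Fin d → ℤ) →ₗ[ℤ] LinearMap.range A.mulVecLin)) = Matrix.toLin' A := by
    ext; rfl
  exact (congrArg LinearMap.det e).trans (LinearMap.det_toLin' A)

/-- Sums of functions on the quotient do not depend on a shift of the digits. -/
lemma IsDigits.sum_shift [Fintype J] {A : Matrix (Fin d) (Fin d) ℤ} {s : J → Fin d → ℤ}
    (h : IsDigits A s) {R : Type*} [AddCommMonoid R] (g : (Fin d → ℤ) → R)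
    (hg : ∀ α β, Congr A α β → g α = g β) (a : Fin d → ℤ) :
    ∑ j, g (s j + a) = ∑ j, g (s j) := by
  have hshift : ∀ {α β c : Fin d → ℤ}, Congr A α β → Congr A (α + c) (β + c) := by
    rintro α β c ⟨γ, hγ⟩
    exact ⟨γ, by rw [← hγ]; abel⟩
  choose f hf hu using fun j => h (s j + a)
  refine Fintype.sum_bijective f ?_ _ _ fun j => hg _ _ (hf j)
  rw [Finite.injective_iff_bijective.symm]
  intro i j hij
  have h1 : Congr A (s i + a) (s j + a) := (hf i).trans (hij ▸ (hf j).symm)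
  have h2 := hshift (c := -a) h1
  simp only [add_neg_cancel_right] at h2
  exact (h (s i)).unique (congr_refl A _) h2

/-- Orthogonality of the characters of `ℤ^d` modulo `M^*`. -/
lemma sum_expo_digits [Fintype J] {M : Matrix (Fin d) (Fin d) ℤ} (hM : M.det ≠ 0)
    {s : J → Fin d → ℤ} (h : IsDigits Mᵀ s) (k : Fin d → ℤ) [Decidable (Congr M k 0)] :
    ∑ j, expo k (act (toReal M)ᵀ⁻¹ (intVec (s j))) =
      if Congr M k 0 then (absDet M : ℂ) else 0 := by
  have hB : IsUnit (toReal M)ᵀ.det := by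
    rw [Matrix.det_transpose, toReal_det]; exact (Int.cast_ne_zero.2 hM).isUnit
  have hinv : ∀ x : V d, act (toReal M)ᵀ⁻¹ (act (toReal M)ᵀ x) = x := fun x => by
    rw [← act_mul, Matrix.nonsing_inv_mul _ hB, act_one]
  have hinv' : ∀ x : V d, act (toReal M)ᵀ (act (toReal M)ᵀ⁻¹ x) = x := fun x => by
    rw [← act_mul, Matrix.mul_nonsing_inv _ hB, act_one]
  split_ifs with hk
  · obtain ⟨γ, hγ⟩ := hk
    rw [sub_zero] at hγ
    subst hγ
    simp only [expo_mulVec, hinv', expo_intVec, Finset.sum_const, nsmul_eq_mul, mul_one,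
      Finset.card_univ]
    have := h.card (by rwa [Matrix.det_transpose])
    rw [Matrix.det_transpose] at this
    rw [absDet, ← this]; simp
  · set g : (Fin d → ℤ) → ℂ := fun l => expo k (act (toReal M)ᵀ⁻¹ (intVec l)) with hg
    have hinvg : ∀ α β, Congr Mᵀ α β → g α = g β := by
      rintro α β ⟨γ, hγ⟩
      have : α = β + Mᵀ *ᵥ γ := by rw [← hγ]; abel
      rw [this]
      simp only [hg, intVec_add, act_add, intVec_mulVec, toReal_transpose, hinv, expo_add_right,
        expo_intVec, mul_one]
    have hadd : ∀ l a, g (l + a) = g l * g a := fun l a => by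
      simp only [hg, intVec_add, act_add, expo_add_right]
    by_contra hne
    -- Shifting the digits by `a` multiplies the character sum by `g a` without changing it, so a
    -- nonzero sum forces the character to be trivial.
    have hall : ∀ a, g a = 1 := by
      intro a
      have h1 := h.sum_shift g hinvg a
      simp only [hadd] at h1
      rw [← Finset.sum_mul] at h1
      exact (mul_eq_left₀ hne).1 h1
    apply hk
    -- Triviality on the unit vectors says that every coordinate of `M⁻¹ k` is an integer, that is,
    -- `k ∈ M ℤ^d`.
    have hint : ∀ i, ∃ n : ℤ, (act (toReal M)⁻¹ (intVec k)) i = n := by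
      intro i
      have h1 := hall (Pi.single i 1)
      simp only [hg] at h1
      rw [expo_eq_ex, ex_comm, ex_act, Matrix.transpose_nonsing_inv, Matrix.transpose_transpose,
        ← expo_eq_ex, expo, Complex.exp_eq_one_iff] at h1
      obtain ⟨n, hn⟩ := h1
      refine ⟨n, ?_⟩
      rw [mul_comm] at hn
      have h2 := mul_right_cancel₀ Complex.two_pi_I_ne_zero hn
      have h3 : (∑ j, ((Pi.single i (1 : ℤ) : Fin d → ℤ) j : ℝ) * (act (toReal M)⁻¹ (intVec k)) j)
          = n := by exact_mod_cast h2
      rw [← h3, Finset.sum_eq_single i]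
      · simp
      · intro j _ hj; simp [hj]
      · simp
    choose γ hγ using hint
    refine ⟨γ, intVec_injective ?_⟩
    rw [sub_zero, intVec_mulVec]
    have : act (toReal M)⁻¹ (intVec k) = intVec γ := by ext i; simpa [intVec] using hγ i
    rw [← this, ← act_mul, Matrix.mul_nonsing_inv, act_one]
    rwa [Matrix.det_transpose] at hB

end Digits

/-! ### Existence, inversion and uniqueness of polyphase components. -/

section Polyphase

variable {d : ℕ} {J : Type} [Fintype J]

lemma absDet_pos {M : Matrix (Fin d) (Fin d) ℤ} (hM : M.det ≠ 0) : 0 < absDet M :=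
  abs_pos.2 (Int.cast_ne_zero.2 hM)

lemma sqrt_absDet_ne_zero {M : Matrix (Fin d) (Fin d) ℤ} (hM : M.det ≠ 0) :
    (Real.sqrt (absDet M) : ℂ) ≠ 0 := by
  exact_mod_cast (Real.sqrt_pos.2 (absDet_pos hM)).ne'

lemma sqrt_absDet_mul_self {M : Matrix (Fin d) (Fin d) ℤ} (hM : M.det ≠ 0) :
    (Real.sqrt (absDet M) : ℂ) * Real.sqrt (absDet M) = absDet M := by
  exact_mod_cast Real.mul_self_sqrt (absDet_pos hM).le

lemma isUnit_det_transpose {M : Matrix (Fin d) (Fin d) ℤ} (hM : M.det ≠ 0) :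
    IsUnit (toReal M)ᵀ.det := by
  rw [Matrix.det_transpose, toReal_det]; exact (Int.cast_ne_zero.2 hM).isUnit

lemma act_transpose_inv_act {M : Matrix (Fin d) (Fin d) ℤ} (hM : M.det ≠ 0) (x : V d) :
    act (toReal M)ᵀ⁻¹ (act (toReal M)ᵀ x) = x := by
  rw [← act_mul, Matrix.nonsing_inv_mul _ (isUnit_det_transpose hM), act_one]

lemma act_transpose_act_inv {M : Matrix (Fin d) (Fin d) ℤ} (hM : M.det ≠ 0) (x : V d) :
    act (toReal M)ᵀ (act (toReal M)ᵀ⁻¹ x) = x := by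
  rw [← act_mul, Matrix.mul_nonsing_inv _ (isUnit_det_transpose hM), act_one]

lemma IsTrigPoly.fromPolyphase {M : Matrix (Fin d) (Fin d) ℤ} (s : J → Fin d → ℤ)
    {τ : J → V d → ℂ} (hτ : ∀ j, IsTrigPoly (τ j)) : IsTrigPoly (fromPolyphase M s τ) :=
  (IsTrigPoly.sum _ fun j _ => ((hτ j).comp_act M).mul_expo (s j)).const_mul _

/-- An exponential of frequency `k = s_j + M l` has the single nonzero component `√m e(l)`, at the
digit `s_j`; the rest is linearity. -/
lemma exists_isPolyphase {M : Matrix (Fin d) (Fin d) ℤ} (hM : M.det ≠ 0) {s : J → Fin d → ℤ}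
    (hs : IsDigits M s) {t : V d → ℂ} (ht : IsTrigPoly t) : ∃ τ, IsPolyphase M s t τ := by
  induction ht using IsTrigPoly.induction with
  | he k =>
    classical
    obtain ⟨j, ⟨l, hl⟩, -⟩ := hs k
    refine ⟨fun i => if i = j then fun ξ => (Real.sqrt (absDet M) : ℂ) * expo l ξ else fun _ => 0,
      fun i => ?_, fun ξ => ?_⟩
    · dsimp only
      split_ifs
      · exact (isTrigPoly_expo l).const_mul _
      · exact isTrigPoly_const 0
    · rw [fromPolyphase, Finset.sum_eq_single j]
      · have hk : k = s j + M *ᵥ l := by rw [← hl]; abel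
        have := sqrt_absDet_ne_zero hM
        rw [hk, expo_add, expo_mulVec]
        simp only [if_true]
        field_simp
      · intro i _ hij; simp [hij]
      · simp
  | hs a f hf ih =>
    obtain ⟨τ, hτ, h⟩ := ih
    refine ⟨fun i ξ => a * τ i ξ, fun i => (hτ i).const_mul a, fun ξ => ?_⟩
    show a * f ξ = _
    rw [h, fromPolyphase, fromPolyphase, mul_left_comm, Finset.mul_sum]
    simp only [mul_left_comm a]
  | ha f g hf hg ihf ihg =>
    obtain ⟨τ, hτ, h⟩ := ihf
    obtain ⟨τ', hτ', h'⟩ := ihg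
    refine ⟨fun i ξ => τ i ξ + τ' i ξ, fun i => (hτ i).add (hτ' i), fun ξ => ?_⟩
    show f ξ + g ξ = _
    rw [h, h']
    simp only [fromPolyphase, mul_add, Finset.sum_add_distrib]

/-- Inversion formula for the polyphase components. -/
lemma sum_fromPolyphase_mul_expo {M : Matrix (Fin d) (Fin d) ℤ} (hM : M.det ≠ 0)
    {s : J → Fin d → ℤ} (hs : IsDigits M s) {K : Type*} [Fintype K] {u : K → Fin d → ℤ}
    (hu : IsDigits Mᵀ u) {τ : J → V d → ℂ} (hτ : ∀ j ξ k, τ j (ξ + intVec k) = τ j ξ) (j : J)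
    (ξ : V d) :
    ∑ i, fromPolyphase M s τ (ξ + act (toReal M)ᵀ⁻¹ (intVec (u i))) *
        expo (-s j) (ξ + act (toReal M)ᵀ⁻¹ (intVec (u i))) =
      Real.sqrt (absDet M) * τ j (act (toReal M)ᵀ ξ) := by
  classical
  have h1 : ∀ i, fromPolyphase M s τ (ξ + act (toReal M)ᵀ⁻¹ (intVec (u i))) *
        expo (-s j) (ξ + act (toReal M)ᵀ⁻¹ (intVec (u i))) =
      ∑ l, (1 / Real.sqrt (absDet M) : ℂ) * expo (s l - s j) ξ * τ l (act (toReal M)ᵀ ξ) *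
        expo (s l - s j) (act (toReal M)ᵀ⁻¹ (intVec (u i))) := by
    intro i
    rw [fromPolyphase, mul_assoc, Finset.sum_mul, Finset.mul_sum]
    refine Finset.sum_congr rfl fun l _ => ?_
    rw [act_add, act_transpose_act_inv hM, hτ, sub_eq_add_neg, expo_add, expo_add, expo_add_right,
      expo_add_right]
    ring
  simp_rw [h1]
  rw [Finset.sum_comm]
  -- Orthogonality of characters keeps only the digits congruent to `s_j`, hence only `l = j`.
  simp_rw [← Finset.mul_sum, sum_expo_digits hM hu]
  rw [Finset.sum_eq_single j]
  · rw [if_pos ⟨0, by simp⟩, sub_self, expo_zero, ← sqrt_absDet_mul_self hM]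
    have := sqrt_absDet_ne_zero hM
    field_simp
  · intro l _ hl
    rw [if_neg, mul_zero]
    rintro ⟨γ, hγ⟩
    exact hl ((hs (s l)).unique (congr_refl M _) ⟨γ, by simpa using hγ⟩)
  · simp

/-- The inversion formula recovers the components, and it needs only their `ℤ^d`-periodicity. -/
lemma fromPolyphase_injective {M : Matrix (Fin d) (Fin d) ℤ} (hM : M.det ≠ 0)
    {s : J → Fin d → ℤ} (hs : IsDigits M s) {K : Type*} [Fintype K] {u : K → Fin d → ℤ}
    (hu : IsDigits Mᵀ u) {τ τ' : J → V d → ℂ} (hτ : ∀ j ξ k, τ j (ξ + intVec k) = τ j ξ)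
    (hτ' : ∀ j ξ k, τ' j (ξ + intVec k) = τ' j ξ)
    (h : ∀ ξ, fromPolyphase M s τ ξ = fromPolyphase M s τ' ξ) (j : J) (ξ : V d) :
    τ j ξ = τ' j ξ := by
  have h1 := sum_fromPolyphase_mul_expo hM hs hu hτ j (act (toReal M)ᵀ⁻¹ ξ)
  have h2 := sum_fromPolyphase_mul_expo hM hs hu hτ' j (act (toReal M)ᵀ⁻¹ ξ)
  simp only [h] at h1
  rw [h1, act_transpose_act_inv hM] at h2
  exact mul_left_cancel₀ (sqrt_absDet_ne_zero hM) h2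

/-- Polyphase components of a mask which is invariant under an integer substitution. -/
lemma polyphase_of_invariant {M : Matrix (Fin d) (Fin d) ℤ} (hM : M.det ≠ 0)
    {s : J → Fin d → ℤ} (hs : IsDigits M s) {K : Type*} [Fintype K] {u : K → Fin d → ℤ}
    (hu : IsDigits Mᵀ u) {t : V d → ℂ} {τ : J → V d → ℂ} (hτ : IsPolyphase M s t τ)
    {E E' : Matrix (Fin d) (Fin d) ℤ} (hE : E * M = M * E')
    (ht : ∀ ξ, t (act (toReal E)ᵀ ξ) = t ξ) (σ : J ≃ J) {r : J → Fin d → ℤ}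
    (hσ : ∀ j, E *ᵥ s j = s (σ j) + M *ᵥ r j) (j : J) (η : V d) :
    τ (σ j) η = expo (r j) η * τ j (act (toReal E')ᵀ η) := by
  -- Substituting `E^* ξ` permutes the digits up to elements of `M ℤ^d`. This is a second polyphase
  -- representation of the same mask, and uniqueness compares it with the first.
  have h1 : ∀ ξ, fromPolyphase M s τ ξ = fromPolyphase M s
      (fun j η => expo (r (σ.symm j)) η * τ (σ.symm j) (act (toReal E')ᵀ η)) ξ := by
    intro ξ
    rw [← hτ.2, ← ht, hτ.2, fromPolyphase, fromPolyphase]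
    congr 1
    refine Fintype.sum_equiv σ _ _ fun j => ?_
    rw [Equiv.symm_apply_apply, ← expo_mulVec, hσ, expo_add, ← act_mul, ← Matrix.transpose_mul,
      ← toReal_mul, hE, toReal_mul, Matrix.transpose_mul, act_mul, expo_mulVec]
    ring
  have h2 := fromPolyphase_injective hM hs hu (fun j ξ k => (hτ.1 j).add_intVec k ξ)
    (fun j ξ k => (((hτ.1 (σ.symm j)).comp_act E').mul_expo (r (σ.symm j))).add_intVec k ξ) h1
    (σ j) η
  simpa using h2

end Polyphase

/-! ### The matrix extension and closed forms of the masks. -/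

section Extension

variable {d : ℕ} {I : Type} [Fintype I] {M : Matrix (Fin d) (Fin d) ℤ}

/-- For the digit `0` the exponentials in the inversion formula are trivial, and the sum is the
interpolation sum, equal to `1`. -/
lemma polyphase_zero_of_interpolatory (hM : M.det ≠ 0) {s : Unit ⊕ I → Fin d → ℤ}
    (hs : IsDigits M s) (hs0 : s (Sum.inl ()) = 0) {Dst : Finset (Fin d → ℤ)}
    (hD : IsDigitSet Mᵀ Dst) {m₀ : V d → ℂ} (hint : IsInterpolatory M Dst m₀)
    {μ : Unit ⊕ I → V d → ℂ} (hμ : IsPolyphase M s m₀ μ) (ξ : V d) :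
    μ (Sum.inl ()) ξ = 1 / Real.sqrt (absDet M) := by
  have h1 := sum_fromPolyphase_mul_expo hM hs hD.isDigits
    (fun j ξ k => (hμ.1 j).add_intVec k ξ) (Sum.inl ()) (act (toReal M)ᵀ⁻¹ ξ)
  simp only [hs0, neg_zero, expo_zero, mul_one, ← hμ.2] at h1
  have h2 := hint (act (toReal M)ᵀ⁻¹ ξ)
  rw [← Finset.sum_coe_sort] at h2
  rw [h2, act_transpose_act_inv hM] at h1
  rw [eq_div_iff (sqrt_absDet_ne_zero hM), mul_comm]
  exact h1.symm

/-- A block computation in which all terms in `P` cancel once `UᴴU = 1` is used; the row `P` is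
arbitrary. -/
lemma extN_conjTranspose_mul_extNDual [DecidableEq I] (hM : M.det ≠ 0) (μ : Unit ⊕ I → V d → ℂ)
    {U : Matrix I I ℂ} (hU : Uᴴ * U = 1) (ξ : V d) :
    (extN M μ U ξ)ᴴ * extNDual M μ U ξ = 1 := by
  have hm := sqrt_absDet_ne_zero hM
  set c : ℂ := (Real.sqrt (absDet M) : ℂ) with hc
  have hcc : star c = c := by rw [hc]; exact Complex.conj_ofReal _
  rw [extN, extNDual, Matrix.fromBlocks_conjTranspose, Matrix.fromBlocks_multiply,
    ← Matrix.fromBlocks_one]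
  set P := rowP μ ξ
  have hUX : ∀ X : Matrix I Unit ℂ, Uᴴ * (U * X) = X := fun X => by
    rw [← Matrix.mul_assoc, hU, Matrix.one_mul]
  simp only [← hc, Matrix.conjTranspose_smul, Matrix.conjTranspose_one, Matrix.conjTranspose_neg,
    Matrix.conjTranspose_mul, Matrix.conjTranspose_conjTranspose, Matrix.conjTranspose_sub,
    star_div₀, star_one, hcc, Matrix.smul_mul, Matrix.mul_smul, Matrix.one_mul, Matrix.mul_one,
    Matrix.neg_mul, Matrix.mul_neg, Matrix.sub_mul, Matrix.mul_sub, Matrix.mul_assoc, hUX, hU,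
    neg_neg, smul_sub, smul_neg, smul_smul]
  congr 1
  · rw [one_div, mul_inv_cancel₀ hm]; simp
  · simp
  · abel
  · rw [one_div, inv_mul_cancel₀ hm]; simp

lemma isTrigPoly_extN [DecidableEq I] {μ : Unit ⊕ I → V d → ℂ} (hμ : ∀ i, IsTrigPoly (μ i)) (U : Matrix I I ℂ)
    (ν i : Unit ⊕ I) : IsTrigPoly (fun ξ => extN M μ U ξ ν i) := by
  have hP : ∀ k, IsTrigPoly (fun ξ => ∑ x, U k x * (starRingEnd ℂ) (μ (Sum.inr x) ξ)) :=
    fun k => IsTrigPoly.sum _ fun x _ => (hμ _).conj.const_mul _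
  rcases ν with ν | ν <;> rcases i with i | i
  · exact isTrigPoly_const _
  · exact hμ _
  · simpa [extN, rowP, Matrix.mul_apply] using (hP ν).neg
  · simpa [extN, rowP, Matrix.mul_apply] using
      ((isTrigPoly_const (U ν i)).sub ((hP ν).mul (hμ (Sum.inr i)))).const_mul
        (Real.sqrt (absDet M) : ℂ)

lemma isTrigPoly_extNDual [DecidableEq I] {μ : Unit ⊕ I → V d → ℂ} (hμ : ∀ i, IsTrigPoly (μ i))
    (U : Matrix I I ℂ) (ν i : Unit ⊕ I) : IsTrigPoly (fun ξ => extNDual M μ U ξ ν i) := by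
  have hP : ∀ k, IsTrigPoly (fun ξ => ∑ x, U k x * (starRingEnd ℂ) (μ (Sum.inr x) ξ)) :=
    fun k => IsTrigPoly.sum _ fun x _ => (hμ _).conj.const_mul _
  rcases ν with ν | ν <;> rcases i with i | i
  · simpa [extNDual, rowP, Matrix.mul_apply] using
      ((isTrigPoly_const 1).sub (IsTrigPoly.sum Finset.univ fun x _ =>
        (hμ (Sum.inr x)).mul (hμ (Sum.inr x)).conj)).const_mul (Real.sqrt (absDet M) : ℂ)
  · exact hμ _
  · simpa [extNDual, rowP, Matrix.mul_apply] using (hP ν).neg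
  · exact isTrigPoly_const _

lemma extN_inl [DecidableEq I] {μ : Unit ⊕ I → V d → ℂ}
    (h0 : ∀ ξ, μ (Sum.inl ()) ξ = 1 / Real.sqrt (absDet M)) (U : Matrix I I ℂ) :
    (fun (i : Unit ⊕ I) ξ => extN M μ U ξ (Sum.inl ()) i) = μ := by
  ext i ξ
  rcases i with i | i
  · simp [extN, h0]
  · rfl

lemma extNDual_inl [DecidableEq I] (μ : Unit ⊕ I → V d → ℂ) (U : Matrix I I ℂ) :
    (fun (i : Unit ⊕ I) ξ => extNDual M μ U ξ (Sum.inl ()) i) = dualPolyphase M μ := by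
  ext i ξ
  rcases i with i | i
  · simp [extNDual, dualPolyphase, rowP, Matrix.mul_apply, Complex.mul_conj']
  · rfl

variable {s : Unit ⊕ I → Fin d → ℤ} {m₀ : V d → ℂ} {μ : Unit ⊕ I → V d → ℂ}

lemma sum_expo_polyphase (hM : M.det ≠ 0) (hs0 : s (Sum.inl ()) = 0) (hμ : IsPolyphase M s m₀ μ)
    (h0 : ∀ ξ, μ (Sum.inl ()) ξ = 1 / Real.sqrt (absDet M)) (ξ : V d) :
    ∑ i, expo (s (Sum.inr i)) ξ * μ (Sum.inr i) (act (toReal M)ᵀ ξ) =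
      Real.sqrt (absDet M) * m₀ ξ - 1 / Real.sqrt (absDet M) := by
  have h1 := hμ.2 ξ
  rw [fromPolyphase, Fintype.sum_sum_type] at h1
  simp only [Finset.univ_unique, Finset.sum_singleton, PUnit.default_eq_unit, hs0, expo_zero,
    one_mul, h0] at h1
  have := sqrt_absDet_ne_zero hM
  rw [h1]
  field_simp
  ring

/-- Moments and symmetry are read off from this closed form. The sum over the digits collapses
because `P` consists of the components of `m₀` itself. -/
lemma fromPolyphase_extN [DecidableEq I] (hM : M.det ≠ 0) (hs0 : s (Sum.inl ()) = 0) (hμ : IsPolyphase M s m₀ μ)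
    (h0 : ∀ ξ, μ (Sum.inl ()) ξ = 1 / Real.sqrt (absDet M)) (U : Matrix I I ℂ) (ν : I) (ξ : V d) :
    fromPolyphase M s (fun i ξ => extN M μ U ξ (Sum.inr ν) i) ξ =
      ∑ j, U ν j * expo (s (Sum.inr j)) ξ - Real.sqrt (absDet M) *
        (∑ j, U ν j * (starRingEnd ℂ) (μ (Sum.inr j) (act (toReal M)ᵀ ξ))) * m₀ ξ := by
  set a := ∑ j, U ν j * (starRingEnd ℂ) (μ (Sum.inr j) (act (toReal M)ᵀ ξ)) with ha
  have hS := sum_expo_polyphase hM hs0 hμ h0 ξ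
  have hm := sqrt_absDet_ne_zero hM
  have e1 : extN M μ U (act (toReal M)ᵀ ξ) (Sum.inr ν) (Sum.inl ()) = -a := by
    simp [extN, rowP, Matrix.mul_apply, ha]
  have e2 : ∀ i, extN M μ U (act (toReal M)ᵀ ξ) (Sum.inr ν) (Sum.inr i) =
      Real.sqrt (absDet M) * (U ν i - a * μ (Sum.inr i) (act (toReal M)ᵀ ξ)) := by
    intro i
    simp [extN, rowP, Matrix.mul_apply, ha]
  rw [fromPolyphase, Fintype.sum_sum_type]
  simp only [Finset.univ_unique, Finset.sum_singleton, PUnit.default_eq_unit, hs0, expo_zero,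
    one_mul, e1, e2]
  have e3 : ∑ x, expo (s (Sum.inr x)) ξ * (Real.sqrt (absDet M) *
      (U ν x - a * μ (Sum.inr x) (act (toReal M)ᵀ ξ))) =
      Real.sqrt (absDet M) * (∑ x, U ν x * expo (s (Sum.inr x)) ξ -
        a * ∑ x, expo (s (Sum.inr x)) ξ * μ (Sum.inr x) (act (toReal M)ᵀ ξ)) := by
    rw [Finset.mul_sum (a := a), ← Finset.sum_sub_distrib, Finset.mul_sum]
    exact Finset.sum_congr rfl fun x _ => by ring
  rw [e3, hS]
  field_simp
  ring

lemma fromPolyphase_extNDual [DecidableEq I] (hM : M.det ≠ 0) (hs0 : s (Sum.inl ()) = 0)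
    (μ : Unit ⊕ I → V d → ℂ) (U : Matrix I I ℂ) (ν : I) (ξ : V d) :
    fromPolyphase M s (fun i ξ => extNDual M μ U ξ (Sum.inr ν) i) ξ =
      (1 / absDet M : ℂ) * (∑ j, U ν j * expo (s (Sum.inr j)) ξ - Real.sqrt (absDet M) *
        (∑ j, U ν j * (starRingEnd ℂ) (μ (Sum.inr j) (act (toReal M)ᵀ ξ)))) := by
  set a := ∑ j, U ν j * (starRingEnd ℂ) (μ (Sum.inr j) (act (toReal M)ᵀ ξ)) with ha
  have hm := sqrt_absDet_ne_zero hM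
  have e1 : extNDual M μ U (act (toReal M)ᵀ ξ) (Sum.inr ν) (Sum.inl ()) = -a := by
    simp [extNDual, rowP, Matrix.mul_apply, ha]
  have e2 : ∀ i, extNDual M μ U (act (toReal M)ᵀ ξ) (Sum.inr ν) (Sum.inr i) =
      (1 / Real.sqrt (absDet M)) * U ν i := by
    intro i
    simp [extNDual]
  rw [fromPolyphase, Fintype.sum_sum_type]
  simp only [Finset.univ_unique, Finset.sum_singleton, PUnit.default_eq_unit, hs0, expo_zero,
    one_mul, e1, e2]
  have e3 : ∑ x, expo (s (Sum.inr x)) ξ * ((1 / Real.sqrt (absDet M)) * U ν x) =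
      (1 / Real.sqrt (absDet M)) * ∑ x, U ν x * expo (s (Sum.inr x)) ξ := by
    rw [Finset.mul_sum]
    exact Finset.sum_congr rfl fun x _ => by ring
  rw [e3, ← sqrt_absDet_mul_self hM]
  field_simp
  ring

/-- Only `m₀` and the moduli of its components enter, so the symmetry of `m₀` and the value at the
origin pass to the dual mask. -/
lemma fromPolyphase_dualPolyphase (hM : M.det ≠ 0) (hs0 : s (Sum.inl ()) = 0)
    (hμ : IsPolyphase M s m₀ μ)
    (h0 : ∀ ξ, μ (Sum.inl ()) ξ = 1 / Real.sqrt (absDet M)) (ξ : V d) :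
    fromPolyphase M s (dualPolyphase M μ) ξ =
      1 - ∑ i, (‖μ (Sum.inr i) (act (toReal M)ᵀ ξ)‖ ^ 2 : ℂ) + m₀ ξ - 1 / absDet M := by
  have hS := sum_expo_polyphase hM hs0 hμ h0 ξ
  have hm := sqrt_absDet_ne_zero hM
  rw [fromPolyphase, Fintype.sum_sum_type]
  simp only [Finset.univ_unique, Finset.sum_singleton, PUnit.default_eq_unit, hs0, expo_zero,
    one_mul, dualPolyphase, Sum.elim_inl, Sum.elim_inr, hS]
  rw [← sqrt_absDet_mul_self hM]
  field_simp
  ring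

end Extension

/-! ### Finite abelian groups as products of cyclic groups of prime power order. -/

section CyclicDecomposition

/-- The structure theorem used here allows factors of order `p ^ 0 = 1`. These are trivial and are
discarded, since `1` is not a prime power. -/
lemma exists_cyclic_decomposition (G : Type*) [CommGroup G] [Finite G] :
    ∃ (γ : ℕ) (N : Fin γ → ℕ+), (∀ j, IsPrimePow (N j : ℕ)) ∧
      Nonempty (((j : Fin γ) → ZMod (N j)) ≃+ Additive G) := by
  classical
  obtain ⟨ι, hι, p, hp, n, ⟨e⟩⟩ := AddCommGroup.equiv_directSum_zmod_of_finite (Additive G)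
  let h : {i : ι // n i ≠ 0} ≃ Fin (Fintype.card {i : ι // n i ≠ 0}) := Fintype.equivFin _
  let N : Fin (Fintype.card {i : ι // n i ≠ 0}) → ℕ+ := fun k =>
    ⟨p (h.symm k).1 ^ n (h.symm k).1, pow_pos (hp _).pos _⟩
  let F : ((i : ι) → ZMod (p i ^ n i)) →+ ((k : Fin (Fintype.card {i : ι // n i ≠ 0})) →
      ZMod (N k)) :=
    { toFun := fun x k => x (h.symm k).1
      map_zero' := rfl
      map_add' := fun _ _ => rfl }
  have hF : Function.Bijective F := by
    constructor
    · intro x y hxy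
      ext i
      by_cases hi : n i = 0
      · have : Subsingleton (ZMod (p i ^ n i)) := ZMod.subsingleton_iff.2 (by rw [hi, pow_zero])
        exact Subsingleton.elim _ _
      · obtain ⟨k, hk⟩ := h.symm.surjective ⟨i, hi⟩
        have h1 : x (h.symm k).1 = y (h.symm k).1 := congrFun hxy k
        rw [hk] at h1
        exact h1
    · intro z
      obtain ⟨w, hw⟩ := (Equiv.piCongrLeft' (fun i : {i : ι // n i ≠ 0} => ZMod (p i ^ n i))
        h).surjective z
      refine ⟨fun i => if hi : n i ≠ 0 then w ⟨i, hi⟩ else 0, ?_⟩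
      rw [← hw]
      ext k
      exact dif_pos (h.symm k).2
  refine ⟨_, N, fun j => ?_, ⟨((e.trans (DirectSum.addEquivProd _)).trans
    (AddEquiv.ofBijective F hF)).symm⟩⟩
  exact (hp _).isPrimePow.pow (h.symm j).2

end CyclicDecomposition

/-! ### Orbits of cosets, numbering of the digits and the action of the group on them. -/

section Orbits

variable {d : ℕ} {M : Matrix (Fin d) (Fin d) ℤ} {H : Subgroup (GL (Fin d) ℤ)}

/-- As `M⁻¹ E M` is an integer matrix, `E` maps `M ℤ^d` into itself, so it acts on cosets. -/
lemma IsSymmetryGroup.congr (hH : IsSymmetryGroup M H) {E : GL (Fin d) ℤ} (hE : E ∈ H)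
    {α β : Fin d → ℤ} (h : Congr M α β) : Congr M (E.val *ᵥ α) (E.val *ᵥ β) := by
  obtain ⟨γ, hγ⟩ := h
  obtain ⟨E', -, hE'⟩ := hH.2 E hE
  exact ⟨E'.val *ᵥ γ, by
    rw [← Matrix.mulVec_sub, hγ, Matrix.mulVec_mulVec, hE', Matrix.mulVec_mulVec]⟩

lemma GL_mul_mulVec (E F : GL (Fin d) ℤ) (α : Fin d → ℤ) :
    (E * F).val *ᵥ α = E.val *ᵥ (F.val *ᵥ α) := by
  rw [Matrix.mulVec_mulVec]; rfl

lemma GL_one_mulVec (α : Fin d → ℤ) : (1 : GL (Fin d) ℤ).val *ᵥ α = α := by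
  simp

/-- The stabilizer of a coset is a subgroup. -/
def stabilizerSubgroup (hH : IsSymmetryGroup M H) (s : Fin d → ℤ) : Subgroup (GL (Fin d) ℤ) where
  carrier := stabilizer M H s
  one_mem' := ⟨H.one_mem, by rw [GL_one_mulVec]; exact congr_refl M s⟩
  mul_mem' := by
    rintro E F ⟨hE, hE'⟩ ⟨hF, hF'⟩
    refine ⟨H.mul_mem hE hF, ?_⟩
    rw [GL_mul_mulVec]
    exact (hH.congr hE hF').trans hE'
  inv_mem' := by
    rintro E ⟨hE, hE'⟩
    refine ⟨H.inv_mem hE, ?_⟩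
    have h1 := hH.congr (H.inv_mem hE) hE'
    rw [← GL_mul_mulVec, inv_mul_cancel, GL_one_mulVec] at h1
    exact h1.symm

/-- Commutativity makes `H` modulo the stabilizer an abelian group. After a decomposition of this
quotient, `E^(k)` is the member of `Γ p` in the coset with number `k`. -/
lemma exists_cyclicNumbering (hH : IsSymmetryGroup M H)
    (hab : ∀ E ∈ H, ∀ F ∈ H, E * F = F * E) (S : OrbitSystem M H) :
    ∃ C : CyclicNumbering S, ∀ p j, IsPrimePow (C.N p j : ℕ) := by
  classical
  let _ : CommGroup H := { (inferInstance : Group H) with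
    mul_comm := fun a b => Subtype.ext (hab a a.2 b b.2) }
  have := hH.1
  have key : ∀ p : Fin S.q, ∃ (γ : ℕ) (N : Fin γ → ℕ+)
      (E : ((j : Fin γ) → ZMod (N j)) → GL (Fin d) ℤ), (∀ j, IsPrimePow (N j : ℕ)) ∧
      Set.BijOn E Set.univ (S.Γ p.succ) ∧
      ∀ k l, (E (k + l))⁻¹ * (E k * E l) ∈ stabilizer M H (S.rep p.succ) := by
    intro p
    set K : Subgroup H := (stabilizerSubgroup hH (S.rep p.succ)).subgroupOf H with hK
    have hKm : ∀ A B : H, ((A : H ⧸ K) = B) ↔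
        ((A⁻¹ * B : H) : GL (Fin d) ℤ) ∈ stabilizer M H (S.rep p.succ) := fun A B => QuotientGroup.eq
    clear_value K
    obtain ⟨γ, N, hN, ⟨f⟩⟩ := exists_cyclic_decomposition (H ⧸ K)
    choose x hx hxu using fun A : H => S.transversal p.succ A.1 A.2
    have hxH : ∀ A, (x A).1 ∈ H := fun A => S.subset _ (hx A).1
    let q : ((j : Fin γ) → ZMod (N j)) → H ⧸ K := fun k => (f k).toMul
    let E : ((j : Fin γ) → ZMod (N j)) → GL (Fin d) ℤ := fun k => (x (q k).out).1
    have hEH : ∀ k, E k ∈ H := fun k => hxH _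
    have hEq : ∀ k, ((⟨E k, hEH k⟩ : H) : H ⧸ K) = q k := by
      intro k
      rw [← QuotientGroup.out_eq' (q k)]
      rw [hKm]
      have h1 := (hx (q k).out).2.2
      have h2 : (((⟨E k, hEH k⟩ : H)⁻¹ * (q k).out : H) : GL (Fin d) ℤ) = (x (q k).out).2 := by
        rw [Subgroup.coe_mul, h1]
        simp [E]
      rw [h2]
      exact (hx (q k).out).2.1
    refine ⟨γ, N, E, hN, ⟨fun k _ => (hx _).1, ?_, ?_⟩, ?_⟩
    · intro k _ l _ hkl
      apply f.injective
      have h1 := hEq k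
      have h2 := hEq l
      simp only [hkl] at h1
      exact Additive.toMul.injective (h1.symm.trans h2)
    · intro g hg
      have hgH := S.subset _ hg
      refine ⟨f.symm (Additive.ofMul ((⟨g, hgH⟩ : H) : H ⧸ K)), trivial, ?_⟩
      set k := f.symm (Additive.ofMul ((⟨g, hgH⟩ : H) : H ⧸ K)) with hk
      have h1 := hEq k
      have h2 : q k = ((⟨g, hgH⟩ : H) : H ⧸ K) := by simp [q, hk]
      rw [h2, eq_comm, hKm] at h1
      -- The element `E k` factors both as `E k · 1` and as `g · (g⁻¹ E k)`, and the factorization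
      -- over the transversal is unique.
      have h3 := (S.transversal p.succ (E k) (hEH k)).unique
        (y₁ := (E k, 1)) (y₂ := (g, g⁻¹ * E k))
        ⟨(hx _).1, (stabilizerSubgroup hH _).one_mem, by simp⟩
        ⟨hg, by simpa using h1, by simp⟩
      exact congrArg Prod.fst h3
    · intro k l
      have h1 : ((⟨E (k + l), hEH _⟩ : H) : H ⧸ K) =
          ((⟨E k, hEH k⟩ * ⟨E l, hEH l⟩ : H) : H ⧸ K) := by
        rw [hEq, QuotientGroup.mk_mul, hEq, hEq]
        simp [q]
      rw [hKm] at h1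
      simpa using h1
  choose γ N E h1 h2 h3 using key
  exact ⟨⟨γ, N, E, h2, h3⟩, h1⟩

variable {S : OrbitSystem M H}

lemma CyclicNumbering.E_mem (C : CyclicNumbering S) (p : Fin S.q) (k : C.Idx p) : C.E p k ∈ H :=
  S.subset _ ((C.bij p).mapsTo (Set.mem_univ k))

/-- The cosets in one orbit correspond to the cosets of the stabilizer, hence to `Γ p`. The orbit
with number `0` is the single coset of `0`, because its representative is the zero vector. -/
lemma CyclicNumbering.isDigits (C : CyclicNumbering S) (hH : IsSymmetryGroup M H) :
    IsDigits M C.digit := by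
  have hbase : ∀ (p : Fin S.q) (k : C.Idx p), Congr M (C.digit (Sum.inr ⟨p, k⟩))
      ((C.E p k).val *ᵥ S.rep p.succ) := fun p k => congr_refl _ _
  have hex : ∀ α, ∃ j, Congr M α (C.digit j) := by
    intro α
    obtain ⟨p, ⟨E, hE, hα⟩, -⟩ := S.covers α
    refine Fin.cases (fun hα => ⟨Sum.inl (), ?_⟩) (fun p hα => ?_) p hα
    · rw [S.rep_zero, Matrix.mulVec_zero] at hα
      exact hα
    · obtain ⟨x, ⟨hx1, hx2, hx3⟩, -⟩ := S.transversal p.succ E hE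
      obtain ⟨k, -, hk⟩ := (C.bij p).surjOn hx1
      refine ⟨Sum.inr ⟨p, k⟩, hα.trans ?_⟩
      rw [hx3, GL_mul_mulVec, ← hk]
      exact hH.congr (C.E_mem p k) hx2.2
  have horb : ∀ j, ∃ E ∈ H, Congr M (C.digit j)
      (E.val *ᵥ S.rep (Sum.elim (fun _ => 0) (fun i : C.WIdx => i.1.succ) j)) := by
    rintro (j | ⟨p, k⟩)
    · exact ⟨1, H.one_mem, by rw [GL_one_mulVec]; simpa [S.rep_zero, digit] using congr_refl M 0⟩
    · exact ⟨C.E p k, C.E_mem p k, congr_refl _ _⟩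
  intro α
  obtain ⟨j, hj⟩ := hex α
  refine ⟨j, hj, fun i hi => ?_⟩
  have hij : Congr M (C.digit i) (C.digit j) := hi.symm.trans hj
  obtain ⟨E1, hE1, h1⟩ := horb i
  obtain ⟨E2, hE2, h2⟩ := horb j
  -- Congruent digits lie in one orbit. Inside an orbit the transversal property separates them.
  have hp := (S.covers (C.digit i)).unique ⟨E1, hE1, h1⟩ ⟨E2, hE2, hij.trans h2⟩
  rcases i with ⟨⟩ | ⟨p, k⟩ <;> rcases j with ⟨⟩ | ⟨p', k'⟩
  · rfl
  · exact absurd hp (Fin.succ_ne_zero _).symm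
  · exact absurd hp (Fin.succ_ne_zero _)
  · obtain rfl : p = p' := Fin.succ_injective _ hp
    have h3 := hH.congr (H.inv_mem (C.E_mem p k')) hij
    simp only [digit, Sum.elim_inr, ← GL_mul_mulVec, inv_mul_cancel, GL_one_mulVec] at h3
    have h4 := (S.transversal p.succ (C.E p k) (C.E_mem p k)).unique
        (y₁ := (C.E p k, 1)) (y₂ := (C.E p k', (C.E p k')⁻¹ * C.E p k))
        ⟨(C.bij p).mapsTo (Set.mem_univ k), (stabilizerSubgroup hH _).one_mem, by simp⟩
        ⟨(C.bij p).mapsTo (Set.mem_univ k'),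
          ⟨H.mul_mem (H.inv_mem (C.E_mem p k')) (C.E_mem p k), h3⟩, by simp⟩
    rw [(C.bij p).injOn (Set.mem_univ k) (Set.mem_univ k') (congrArg Prod.fst h4)]

/-- The special assumption, multiplied by `M`. -/
lemma SpecialAssumption.fixed (hS : SpecialAssumption S) (hM : M.det ≠ 0) {p : Fin S.q}
    {F : GL (Fin d) ℤ} (hF : F ∈ stabilizer M H (S.rep p.succ)) {E : GL (Fin d) ℤ}
    (hE : E ∈ S.Γ p.succ) :
    E.val *ᵥ (F.val *ᵥ S.rep p.succ - S.rep p.succ) =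
      F.val *ᵥ S.rep p.succ - S.rep p.succ := by
  have hu : IsUnit (toReal M).det := by
    rw [toReal_det]; exact (Int.cast_ne_zero.2 hM).isUnit
  have h1 := hS p.succ (Fin.succ_ne_zero p) F hF E hE
  simp only [stabShift] at h1
  have h2 := congrArg (act (toReal M)) h1
  rw [← act_mul, ← act_mul, ← act_mul, Matrix.mul_nonsing_inv _ hu, act_one, Matrix.mul_assoc,
    Matrix.mul_assoc, Matrix.mul_assoc, Matrix.mul_nonsing_inv _ hu, Matrix.mul_one,
    ← Matrix.mul_assoc, Matrix.mul_nonsing_inv _ hu, Matrix.one_mul, ← intVec_mulVec] at h2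
  exact (intVec_injective h2).symm

/-- The action of `H` on the digits. -/
lemma CyclicNumbering.exists_shift (C : CyclicNumbering S) (hM : M.det ≠ 0)
    (hH : IsSymmetryGroup M H) (hab : ∀ E ∈ H, ∀ F ∈ H, E * F = F * E)
    (hS : SpecialAssumption S) {E : GL (Fin d) ℤ} (hE : E ∈ H) (p : Fin S.q) :
    ∃ (k : C.Idx p) (r : Fin d → ℤ), ∀ i : C.Idx p,
      E.val *ᵥ ((C.E p i).val *ᵥ S.rep p.succ) =
        (C.E p (i + k)).val *ᵥ S.rep p.succ + M *ᵥ r := by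
  -- With `E = E^(k) F`, the factor `E^(k)` gives the translation by `k` and the stabilizer element
  -- `F` gives the shift `r`.
  obtain ⟨⟨A, F⟩, ⟨hA, hF, hEAF⟩, -⟩ := S.transversal p.succ E hE
  simp only at hA hF hEAF
  obtain ⟨k, -, rfl⟩ := (C.bij p).surjOn hA
  obtain ⟨r, hr⟩ := hF.2
  set s := S.rep p.succ with hs
  have hfix : ∀ G ∈ stabilizer M H s, ∀ i, (C.E p i).val *ᵥ (G.val *ᵥ s - s) = G.val *ᵥ s - s :=
    fun G hG i => hS.fixed hM hG ((C.bij p).mapsTo (Set.mem_univ i))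
  -- The numbering only gives `E^(i) E^(k) s ≡ E^(i+k) s` modulo `M`; equality is needed to make the
  -- shift independent of `i`.
  have hadd : ∀ i, (C.E p i * C.E p k).val *ᵥ s = (C.E p (i + k)).val *ᵥ s := by
    intro i
    set F' := (C.E p (i + k))⁻¹ * (C.E p i * C.E p k) with hF'
    have hF's : F' ∈ stabilizer M H s := C.add p i k
    set v := F'.val *ᵥ s - s with hv
    -- `F'` is built from elements of `Γ p` and the inverse of one, and all elements of `Γ p` fix
    -- `v` by the special assumption.
    have hFv : F'.val *ᵥ v = v := by
      have h1 : (C.E p (i + k) * F').val *ᵥ v = v := by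
        rw [hF', mul_inv_cancel_left, GL_mul_mulVec, hfix F' hF's, hfix F' hF's]
      have h2 : (C.E p (i + k))⁻¹.val *ᵥ v = v := by
        conv_lhs => rw [hv, ← hfix F' hF's (i + k)]
        rw [← GL_mul_mulVec, inv_mul_cancel, GL_one_mulVec]
      rw [GL_mul_mulVec] at h1
      have h3 := congrArg (fun w => (C.E p (i + k))⁻¹.val *ᵥ w) h1
      simp only [h2] at h3
      rwa [← GL_mul_mulVec, inv_mul_cancel, GL_one_mulVec] at h3
    -- Since `F' s = s + v` and `F' v = v`, the powers of `F'` translate `s` by multiples of `v`.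
    -- Finite order of `F'` then forces `v = 0`.
    have hpow : ∀ a : ℕ, (F' ^ a).val *ᵥ s = s + a • v := by
      intro a
      induction a with
      | zero => simp
      | succ a ih =>
        rw [pow_succ', GL_mul_mulVec, ih, Matrix.mulVec_add, Matrix.mulVec_smul, hFv, hv, add_smul]
        abel
    have := hH.1
    have hfin : IsOfFinOrder (⟨F', hF's.1⟩ : H) := isOfFinOrder_of_finite _
    obtain ⟨a, ha, hFa⟩ := hfin.exists_pow_eq_one
    have hFa' : F' ^ a = 1 := by simpa using congrArg Subtype.val hFa
    have h4 := hpow a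
    rw [hFa', GL_one_mulVec, left_eq_add] at h4
    have hv0 : v = 0 := (smul_eq_zero.1 h4).resolve_left ha.ne'
    have h5 : F'.val *ᵥ s = s := sub_eq_zero.1 hv0
    have h6 : C.E p i * C.E p k = C.E p (i + k) * F' := by rw [hF', mul_inv_cancel_left]
    rw [h6, GL_mul_mulVec, h5]
  refine ⟨k, r, fun i => ?_⟩
  -- Commutativity of `H` puts `F` next to `s`. The vector `F s - s = M r` is fixed by `E^(k)` and
  -- `E^(i)`, so the same `r` appears for every `i`.
  have hcomm : E * C.E p i = C.E p i * C.E p k * F := by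
    rw [hab E hE _ (C.E_mem p i), hEAF, mul_assoc]
  rw [← GL_mul_mulVec, hcomm, GL_mul_mulVec]
  have hFs : F.val *ᵥ s = s + (F.val *ᵥ s - s) := by abel
  rw [hFs, Matrix.mulVec_add, hadd, GL_mul_mulVec, hfix F hF, hfix F hF, hr]

end Orbits

/-! ### Discrete Fourier transform matrices: unitarity and translation of indices. -/

section DFT

lemma dft_apply (N : ℕ+) (k l : ZMod N) :
    dft N k l = (1 / Real.sqrt (N : ℕ) : ℂ) * ZMod.stdAddChar (k * l) := by
  rw [dft, Matrix.of_apply]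
  congr 1
  have h : k * l = (((k.val * l.val : ℕ) : ℤ) : ZMod N) := by simp
  rw [h, ZMod.stdAddChar_coe, ← Complex.exp_nat_mul]
  congr 1
  push_cast
  ring

lemma dft_add (N : ℕ+) (k a l : ZMod N) :
    dft N (k + a) l = ZMod.stdAddChar (a * l) * dft N k l := by
  rw [dft_apply, dft_apply, add_mul, AddChar.map_add_eq_mul]
  ring

lemma norm_stdAddChar (N : ℕ+) (k : ZMod N) : ‖(ZMod.stdAddChar k : ℂ)‖ = 1 := by
  rw [ZMod.stdAddChar_apply, Circle.norm_coe]

lemma dft_orthogonal (N : ℕ+) (k l : ZMod N) :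
    ∑ x, dft N x k * (starRingEnd ℂ) (dft N x l) = if k = l then 1 else 0 := by
  have h1 : ∀ x, dft N x k * (starRingEnd ℂ) (dft N x l) =
      (1 / (N : ℕ) : ℂ) * ZMod.stdAddChar (x * (k - l)) := by
    intro x
    have hc : (starRingEnd ℂ) (ZMod.stdAddChar (x * l)) = ZMod.stdAddChar (-(x * l)) := by
      rw [AddChar.map_neg_eq_inv, ← Complex.inv_eq_conj (norm_stdAddChar N _)]
    have hN : ((Real.sqrt (N : ℕ) : ℂ)) * Real.sqrt (N : ℕ) = (N : ℕ) := by
      exact_mod_cast Real.mul_self_sqrt (Nat.cast_nonneg (N : ℕ))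
    rw [dft_apply, dft_apply, map_mul (starRingEnd ℂ), hc, mul_sub, sub_eq_add_neg, AddChar.map_add_eq_mul,
      map_div₀, map_one, Complex.conj_ofReal, ← hN]
    ring
  simp_rw [h1, ← Finset.mul_sum]
  rw [AddChar.sum_mulShift _ (ZMod.isPrimitive_stdAddChar _)]
  simp only [sub_eq_zero, ZMod.card]
  split_ifs
  · rw [one_div]; exact inv_mul_cancel₀ (Nat.cast_ne_zero.2 N.ne_zero)
  · simp

variable {d : ℕ} {M : Matrix (Fin d) (Fin d) ℤ} {H : Subgroup (GL (Fin d) ℤ)}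
  {S : OrbitSystem M H}

lemma CyclicNumbering.kronDFT_conjTranspose_mul (C : CyclicNumbering S) (p : Fin S.q) :
    (C.kronDFT p)ᴴ * C.kronDFT p = 1 := by
  ext k l
  have h1 : ∀ x, star (C.kronDFT p x k) * C.kronDFT p x l =
      ∏ j, dft (C.N p j) (x j) (l j) * (starRingEnd ℂ) (dft (C.N p j) (x j) (k j)) := by
    intro x
    rw [Finset.prod_mul_distrib, ← map_prod, mul_comm]
    rfl
  rw [Matrix.mul_apply]
  simp only [Matrix.conjTranspose_apply, h1]
  -- The sum over the product index group of a product of factors is the product of the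
  -- one-dimensional sums.
  have h2 := (Finset.prod_univ_sum (fun _ => Finset.univ) (fun j (y : ZMod (C.N p j)) =>
    dft (C.N p j) y (l j) * (starRingEnd ℂ) (dft (C.N p j) y (k j)))).symm
  rw [Fintype.piFinset_univ] at h2
  rw [h2]
  simp only [dft_orthogonal]
  by_cases hkl : k = l
  · subst hkl; simp
  · rw [Matrix.one_apply_ne hkl]
    obtain ⟨j, hj⟩ := Function.ne_iff.1 hkl
    exact Finset.prod_eq_zero (Finset.mem_univ j) (if_neg (Ne.symm hj))

lemma CyclicNumbering.blockW_unitary (C : CyclicNumbering S) : (C.blockWᴴ)ᴴ * C.blockWᴴ = 1 := by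
  rw [Matrix.conjTranspose_conjTranspose, mul_eq_one_comm, blockW,
    Matrix.blockDiagonal'_conjTranspose, ← Matrix.blockDiagonal'_mul]
  simp only [C.kronDFT_conjTranspose_mul]
  exact Matrix.blockDiagonal'_one

/-- The columns of `𝒲_p` are characters of the index group: a translation of the row index costs a
phase that depends on the column only. This makes the rows of `𝒲_p^*` eigenvectors of translations.
-/
lemma CyclicNumbering.kronDFT_add (C : CyclicNumbering S) (p : Fin S.q) (k i l : C.Idx p) :
    C.kronDFT p (i + k) l = (∏ j, ZMod.stdAddChar (k j * l j)) * C.kronDFT p i l := by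
  simp only [kronDFT, Matrix.of_apply, Pi.add_apply, dft_add, Finset.prod_mul_distrib]

end DFT

/-! ### Functions vanishing to a given order at a point. -/

section Vanishing

variable {d : ℕ}

/-- Smooth complex functions on `ℝ^d`. -/
abbrev Smooth (f : V d → ℂ) : Prop := ContDiff ℝ (⊤ : ℕ∞) f

lemma Smooth.differentiable {f : V d → ℂ} (hf : Smooth f) : Differentiable ℝ f :=
  ContDiff.differentiable hf (by simp)

lemma Smooth.pderiv_eq {f : V d → ℂ} (hf : Smooth f) (j : Fin d) :
    pderiv j f = fun x => fderiv ℝ f x (EuclideanSpace.single j (1 : ℝ)) := by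
  ext x
  exact (hf.differentiable x).lineDeriv_eq_fderiv

lemma Smooth.pderiv {f : V d → ℂ} (hf : Smooth f) (j : Fin d) : Smooth (pderiv j f) := by
  rw [hf.pderiv_eq]
  exact (hf.fderiv_right (m := (⊤ : ℕ∞)) (by simp)).clm_apply contDiff_const

lemma pderiv_comm {f : V d → ℂ} (hf : Smooth f) (i j : Fin d) :
    pderiv i (pderiv j f) = pderiv j (pderiv i f) := by
  rw [(hf.pderiv j).pderiv_eq, (hf.pderiv i).pderiv_eq, hf.pderiv_eq, hf.pderiv_eq]
  ext x
  have hd : DifferentiableAt ℝ (fderiv ℝ f) x :=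
    ((hf.fderiv_right (m := (⊤ : ℕ∞)) (by simp)).differentiable (by simp)) x
  rw [fderiv_clm_apply hd (differentiableAt_const _), fderiv_clm_apply hd (differentiableAt_const _)]
  have hsymm := (hf.contDiffAt (x := x)).isSymmSndFDerivAt (by
    rw [minSmoothness_of_isRCLikeNormedField]; exact WithTop.coe_le_coe.2 (le_top (a := (2 : ℕ∞))))
  simpa using hsymm (EuclideanSpace.single i 1) (EuclideanSpace.single j 1)

lemma pderiv_add {f g : V d → ℂ} (hf : Smooth f) (hg : Smooth g) (j : Fin d) :
    pderiv j (fun x => f x + g x) = fun x => pderiv j f x + pderiv j g x := by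
  rw [Smooth.pderiv_eq (hf.add hg), hf.pderiv_eq, hg.pderiv_eq]
  ext x
  rw [fderiv_fun_add (hf.differentiable x) (hg.differentiable x)]
  rfl

lemma pderiv_mul {f g : V d → ℂ} (hf : Smooth f) (hg : Smooth g) (j : Fin d) :
    pderiv j (fun x => f x * g x) = fun x => pderiv j f x * g x + f x * pderiv j g x := by
  rw [Smooth.pderiv_eq (hf.mul hg), hf.pderiv_eq, hg.pderiv_eq]
  ext x
  rw [fderiv_fun_mul (hf.differentiable x) (hg.differentiable x)]
  simp
  ring

lemma Smooth.conj {f : V d → ℂ} (hf : Smooth f) : Smooth (fun x => (starRingEnd ℂ) (f x)) :=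
  Complex.conjCLE.contDiff.comp hf

lemma pderiv_conj {f : V d → ℂ} (hf : Smooth f) (j : Fin d) :
    pderiv j (fun x => (starRingEnd ℂ) (f x)) = fun x => (starRingEnd ℂ) (pderiv j f x) := by
  rw [Smooth.pderiv_eq hf.conj, hf.pderiv_eq]
  ext x
  have := (Complex.conjCLE.toContinuousLinearMap.hasFDerivAt.comp x
    (hf.differentiable x).hasFDerivAt).fderiv
  have h2 : fderiv ℝ (fun x => (starRingEnd ℂ) (f x)) x =
    Complex.conjCLE.toContinuousLinearMap.comp (fderiv ℝ f x) := this
  rw [h2]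
  rfl

lemma Smooth.comp_affine {f : V d → ℂ} (hf : Smooth f) (A : Matrix (Fin d) (Fin d) ℝ) (b : V d) :
    Smooth (fun x => f (act A x + b)) :=
  ContDiff.comp hf (((Matrix.toEuclideanCLM (n := Fin d) (𝕜 := ℝ) A).contDiff).add contDiff_const)

lemma act_single (A : Matrix (Fin d) (Fin d) ℝ) (j : Fin d) :
    act A (EuclideanSpace.single j 1) = ∑ i, A i j • EuclideanSpace.single i (1 : ℝ) := by
  ext k
  simp [act, Finset.sum_apply, Pi.single_apply]

lemma pderiv_comp_affine {f : V d → ℂ} (hf : Smooth f) (A : Matrix (Fin d) (Fin d) ℝ) (b : V d)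
    (j : Fin d) :
    pderiv j (fun x => f (act A x + b)) =
      fun x => ∑ i, (A i j : ℂ) * pderiv i f (act A x + b) := by
  rw [Smooth.pderiv_eq (hf.comp_affine A b)]
  ext x
  have h1 : HasFDerivAt (fun x : V d => act A x + b)
      (Matrix.toEuclideanCLM (n := Fin d) (𝕜 := ℝ) A) x :=
    (Matrix.toEuclideanCLM (n := Fin d) (𝕜 := ℝ) A).hasFDerivAt.add_const b
  have h2 := ((hf.differentiable (act A x + b)).hasFDerivAt.comp x h1).fderiv
  have h3 : fderiv ℝ (fun x => f (act A x + b)) x =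
    (fderiv ℝ f (act A x + b)).comp (Matrix.toEuclideanCLM (n := Fin d) (𝕜 := ℝ) A) := h2
  rw [h3, ContinuousLinearMap.comp_apply, ← act_eq_clm, act_single, map_sum]
  refine Finset.sum_congr rfl fun i _ => ?_
  rw [map_smul, hf.pderiv_eq, Complex.real_smul]

/-- All partial derivatives of order less than `n` vanish at `x`. -/
def VanishesTo : ℕ → V d → (V d → ℂ) → Prop
  | 0, _, _ => True
  | n + 1, x, f => f x = 0 ∧ ∀ j, VanishesTo n x (pderiv j f)

lemma VanishesTo.of_succ {n : ℕ} {x : V d} {f : V d → ℂ} (h : VanishesTo (n + 1) x f) :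
    VanishesTo n x f := by
  induction n generalizing f with
  | zero => trivial
  | succ n ih => exact ⟨h.1, fun j => ih (h.2 j)⟩

lemma VanishesTo.mono {n k : ℕ} (hk : k ≤ n) {x : V d} {f : V d → ℂ} (h : VanishesTo n x f) :
    VanishesTo k x f := by
  induction n, hk using Nat.le_induction with
  | base => exact h
  | succ n _ ih => exact ih h.of_succ

lemma VanishesTo.add {n : ℕ} {x : V d} {f g : V d → ℂ} (hf : Smooth f) (hg : Smooth g)
    (h : VanishesTo n x f) (h' : VanishesTo n x g) : VanishesTo n x (fun y => f y + g y) := by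
  induction n generalizing f g with
  | zero => trivial
  | succ n ih =>
    refine ⟨by simp [h.1, h'.1], fun j => ?_⟩
    rw [pderiv_add hf hg]
    exact ih (hf.pderiv j) (hg.pderiv j) (h.2 j) (h'.2 j)

/-- The recursive form of `VanishesTo` suits this induction: Leibniz' rule produces `∂g · f`,
handled by lowering the order of `f`, and `g · ∂f`. -/
lemma VanishesTo.mul_left {n : ℕ} {x : V d} {f g : V d → ℂ} (hf : Smooth f) (hg : Smooth g)
    (h : VanishesTo n x f) : VanishesTo n x (fun y => g y * f y) := by
  induction n generalizing f g with
  | zero => trivial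
  | succ n ih =>
    refine ⟨by simp [h.1], fun j => ?_⟩
    rw [pderiv_mul hg hf]
    exact VanishesTo.add ((hg.pderiv j).mul hf) (hg.mul (hf.pderiv j))
      (ih hf (hg.pderiv j) h.of_succ) (ih (hf.pderiv j) hg (h.2 j))

lemma VanishesTo.const_mul {n : ℕ} {x : V d} {f : V d → ℂ} (hf : Smooth f)
    (h : VanishesTo n x f) (a : ℂ) : VanishesTo n x (fun y => a * f y) :=
  h.mul_left hf contDiff_const

lemma vanishesTo_zero (n : ℕ) (x : V d) : VanishesTo n x (fun _ => 0) := by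
  induction n with
  | zero => trivial
  | succ n ih =>
    refine ⟨rfl, fun j => ?_⟩
    have : pderiv j (fun _ : V d => (0 : ℂ)) = fun _ => 0 := by
      rw [Smooth.pderiv_eq contDiff_const]; ext; simp
    rw [this]
    exact ih

lemma VanishesTo.sum {n : ℕ} {x : V d} {J : Type*} (s : Finset J) {f : J → V d → ℂ}
    (hf : ∀ j ∈ s, Smooth (f j)) (h : ∀ j ∈ s, VanishesTo n x (f j)) :
    VanishesTo n x (fun y => ∑ j ∈ s, f j y) := by
  classical
  induction s using Finset.induction_on with
  | empty => simpa using vanishesTo_zero n x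
  | insert a s ha ih =>
    simp only [Finset.sum_insert ha]
    have hf' : ∀ j ∈ s, Smooth (f j) := fun j hj => hf j (Finset.mem_insert_of_mem hj)
    exact VanishesTo.add (hf a (Finset.mem_insert_self a s)) (ContDiff.sum hf')
      (h a (Finset.mem_insert_self a s)) (ih hf' fun j hj => h j (Finset.mem_insert_of_mem hj))

lemma VanishesTo.conj {n : ℕ} {x : V d} {f : V d → ℂ} (hf : Smooth f)
    (h : VanishesTo n x f) : VanishesTo n x (fun y => (starRingEnd ℂ) (f y)) := by
  induction n generalizing f with
  | zero => trivial
  | succ n ih =>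
    refine ⟨by simp [h.1], fun j => ?_⟩
    rw [pderiv_conj hf]
    exact ih (hf.pderiv j) (h.2 j)

lemma VanishesTo.comp_affine {n : ℕ} {x : V d} {f : V d → ℂ} (hf : Smooth f)
    (A : Matrix (Fin d) (Fin d) ℝ) (b : V d) (h : VanishesTo n (act A x + b) f) :
    VanishesTo n x (fun y => f (act A y + b)) := by
  induction n generalizing f with
  | zero => trivial
  | succ n ih =>
    refine ⟨h.1, fun j => ?_⟩
    rw [pderiv_comp_affine hf]
    exact VanishesTo.sum _ (fun i _ => contDiff_const.mul ((hf.pderiv i).comp_affine A b))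
      fun i _ => (ih (hf.pderiv i) (h.2 i)).const_mul ((hf.pderiv i).comp_affine A b) _

lemma VanishesTo.iterate {n k : ℕ} {x : V d} {f : V d → ℂ} (j : Fin d)
    (h : VanishesTo (n + k) x f) : VanishesTo n x ((pderiv j)^[k] f) := by
  induction k generalizing f with
  | zero => exact h
  | succ k ih => exact ih (h.2 j)

/-- Each partial derivative uses up one order of vanishing. -/
lemma VanishesTo.multiDeriv_eq_zero {n : ℕ} {x : V d} {f : V d → ℂ} (h : VanishesTo n x f)
    {β : Fin d → ℕ} (hβ : ∑ j, β j < n) : multiDeriv β f x = 0 := by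
  have key : ∀ (l : List (Fin d)) (k : ℕ), VanishesTo (k + (l.map β).sum) x f →
      VanishesTo k x (l.foldr (fun j g => (pderiv j)^[β j] g) f) := by
    intro l
    induction l with
    | nil => intro k hk; simpa using hk
    | cons i l ih =>
      intro k hk
      rw [List.foldr_cons]
      refine VanishesTo.iterate i (ih (k + β i) ?_)
      simpa [add_assoc] using hk
  have hsum : ((List.finRange d).map β).sum = ∑ j, β j := by
    rw [← List.sum_ofFn, List.ofFn_eq_map]
  -- Order `1` must be left after all derivatives: it is the vanishing of the value itself.
  exact (key (List.finRange d) 1 (h.mono (by rw [hsum]; omega))).1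

lemma smooth_iterate {f : V d → ℂ} (hf : Smooth f) (j : Fin d) (k : ℕ) :
    Smooth ((pderiv j)^[k] f) := by
  induction k generalizing f with
  | zero => exact hf
  | succ k ih => exact ih (hf.pderiv j)

lemma pderiv_iterate_comm {f : V d → ℂ} (hf : Smooth f) (i j : Fin d) (k : ℕ) :
    pderiv i ((pderiv j)^[k] f) = (pderiv j)^[k] (pderiv i f) := by
  induction k generalizing f with
  | zero => rfl
  | succ k ih => rw [Function.iterate_succ_apply, Function.iterate_succ_apply,
      ih (hf.pderiv j), pderiv_comm hf]

/-- `multiDeriv` differentiates in a fixed order of the coordinates, so the additional derivative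
has to be commuted to its place. -/
lemma pderiv_multiDeriv {f : V d → ℂ} (hf : Smooth f) (j : Fin d) (β : Fin d → ℕ) :
    pderiv j (multiDeriv β f) = multiDeriv (β + Pi.single j 1) f := by
  have hsm : ∀ l : List (Fin d), Smooth (l.foldr (fun j g => (pderiv j)^[β j] g) f) := by
    intro l
    induction l with
    | nil => exact hf
    | cons i l ih => exact smooth_iterate ih i _
  have hnot : ∀ l : List (Fin d), j ∉ l →
      l.foldr (fun i g => (pderiv i)^[(β + Pi.single j 1 : Fin d → ℕ) i] g) f =
        l.foldr (fun i g => (pderiv i)^[β i] g) f := by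
    intro l
    induction l with
    | nil => intro _; rfl
    | cons i l ih =>
      intro hj
      rw [List.mem_cons, not_or] at hj
      rw [List.foldr_cons, List.foldr_cons, ih hj.2]
      simp [Ne.symm hj.1]
  have key : ∀ l : List (Fin d), l.Nodup → j ∈ l →
      pderiv j (l.foldr (fun i g => (pderiv i)^[β i] g) f) =
        l.foldr (fun i g => (pderiv i)^[(β + Pi.single j 1 : Fin d → ℕ) i] g) f := by
    intro l
    induction l with
    | nil => intro _ h; simp at h
    | cons i l ih =>
      intro hn hj
      rw [List.nodup_cons] at hn
      rw [List.foldr_cons, List.foldr_cons]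
      by_cases hij : j = i
      · subst hij
        rw [hnot l hn.1, Pi.add_apply, Pi.single_eq_same, Function.iterate_succ_apply']
      · rw [pderiv_iterate_comm (hsm l), ih hn.2 ((List.mem_cons.1 hj).resolve_left hij)]
        simp [Pi.single_apply, Ne.symm hij]
  exact key _ (List.nodup_finRange d) (List.mem_finRange j)

lemma vanishesTo_of_multiDeriv {n : ℕ} {x : V d} {f : V d → ℂ} (hf : Smooth f)
    (h : ∀ β : Fin d → ℕ, ∑ j, β j < n → multiDeriv β f x = 0) : VanishesTo n x f := by
  have key : ∀ (k : ℕ) (β : Fin d → ℕ), k + ∑ j, β j ≤ n → VanishesTo k x (multiDeriv β f) := by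
    intro k
    induction k with
    | zero => intro _ _; trivial
    | succ k ih =>
      intro β hβ
      refine ⟨h β (by omega), fun j => ?_⟩
      rw [pderiv_multiDeriv hf]
      refine ih _ ?_
      simp only [Pi.add_apply, Finset.sum_add_distrib, Finset.sum_pi_single', Finset.mem_univ,
        if_true]
      omega
  have h0 : multiDeriv (0 : Fin d → ℕ) f = f := by
    have : ∀ l : List (Fin d), l.foldr (fun j g => (pderiv j)^[(0 : Fin d → ℕ) j] g) f = f := by
      intro l
      induction l with
      | nil => rfl
      | cons i l ih => rw [List.foldr_cons, ih]; rfl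
    exact this _
  simpa [h0] using key n 0 (by simp)

end Vanishing

/-! ### Vanishing moments and symmetry of the masks of a general matrix extension. -/

section Moments

variable {d : ℕ} {I : Type} [Fintype I] {M : Matrix (Fin d) (Fin d) ℤ}
  {s : Unit ⊕ I → Fin d → ℤ} {m₀ : V d → ℂ} {μ : Unit ⊕ I → V d → ℂ}
  {Dst : Finset (Fin d → ℤ)} {n : ℕ}

/-- The sum rule concerns `m₀ ∘ M^{*-1}` at `u`. Composition with the affine map `ξ ↦ M^* ξ + u`
moves the statement to the origin. -/
lemma HasSumRule.vanishesTo (hM : M.det ≠ 0) (hm₀ : IsTrigPoly m₀) (hsum : HasSumRule M Dst n m₀)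
    {u : Fin d → ℤ} (hu : u ∈ Dst) (hu0 : u ≠ 0) :
    VanishesTo n 0 (fun ξ => m₀ (ξ + act (toReal M)ᵀ⁻¹ (intVec u))) := by
  have hsm : Smooth (fun ξ => m₀ (act (toReal M)ᵀ⁻¹ ξ)) := by
    simpa using Smooth.comp_affine hm₀.contDiff (toReal M)ᵀ⁻¹ 0
  have h1 := vanishesTo_of_multiDeriv hsm (hsum u hu hu0)
  have h2 := VanishesTo.comp_affine (x := 0) hsm (toReal M)ᵀ (intVec u)
    (by rwa [act_zero, zero_add])
  simpa only [act_add, act_transpose_inv_act hM] using h2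

lemma smooth_shift (hm₀ : IsTrigPoly m₀) (b : V d) : Smooth (fun ξ => m₀ (ξ + b)) := by
  simpa only [act_one] using Smooth.comp_affine hm₀.contDiff 1 b

lemma interpolatory_eq (hD : IsDigitSet Mᵀ Dst) (hint : IsInterpolatory M Dst m₀) (ξ : V d) :
    1 - m₀ ξ = ∑ u ∈ Dst.erase 0, m₀ (ξ + act (toReal M)ᵀ⁻¹ (intVec u)) := by
  rw [← hint ξ, ← Finset.add_sum_erase _ _ hD.1, intVec_zero, act_zero, add_zero,
    add_sub_cancel_left]

/-- By interpolation `1 - m₀` is the sum of the nontrivial translates of `m₀`, and the sum rule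
applies to each of them. -/
lemma vanishesTo_one_sub (hM : M.det ≠ 0) (hm₀ : IsTrigPoly m₀) (hD : IsDigitSet Mᵀ Dst)
    (hint : IsInterpolatory M Dst m₀) (hsum : HasSumRule M Dst n m₀) :
    VanishesTo n 0 (fun ξ => 1 - m₀ ξ) := by
  simp only [interpolatory_eq hD hint]
  exact VanishesTo.sum _ (fun u _ => smooth_shift hm₀ _) fun u hu =>
    hsum.vanishesTo hM hm₀ (Finset.mem_of_mem_erase hu) (Finset.ne_of_mem_erase hu)

/-- This is where the sum rule reaches the polyphase components. The inversion formula writes `√m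
μ_i(M^* ξ) e(s_i)` as a sum of translates of `m₀` with constant coefficients. Subtracting the
interpolation identity removes the translate by `0`, and all the others vanish to order `n`. -/
lemma vanishesTo_expo_sub (hM : M.det ≠ 0) (hm₀ : IsTrigPoly m₀) (hD : IsDigitSet Mᵀ Dst)
    (hint : IsInterpolatory M Dst m₀) (hsum : HasSumRule M Dst n m₀) (hs : IsDigits M s)
    (hμ : IsPolyphase M s m₀ μ) (i : Unit ⊕ I) :
    VanishesTo n 0 (fun ξ => expo (s i) ξ -
      Real.sqrt (absDet M) * (starRingEnd ℂ) (μ i (act (toReal M)ᵀ ξ))) := by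
  set Q : V d → ℂ := fun ξ => ∑ u ∈ Dst.erase 0,
    (expo (-s i) (act (toReal M)ᵀ⁻¹ (intVec u)) - 1) *
      m₀ (ξ + act (toReal M)ᵀ⁻¹ (intVec u)) with hQ
  have hQs : Smooth Q := ContDiff.sum fun u _ => contDiff_const.mul (smooth_shift hm₀ _)
  have hQv : VanishesTo n 0 Q := VanishesTo.sum _
    (fun u _ => contDiff_const.mul (smooth_shift hm₀ _)) fun u hu =>
    (hsum.vanishesTo hM hm₀ (Finset.mem_of_mem_erase hu) (Finset.ne_of_mem_erase hu)).const_mul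
      (smooth_shift hm₀ _) _
  have hQe : ∀ ξ, Q ξ = Real.sqrt (absDet M) * μ i (act (toReal M)ᵀ ξ) * expo (s i) ξ - 1 := by
    intro ξ
    have h1 := sum_fromPolyphase_mul_expo hM hs hD.isDigits
      (fun j ξ k => (hμ.1 j).add_intVec k ξ) i ξ
    simp only [← hμ.2] at h1
    rw [Finset.sum_coe_sort Dst (fun u => m₀ (ξ + act (toReal M)ᵀ⁻¹ (intVec u)) *
      expo (-s i) (ξ + act (toReal M)ᵀ⁻¹ (intVec u)))] at h1
    have h2 := hint ξ
    rw [← h1, ← h2, Finset.sum_mul, ← Finset.sum_sub_distrib, hQ,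
      ← Finset.add_sum_erase Dst _ hD.1]
    simp only [intVec_zero, act_zero, add_zero]
    have h3 : m₀ ξ * expo (-s i) ξ * expo (s i) ξ - m₀ ξ = 0 := by
      have := expo_mul_neg (s i) ξ
      linear_combination m₀ ξ * this
    rw [h3, zero_add]
    refine Finset.sum_congr rfl fun u _ => ?_
    rw [expo_add_right]
    have := expo_mul_neg (s i) ξ
    linear_combination (-m₀ (ξ + act (toReal M)ᵀ⁻¹ (intVec u)) *
      expo (-s i) (act (toReal M)ᵀ⁻¹ (intVec u))) * this
  -- Conjugating `Q` and multiplying by `-e(s_i)` turns `√m μ_i e(s_i) - 1` into `e(s_i) - √m conj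
  -- μ_i`.
  have h4 := (hQv.conj hQs).mul_left (g := fun ξ => (-1) * expo (s i) ξ) hQs.conj
    (contDiff_const.mul (isTrigPoly_expo _).contDiff)
  convert h4 using 2 with ξ
  rw [hQe]
  simp only [map_sub, map_mul, conj_expo, Complex.conj_ofReal, map_one]
  have := expo_mul_neg (s i) ξ
  linear_combination (Real.sqrt (absDet M) * (starRingEnd ℂ) (μ i (act (toReal M)ᵀ ξ))) * this

lemma polyphase_apply_zero (hM : M.det ≠ 0) (hm₀ : IsTrigPoly m₀) (hD : IsDigitSet Mᵀ Dst)
    (hint : IsInterpolatory M Dst m₀) (hn : 0 < n) (hsum : HasSumRule M Dst n m₀)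
    (hs : IsDigits M s) (hμ : IsPolyphase M s m₀ μ) (i : Unit ⊕ I) :
    μ i 0 = 1 / Real.sqrt (absDet M) := by
  have h1 := ((vanishesTo_expo_sub hM hm₀ hD hint hsum hs hμ i).mono
    (k := 0 + 1) (by omega)).1
  beta_reduce at h1
  rw [expo_zero_right, act_zero, sub_eq_zero] at h1
  have h2 := congrArg (starRingEnd ℂ) h1
  simp only [map_mul, map_one, Complex.conj_ofReal, Complex.conj_conj] at h2
  rw [eq_div_iff (sqrt_absDet_ne_zero hM), mul_comm]
  exact h2.symm

/-- There are `m - 1` nonzero digits, each with `|μ_i(0)|² = 1/m`, and `1 - (m - 1)/m + 1 - 1/m =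
1`. -/
lemma fromPolyphase_dualPolyphase_zero (hM : M.det ≠ 0) (hm₀ : IsRefinableMask m₀)
    (hD : IsDigitSet Mᵀ Dst) (hint : IsInterpolatory M Dst m₀) (hn : 0 < n)
    (hsum : HasSumRule M Dst n m₀) (hs : IsDigits M s) (hs0 : s (Sum.inl ()) = 0)
    (hμ : IsPolyphase M s m₀ μ) : fromPolyphase M s (dualPolyphase M μ) 0 = 1 := by
  have hm := absDet_pos hM
  rw [fromPolyphase_dualPolyphase hM hs0 hμ
    (polyphase_zero_of_interpolatory hM hs hs0 hD hint hμ), act_zero, hm₀.2]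
  simp only [polyphase_apply_zero hM hm₀.1 hD hint hn hsum hs hμ]
  have h1 : ((‖(1 / Real.sqrt (absDet M) : ℂ)‖ : ℂ)) ^ 2 = 1 / absDet M := by
    rw [norm_div, norm_one, Complex.norm_real, Real.norm_of_nonneg (Real.sqrt_nonneg _)]
    norm_cast
    rw [div_pow, one_pow, Real.sq_sqrt hm.le]
  have h2 := hs.card hM
  rw [Fintype.card_sum, Fintype.card_unit] at h2
  have h3 : (Fintype.card I : ℂ) = absDet M - 1 := by
    rw [absDet, ← h2]; push_cast; ring
  have hm' : (absDet M : ℂ) ≠ 0 := by exact_mod_cast hm.ne'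
  rw [h1, Finset.sum_const, Finset.card_univ, nsmul_eq_mul, h3]
  field_simp
  ring

/-- Let `R = ∑ U_νj (e(s_j) - √m conj μ_j(M^*·))`. The dual mask is `R/m`, and the primal mask is `R
+ a (1 - m₀)` with `a = √m ∑ U_νj conj μ_j(M^*·)`. The matrix `U` may be arbitrary here. -/
lemma hasVanishingMoments_extN [DecidableEq I] (hM : M.det ≠ 0) (hm₀ : IsTrigPoly m₀) (hD : IsDigitSet Mᵀ Dst)
    (hint : IsInterpolatory M Dst m₀) (hsum : HasSumRule M Dst n m₀) (hs : IsDigits M s)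
    (hs0 : s (Sum.inl ()) = 0) (hμ : IsPolyphase M s m₀ μ) (U : Matrix I I ℂ) (ν : I) :
    HasVanishingMoments n (fromPolyphase M s (fun i ξ => extN M μ U ξ (Sum.inr ν) i)) ∧
    HasVanishingMoments n (fromPolyphase M s (fun i ξ => extNDual M μ U ξ (Sum.inr ν) i)) := by
  have h0 := polyphase_zero_of_interpolatory hM hs hs0 hD hint hμ
  have hconj : ∀ i, Smooth (fun ξ => (starRingEnd ℂ) (μ i (act (toReal M)ᵀ ξ))) :=
    fun i => (((hμ.1 i).comp_act M).conj).contDiff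
  have hsm : ∀ i, Smooth (fun ξ => expo (s i) ξ -
      Real.sqrt (absDet M) * (starRingEnd ℂ) (μ i (act (toReal M)ᵀ ξ))) :=
    fun i => ((isTrigPoly_expo _).contDiff).sub (contDiff_const.mul (hconj i))
  set R : V d → ℂ := fun ξ => ∑ j, U ν j * (expo (s (Sum.inr j)) ξ -
      Real.sqrt (absDet M) * (starRingEnd ℂ) (μ (Sum.inr j) (act (toReal M)ᵀ ξ))) with hR
  have hRs : Smooth R := ContDiff.sum fun j _ => contDiff_const.mul (hsm _)
  have hRv : VanishesTo n 0 R := VanishesTo.sum _ (fun j _ => contDiff_const.mul (hsm _))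
    fun j _ => (vanishesTo_expo_sub hM hm₀ hD hint hsum hs hμ _).const_mul (hsm _) _
  have hRe : ∀ ξ, R ξ = ∑ j, U ν j * expo (s (Sum.inr j)) ξ - Real.sqrt (absDet M) *
        (∑ j, U ν j * (starRingEnd ℂ) (μ (Sum.inr j) (act (toReal M)ᵀ ξ))) := by
    intro ξ
    rw [Finset.mul_sum, ← Finset.sum_sub_distrib]
    exact Finset.sum_congr rfl fun j _ => by ring
  constructor
  · intro β hβ
    refine VanishesTo.multiDeriv_eq_zero ?_ hβ
    set a : V d → ℂ := fun ξ => Real.sqrt (absDet M) *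
        (∑ j, U ν j * (starRingEnd ℂ) (μ (Sum.inr j) (act (toReal M)ᵀ ξ))) with ha
    have has : Smooth a :=
      contDiff_const.mul (ContDiff.sum fun j _ => contDiff_const.mul (hconj _))
    have h1s : Smooth (fun ξ => 1 - m₀ ξ) := contDiff_const.sub hm₀.contDiff
    have h1 := hRv.add hRs (has.mul h1s)
      ((vanishesTo_one_sub hM hm₀ hD hint hsum).mul_left h1s has)
    convert h1 using 2 with ξ
    rw [fromPolyphase_extN hM hs0 hμ h0, hRe]
    simp only [ha]
    ring
  · intro β hβ
    refine VanishesTo.multiDeriv_eq_zero ?_ hβ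
    convert hRv.const_mul hRs (1 / absDet M : ℂ) using 2 with ξ
    rw [fromPolyphase_extNDual hM hs0, hRe]

/-- The symmetry of the masks of a row of `U` which is an eigenvector of the permutation. -/
lemma extN_symm [DecidableEq I] (hM : M.det ≠ 0) (hD : IsDigitSet Mᵀ Dst) (hs : IsDigits M s)
    (hs0 : s (Sum.inl ()) = 0) (hμ : IsPolyphase M s m₀ μ)
    (h0 : ∀ ξ, μ (Sum.inl ()) ξ = 1 / Real.sqrt (absDet M))
    {E E' : Matrix (Fin d) (Fin d) ℤ} (hE : E * M = M * E')
    (ht : ∀ ξ, m₀ (act (toReal E)ᵀ ξ) = m₀ ξ) (σ : I ≃ I) {r : I → Fin d → ℤ}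
    (hσ : ∀ j, E *ᵥ s (Sum.inr j) = s (Sum.inr (σ j)) + M *ᵥ r j) (U : Matrix I I ℂ) (ν : I)
    {ε : ℂ} {r₀ : Fin d → ℤ} (hU : ∀ j, U ν j = ε * U ν (σ j)) (hr : ∀ j, U ν j ≠ 0 → r j = r₀)
    (ξ : V d) :
    fromPolyphase M s (fun i ξ => extN M μ U ξ (Sum.inr ν) i) (act (toReal E)ᵀ ξ) =
      ε * expo (M *ᵥ r₀) ξ * fromPolyphase M s (fun i ξ => extN M μ U ξ (Sum.inr ν) i) ξ ∧
    fromPolyphase M s (fun i ξ => extNDual M μ U ξ (Sum.inr ν) i) (act (toReal E)ᵀ ξ) =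
      ε * expo (M *ᵥ r₀) ξ * fromPolyphase M s (fun i ξ => extNDual M μ U ξ (Sum.inr ν) i) ξ := by
  have hpol : ∀ j η, μ (Sum.inr (σ j)) η = expo (r j) η * μ (Sum.inr j) (act (toReal E')ᵀ η) :=
    fun j η => polyphase_of_invariant hM hs hD.isDigits hμ hE ht
      (Equiv.sumCongr (Equiv.refl Unit) σ) (r := Sum.elim (fun _ => 0) r)
      (by rintro (⟨⟩ | j)
          · simp [hs0]
          · simpa using hσ j) (Sum.inr j) η
  have hBE : ∀ ξ, act (toReal M)ᵀ (act (toReal E)ᵀ ξ) =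
      act (toReal E')ᵀ (act (toReal M)ᵀ ξ) := by
    intro ξ
    rw [← act_mul, ← act_mul, ← Matrix.transpose_mul, ← Matrix.transpose_mul, ← toReal_mul,
      ← toReal_mul, hE]
  -- Both sums in the closed forms of the masks acquire the same factor `ε e(M r₀)`. Terms with `U ν
  -- j = 0` need no information on `r j`, since they vanish on both sides.
  have he : ∑ j, U ν j * expo (s (Sum.inr j)) (act (toReal E)ᵀ ξ) =
      ε * expo (M *ᵥ r₀) ξ * ∑ j, U ν j * expo (s (Sum.inr j)) ξ := by
    rw [Finset.mul_sum]
    refine Fintype.sum_equiv σ _ _ fun j => ?_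
    by_cases hj : U ν j = 0
    · have := hU j
      rw [hj, zero_eq_mul] at this
      rcases this with h | h <;> simp [h, hj]
    · rw [← expo_mulVec, hσ, expo_add, hr j hj, hU j]
      ring
  have ha : ∑ j, U ν j * (starRingEnd ℂ)
      (μ (Sum.inr j) (act (toReal M)ᵀ (act (toReal E)ᵀ ξ))) =
      ε * expo (M *ᵥ r₀) ξ *
        ∑ j, U ν j * (starRingEnd ℂ) (μ (Sum.inr j) (act (toReal M)ᵀ ξ)) := by
    rw [Finset.mul_sum]
    refine Fintype.sum_equiv σ _ _ fun j => ?_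
    by_cases hj : U ν j = 0
    · have := hU j
      rw [hj, zero_eq_mul] at this
      rcases this with h | h <;> simp [h, hj]
    · rw [hBE, hpol, map_mul, conj_expo, hr j hj, expo_mulVec, hU j]
      have := expo_mul_neg r₀ (act (toReal M)ᵀ ξ)
      linear_combination (-ε * U ν (σ j) * (starRingEnd ℂ)
        (μ (Sum.inr j) (act (toReal E')ᵀ (act (toReal M)ᵀ ξ)))) * this
  constructor
  · rw [fromPolyphase_extN hM hs0 hμ h0, fromPolyphase_extN hM hs0 hμ h0, he, ha, ht]
    ring
  · rw [fromPolyphase_extNDual hM hs0, fromPolyphase_extNDual hM hs0, he, ha]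
    ring

lemma dualPolyphase_symm (hM : M.det ≠ 0) (hD : IsDigitSet Mᵀ Dst) (hs : IsDigits M s)
    (hs0 : s (Sum.inl ()) = 0) (hμ : IsPolyphase M s m₀ μ)
    (h0 : ∀ ξ, μ (Sum.inl ()) ξ = 1 / Real.sqrt (absDet M))
    {E E' : Matrix (Fin d) (Fin d) ℤ} (hE : E * M = M * E')
    (ht : ∀ ξ, m₀ (act (toReal E)ᵀ ξ) = m₀ ξ) (σ : I ≃ I) {r : I → Fin d → ℤ}
    (hσ : ∀ j, E *ᵥ s (Sum.inr j) = s (Sum.inr (σ j)) + M *ᵥ r j) (ξ : V d) :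
    fromPolyphase M s (dualPolyphase M μ) (act (toReal E)ᵀ ξ) =
      fromPolyphase M s (dualPolyphase M μ) ξ := by
  have hpol : ∀ j η, μ (Sum.inr (σ j)) η = expo (r j) η * μ (Sum.inr j) (act (toReal E')ᵀ η) :=
    fun j η => polyphase_of_invariant hM hs hD.isDigits hμ hE ht
      (Equiv.sumCongr (Equiv.refl Unit) σ) (r := Sum.elim (fun _ => 0) r)
      (by rintro (⟨⟩ | j)
          · simp [hs0]
          · simpa using hσ j) (Sum.inr j) η
  have hBE : act (toReal M)ᵀ (act (toReal E)ᵀ ξ) = act (toReal E')ᵀ (act (toReal M)ᵀ ξ) := by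
    rw [← act_mul, ← act_mul, ← Matrix.transpose_mul, ← Matrix.transpose_mul, ← toReal_mul,
      ← toReal_mul, hE]
  rw [fromPolyphase_dualPolyphase hM hs0 hμ h0, fromPolyphase_dualPolyphase hM hs0 hμ h0, ht, hBE]
  congr 3
  refine Fintype.sum_equiv σ _ _ fun j => ?_
  rw [hpol, norm_mul, norm_expo, one_mul]

end Moments

/-! ### Symmetry of the wavelet masks for `U = 𝒲^*`. -/

section Symmetry

variable {d : ℕ} {M : Matrix (Fin d) (Fin d) ℤ} {H : Subgroup (GL (Fin d) ℤ)}
  {S : OrbitSystem M H} {m₀ : V d → ℂ}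

lemma IsHSymmetric.invariant (hsym : IsHSymmetric H 0 m₀) {E : GL (Fin d) ℤ} (hE : E ∈ H)
    (ξ : V d) : m₀ (act (toReal E.val)ᵀ ξ) = m₀ ξ := by
  obtain ⟨k, hk, h⟩ := hsym E hE
  rw [act_zero, sub_zero, ← intVec_zero] at hk
  rw [h ξ, ← intVec_injective hk, expo_zero, one_mul]

/-- On each orbit `E` translates the digit index by `k p` and shifts by a common `r p`. A row of
`𝒲^*` is supported in one orbit, so only one `r p` matters, and it is an eigenvector of the
translation with a unimodular eigenvalue. -/
lemma CyclicNumbering.masks_symm (C : CyclicNumbering S) (hM : M.det ≠ 0)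
    (hH : IsSymmetryGroup M H) (hab : ∀ E ∈ H, ∀ F ∈ H, E * F = F * E)
    (hS : SpecialAssumption S) {Dst : Finset (Fin d → ℤ)} (hD : IsDigitSet Mᵀ Dst)
    (hsym : IsHSymmetric H 0 m₀) {μ : Unit ⊕ C.WIdx → V d → ℂ} (hμ : IsPolyphase M C.digit m₀ μ)
    (h0 : ∀ ξ, μ (Sum.inl ()) ξ = 1 / Real.sqrt (absDet M)) :
    IsHSymmetric H 0 (C.dualMask μ) ∧ ∀ ν, HasHSymmetryProperty H (C.waveletMask μ ν) ∧
      HasHSymmetryProperty H (C.dualWaveletMask μ ν) := by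
  have hdata : ∀ E ∈ H, ∃ (k : ∀ p, C.Idx p) (r : Fin S.q → Fin d → ℤ), ∀ (p : Fin S.q)
      (i : C.Idx p), E.val *ᵥ C.digit (Sum.inr ⟨p, i⟩) =
        C.digit (Sum.inr ⟨p, i + k p⟩) + M *ᵥ r p := by
    intro E hE
    choose k r h using fun p => C.exists_shift hM hH hab hS hE p
    exact ⟨k, r, h⟩
  have hs := C.isDigits hH
  have hs0 : C.digit (Sum.inl ()) = 0 := rfl
  have hphase : ∀ (p : Fin S.q) (l k : C.Idx p), ‖∏ j, (ZMod.stdAddChar (k j * l j) : ℂ)‖ = 1 := by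
    intro p l k
    rw [norm_prod]
    exact Finset.prod_eq_one fun j _ => norm_stdAddChar _ _
  have hrow : ∀ (k : ∀ p, C.Idx p) (ν j : C.WIdx), C.blockWᴴ ν j =
      (∏ x, ZMod.stdAddChar (k ν.1 x * ν.2 x)) *
        C.blockWᴴ ν (Equiv.sigmaCongrRight (fun p => Equiv.addRight (k p)) j) := by
    rintro k ⟨p, l⟩ ⟨p', i⟩
    simp only [Matrix.conjTranspose_apply, blockW, Equiv.sigmaCongrRight_apply,
      Equiv.coe_addRight]
    by_cases hp : p' = p
    · subst hp
      rw [Matrix.blockDiagonal'_apply_eq, Matrix.blockDiagonal'_apply_eq, C.kronDFT_add, star_mul']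
      have h2 := Complex.mul_conj' (∏ x, (ZMod.stdAddChar (k p' x * l x) : ℂ))
      rw [hphase] at h2
      have h3 : (∏ x, (ZMod.stdAddChar (k p' x * l x) : ℂ)) *
          star (∏ x, (ZMod.stdAddChar (k p' x * l x) : ℂ)) = 1 := h2.trans (by simp)
      rw [← mul_assoc, h3, one_mul]
    · rw [Matrix.blockDiagonal'_apply_ne _ _ _ hp, Matrix.blockDiagonal'_apply_ne _ _ _ hp]
      simp
  have hr : ∀ (r : Fin S.q → Fin d → ℤ) (ν j : C.WIdx), C.blockWᴴ ν j ≠ 0 →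
      r j.1 = r ν.1 := by
    rintro r ⟨p, l⟩ ⟨p', i⟩ hne
    by_contra hp
    apply hne
    rw [Matrix.conjTranspose_apply, blockW, Matrix.blockDiagonal'_apply_ne, star_zero]
    rintro rfl
    exact hp rfl
  refine ⟨fun E hE => ⟨0, by simp [act_zero, intVec_zero], fun ξ => ?_⟩, fun ν => ⟨fun E hE => ?_,
    fun E hE => ?_⟩⟩ <;> obtain ⟨E', -, hE'⟩ := hH.2 E hE <;>
    obtain ⟨k, r, hkr⟩ := hdata E hE
  · rw [expo_zero, one_mul]
    exact (dualPolyphase_symm hM hD hs hs0 hμ h0 hE' (hsym.invariant hE)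
      (Equiv.sigmaCongrRight fun p => Equiv.addRight (k p)) (r := fun j => r j.1)
      (fun j => hkr j.1 j.2) ξ).symm
  · exact ⟨_, _, hphase ν.1 ν.2 (k ν.1), fun ξ => (extN_symm hM hD hs hs0 hμ h0 hE'
      (hsym.invariant hE) (Equiv.sigmaCongrRight fun p => Equiv.addRight (k p))
      (r := fun j => r j.1) (fun j => hkr j.1 j.2) C.blockWᴴ ν (hrow k ν) (hr r ν) ξ).1⟩
  · exact ⟨_, _, hphase ν.1 ν.2 (k ν.1), fun ξ => (extN_symm hM hD hs hs0 hμ h0 hE'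
      (hsym.invariant hE) (Equiv.sigmaCongrRight fun p => Equiv.addRight (k p))
      (r := fun j => r j.1) (fun j => hkr j.1 j.2) C.blockWᴴ ν (hrow k ν) (hr r ν) ξ).2⟩

lemma CyclicNumbering.isMEPPair (C : CyclicNumbering S) (hM : M.det ≠ 0)
    {μ : Unit ⊕ C.WIdx → V d → ℂ} (hμ : IsPolyphase M C.digit m₀ μ)
    (h0 : ∀ ξ, μ (Sum.inl ()) ξ = 1 / Real.sqrt (absDet M)) :
    IsMEPPair M C.digit (Sum.elim (fun _ => m₀) (C.waveletMask μ))
        (Sum.elim (fun _ => C.dualMask μ) (C.dualWaveletMask μ))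
        (extN M μ C.blockWᴴ) (extNDual M μ C.blockWᴴ) := by
  refine ⟨?_, ?_, extN_conjTranspose_mul_extNDual hM μ C.blockW_unitary⟩
  · rintro (⟨⟩ | ν)
    · rw [extN_inl h0]; exact hμ
    · exact ⟨isTrigPoly_extN hμ.1 _ _, fun ξ => rfl⟩
  · rintro (⟨⟩ | ν)
    · refine ⟨isTrigPoly_extNDual hμ.1 _ _, fun ξ => ?_⟩
      rw [extNDual_inl]; rfl
    · exact ⟨isTrigPoly_extNDual hμ.1 _ _, fun ξ => rfl⟩

end Symmetry

/-! ### Dilation matrices and norms contracted by their inverses. -/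

section Contraction

open Filter Topology

variable {d : ℕ}

lemma IsDilation.det_ne_zero {M : Matrix (Fin d) (Fin d) ℤ} (hM : IsDilation M) : M.det ≠ 0 := by
  intro h0
  have h1 : (0 : ℂ) ∈ spectrum ℂ (M.map (fun a : ℤ => (a : ℂ))) := by
    rw [spectrum.zero_mem_iff, Matrix.isUnit_iff_isUnit_det, isUnit_iff_ne_zero, not_not]
    have := (Int.castRingHom ℂ).map_det M
    rw [h0, map_zero] at this
    exact this.symm
  have := hM 0 h1
  simp at this
  linarith

/-- The powers of the inverse of a dilation matrix tend to zero. -/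
lemma IsDilation.tendsto_inv_pow {M : Matrix (Fin d) (Fin d) ℤ} (hM : IsDilation M) :
    Tendsto (fun n : ℕ => (toReal M)⁻¹ ^ n) atTop (𝓝 0) := by
  let _ : NormedRing (Matrix (Fin d) (Fin d) ℂ) := Matrix.linftyOpNormedRing
  let _ : NormedAlgebra ℂ (Matrix (Fin d) (Fin d) ℂ) := Matrix.linftyOpNormedAlgebra
  set Mc : Matrix (Fin d) (Fin d) ℂ := M.map (fun a : ℤ => (a : ℂ)) with hMc
  have hdet : Mc.det ≠ 0 := by
    have := (Int.castRingHom ℂ).map_det M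
    have h2 : Mc.det = ((M.det : ℤ) : ℂ) := this.symm
    rw [h2]
    exact Int.cast_ne_zero.2 hM.det_ne_zero
  have hu : IsUnit Mc := (Matrix.isUnit_iff_isUnit_det _).2 (isUnit_iff_ne_zero.2 hdet)
  obtain ⟨u, hu⟩ := hu
  have hinv : Mc⁻¹ = (↑u⁻¹ : Matrix (Fin d) (Fin d) ℂ) := by
    rw [Matrix.coe_units_inv, hu]
  have hσ : ∀ z ∈ spectrum ℂ Mc⁻¹, ‖z‖₊ < 1 := by
    intro z hz
    rw [hinv, ← spectrum.map_inv, hu, Set.mem_inv] at hz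
    have h1 := hM _ hz
    rw [norm_inv] at h1
    have hz0 : 0 < ‖z‖ := by
      by_contra h
      have : ‖z‖ = 0 := le_antisymm (not_lt.1 h) (norm_nonneg z)
      rw [this] at h1
      norm_num at h1
    exact (one_lt_inv₀ hz0).1 h1
  have hrad : spectralRadius ℂ Mc⁻¹ < 1 := by
    -- For `d = 0` the matrix ring is trivial and its spectra are empty.
    rcases subsingleton_or_nontrivial (Matrix (Fin d) (Fin d) ℂ) with hs | hn
    · simp [spectralRadius]
    · exact_mod_cast spectrum.spectralRadius_lt_of_forall_lt Mc⁻¹ hσ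
  obtain ⟨r, hr1, hr2⟩ := ENNReal.lt_iff_exists_nnreal_btwn.1 hrad
  have hr2' : (r : ℝ) < 1 := by exact_mod_cast hr2
  -- Gelfand's formula: a spectral radius below `r < 1` bounds the norms of the powers by `r ^ n`
  -- eventually.
  have h1 := (spectrum.pow_nnnorm_pow_one_div_tendsto_nhds_spectralRadius Mc⁻¹).eventually_lt_const hr1
  have hpow : ∀ᶠ n : ℕ in atTop, ‖Mc⁻¹ ^ n‖ ≤ (r : ℝ) ^ n := by
    filter_upwards [h1, eventually_gt_atTop 0] with n hn hn0
    have hn' : (0 : ℝ) < n := Nat.cast_pos.2 hn0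
    rw [one_div, ENNReal.rpow_inv_lt_iff hn', ENNReal.rpow_natCast] at hn
    have : ‖Mc⁻¹ ^ n‖₊ < r ^ n := by exact_mod_cast hn
    exact_mod_cast this.le
  have hentry : ∀ (A : Matrix (Fin d) (Fin d) ℂ) i j, ‖A i j‖ ≤ ‖A‖ := by
    intro A i j
    have h2 : ‖A i j‖₊ ≤ ‖A‖₊ := by
      rw [Matrix.linfty_opNNNorm_def]
      exact (Finset.single_le_sum (f := fun j => ‖A i j‖₊) (fun _ _ => zero_le) (Finset.mem_univ j)).trans
        (Finset.le_sup (f := fun i => ∑ j, ‖A i j‖₊) (Finset.mem_univ i))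
    exact_mod_cast h2
  have hmapinv : (toReal M)⁻¹.map (algebraMap ℝ ℂ) = Mc⁻¹ := by
    symm
    apply Matrix.inv_eq_left_inv
    have h3 : Mc = (toReal M).map (algebraMap ℝ ℂ) := by
      ext i j; simp [hMc, toReal]
    rw [h3, ← Matrix.map_mul, Matrix.nonsing_inv_mul]
    · simp
    · rw [toReal_det]; exact (Int.cast_ne_zero.2 hM.det_ne_zero).isUnit
  have hmappow : ∀ n : ℕ, ((toReal M)⁻¹ ^ n).map (algebraMap ℝ ℂ) = Mc⁻¹ ^ n := by
    intro n
    rw [← hmapinv]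
    exact map_pow (algebraMap ℝ ℂ).mapMatrix _ n
  refine tendsto_pi_nhds.2 fun i => tendsto_pi_nhds.2 fun j => ?_
  refine squeeze_zero_norm' (a := fun n : ℕ => (r : ℝ) ^ n) ?_
    (tendsto_pow_atTop_nhds_zero_of_lt_one r.2 hr2')
  filter_upwards [hpow] with n hn
  refine le_trans (le_of_eq ?_) ((hentry _ i j).trans hn)
  rw [← hmappow, Matrix.map_apply]
  simp

/-- A norm for which the matrix `P` is a contraction. -/
structure AdaptedNorm (P : Matrix (Fin d) (Fin d) ℝ) where
  N : V d → ℝ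
  κ : ℝ
  C : ℝ
  κ_pos : 0 < κ
  κ_lt : κ < 1
  C_pos : 0 < C
  continuous : Continuous N
  norm_le : ∀ x, ‖x‖ ≤ N x
  le_norm : ∀ x, N x ≤ C * ‖x‖
  add_le : ∀ x y, N (x + y) ≤ N x + N y
  act_le : ∀ x, N (act P x) ≤ κ * N x

/-- Take `n` with `‖P^n‖ ≤ 1/2`, put `c = 2^(1/n)` and `N x = ∑_{i<n} c^i ‖P^i x‖`. Then `c N(P x) =
N x - ‖x‖ + 2 ‖P^n x‖ ≤ N x`, so `P` contracts by `c⁻¹`. -/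
lemma exists_adaptedNorm {P : Matrix (Fin d) (Fin d) ℝ}
    (hP : Tendsto (fun n : ℕ => P ^ n) atTop (𝓝 0)) : Nonempty (AdaptedNorm P) := by
  let Φ : Matrix (Fin d) (Fin d) ℝ →ₗ[ℝ] (V d →L[ℝ] V d) :=
    (Matrix.toEuclideanCLM (n := Fin d) (𝕜 := ℝ)).toAlgEquiv.toLinearMap
  have hΦ : Continuous Φ := LinearMap.continuous_of_finiteDimensional Φ
  have h1 : Tendsto (fun n : ℕ => ‖Φ (P ^ n)‖) atTop (𝓝 0) := by
    have := ((hΦ.tendsto 0).comp hP).norm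
    simpa using this
  obtain ⟨n, hn, hn0⟩ := ((h1.eventually_le_const (by norm_num : (0 : ℝ) < 1 / 2)).and
    (eventually_gt_atTop 0)).exists
  have hact : ∀ x, ‖act (P ^ n) x‖ ≤ 1 / 2 * ‖x‖ := fun x =>
    ((Φ (P ^ n)).le_opNorm x).trans (mul_le_mul_of_nonneg_right hn (norm_nonneg x))
  set c : ℝ := 2 ^ (1 / n : ℝ) with hc
  have hn' : (n : ℝ) ≠ 0 := Nat.cast_ne_zero.2 hn0.ne'
  have hcn : c ^ n = 2 := by
    rw [hc, ← Real.rpow_natCast, ← Real.rpow_mul (by norm_num), one_div, inv_mul_cancel₀ hn',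
      Real.rpow_one]
  have hc1 : 1 < c := Real.one_lt_rpow (by norm_num) (by positivity)
  have hc0 : 0 < c := by linarith
  refine ⟨{
    N := fun x => ∑ i ∈ Finset.range n, c ^ i * ‖act (P ^ i) x‖
    κ := c⁻¹
    C := ∑ i ∈ Finset.range n, c ^ i * ‖Φ (P ^ i)‖ + 1
    κ_pos := inv_pos.2 hc0
    κ_lt := inv_lt_one_of_one_lt₀ hc1
    C_pos := by positivity
    continuous := by fun_prop
    norm_le := fun x => ?_
    le_norm := fun x => ?_
    add_le := fun x y => ?_
    act_le := fun x => ?_ }⟩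
  · have h2 := Finset.single_le_sum (f := fun i => c ^ i * ‖act (P ^ i) x‖)
      (fun i _ => by positivity) (Finset.mem_range.2 hn0)
    simpa [act_one] using h2
  · rw [add_mul, one_mul, Finset.sum_mul]
    refine le_add_of_le_of_nonneg (Finset.sum_le_sum fun i _ => ?_) (norm_nonneg x)
    rw [mul_assoc]
    exact mul_le_mul_of_nonneg_left ((Φ (P ^ i)).le_opNorm x) (by positivity)
  · rw [← Finset.sum_add_distrib]
    refine Finset.sum_le_sum fun i _ => ?_
    rw [act_add, ← mul_add]
    exact mul_le_mul_of_nonneg_left (norm_add_le _ _) (by positivity)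
  · have h2 := Finset.sum_range_succ (fun i => c ^ i * ‖act (P ^ i) x‖) n
    have h3 := Finset.sum_range_succ' (fun i => c ^ i * ‖act (P ^ i) x‖) n
    simp only [pow_zero, act_one, one_mul] at h3
    have h4 : c * ∑ i ∈ Finset.range n, c ^ i * ‖act (P ^ i) (act P x)‖ =
        ∑ i ∈ Finset.range n, c ^ (i + 1) * ‖act (P ^ (i + 1)) x‖ := by
      rw [Finset.mul_sum]
      refine Finset.sum_congr rfl fun i _ => ?_
      rw [pow_succ P, act_mul, pow_succ]
      ring
    have h5 := hact x
    rw [hcn] at h2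
    rw [inv_mul_eq_div, le_div_iff₀ hc0, mul_comm _ c, h4]
    linarith

namespace AdaptedNorm

variable {P : Matrix (Fin d) (Fin d) ℝ} (𝒩 : AdaptedNorm P)

lemma nonneg (x : V d) : 0 ≤ 𝒩.N x := (norm_nonneg x).trans (𝒩.norm_le x)

lemma act_pow_le (n : ℕ) (x : V d) : 𝒩.N (act (P ^ n) x) ≤ 𝒩.κ ^ n * 𝒩.N x := by
  induction n with
  | zero => simp [act_one]
  | succ n ih =>
    rw [pow_succ', act_mul, pow_succ', mul_assoc]
    exact (𝒩.act_le _).trans (mul_le_mul_of_nonneg_left ih 𝒩.κ_pos.le)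

lemma N_zero : 𝒩.N 0 = 0 := le_antisymm (by simpa using 𝒩.le_norm 0) (𝒩.nonneg 0)

end AdaptedNorm

lemma IsDilation.nonempty_adaptedNorm {M : Matrix (Fin d) (Fin d) ℤ} (hM : IsDilation M) :
    Nonempty (AdaptedNorm (toReal M)⁻¹) := exists_adaptedNorm hM.tendsto_inv_pow

lemma IsDilation.nonempty_adaptedNorm_transpose {M : Matrix (Fin d) (Fin d) ℤ}
    (hM : IsDilation M) : Nonempty (AdaptedNorm (toReal M)ᵀ⁻¹) := by
  refine exists_adaptedNorm ?_
  have h1 := (Continuous.matrix_transpose (continuous_id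
    (X := Matrix (Fin d) (Fin d) ℝ))).tendsto 0 |>.comp hM.tendsto_inv_pow
  simpa [Function.comp_def, Matrix.transpose_pow, Matrix.transpose_nonsing_inv] using h1

end Contraction

/-! ### Convergence and growth of the infinite product. -/

section InfiniteProduct

open Filter Topology

variable {d : ℕ} {M : Matrix (Fin d) (Fin d) ℤ} {t : V d → ℂ}

/-- The finite products of a mask. -/
def partialHat (M : Matrix (Fin d) (Fin d) ℤ) (t : V d → ℂ) (n : ℕ) (ξ : V d) : ℂ :=
  ∏ j ∈ Finset.range n, t (act ((toReal M)ᵀ⁻¹ ^ (j + 1)) ξ)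

lemma IsRefinableMask.continuous_partialHat (ht : IsRefinableMask t) (n : ℕ) :
    Continuous (partialHat M t n) := by
  have := ht.1.continuous
  unfold partialHat
  fun_prop

lemma IsRefinableMask.exists_lipschitz (ht : IsRefinableMask t) :
    ∃ L, 0 ≤ L ∧ ∀ ξ, ‖t ξ - 1‖ ≤ L * ‖ξ‖ := by
  obtain ⟨L, hL, h⟩ := ht.1.lipschitz_zero
  exact ⟨L, hL, fun ξ => by simpa [ht.2] using h ξ⟩

lemma IsRefinableMask.multipliable (ht : IsRefinableMask t) (𝒩 : AdaptedNorm (toReal M)ᵀ⁻¹)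
    (ξ : V d) : Multipliable (fun j : ℕ => t (act ((toReal M)ᵀ⁻¹ ^ (j + 1)) ξ)) := by
  obtain ⟨L, hL, hLip⟩ := ht.exists_lipschitz
  have h1 : Summable fun j : ℕ => ‖t (act ((toReal M)ᵀ⁻¹ ^ (j + 1)) ξ) - 1‖ := by
    refine Summable.of_nonneg_of_le (fun _ => norm_nonneg _) (fun j => ?_)
      (((summable_geometric_of_lt_one 𝒩.κ_pos.le 𝒩.κ_lt).mul_left (L * (𝒩.κ * 𝒩.N ξ))))
    refine (hLip _).trans ?_
    rw [mul_assoc]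
    refine mul_le_mul_of_nonneg_left ((𝒩.norm_le _).trans ((𝒩.act_pow_le _ _).trans ?_)) hL
    rw [pow_succ]
    exact le_of_eq (by ring)
  simpa using multipliable_one_add_of_summable h1

lemma IsRefinableMask.tendsto_partialHat (ht : IsRefinableMask t)
    (𝒩 : AdaptedNorm (toReal M)ᵀ⁻¹) (ξ : V d) :
    Tendsto (fun n => partialHat M t n ξ) atTop (𝓝 (refinableHat M t ξ)) :=
  (ht.multipliable 𝒩 ξ).hasProd.tendsto_prod_nat

lemma partialHat_succ (n : ℕ) (ξ : V d) : partialHat M t (n + 1) ξ =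
    t (act (toReal M)ᵀ⁻¹ ξ) * partialHat M t n (act (toReal M)ᵀ⁻¹ ξ) := by
  rw [partialHat, Finset.prod_range_succ', mul_comm, partialHat]
  simp only [zero_add, pow_one]
  congr 1
  refine Finset.prod_congr rfl fun j _ => ?_
  rw [← act_mul, ← pow_succ]

lemma IsRefinableMask.refinableHat_eq (ht : IsRefinableMask t)
    (𝒩 : AdaptedNorm (toReal M)ᵀ⁻¹) (ξ : V d) : refinableHat M t ξ =
      t (act (toReal M)ᵀ⁻¹ ξ) * refinableHat M t (act (toReal M)ᵀ⁻¹ ξ) := by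
  have h1 := (ht.tendsto_partialHat 𝒩 ξ).comp (tendsto_add_atTop_nat 1)
  have h2 := (ht.tendsto_partialHat 𝒩 (act (toReal M)ᵀ⁻¹ ξ)).const_mul (t (act (toReal M)ᵀ⁻¹ ξ))
  refine tendsto_nhds_unique h1 (h2.congr fun n => ?_)
  rw [Function.comp_apply, partialHat_succ]

lemma IsRefinableMask.measurable_refinableHat (ht : IsRefinableMask t)
    (𝒩 : AdaptedNorm (toReal M)ᵀ⁻¹) : Measurable (refinableHat M t) :=
  measurable_of_tendsto_metrizable (fun n => (ht.continuous_partialHat n).measurable)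
    (tendsto_pi_nhds.2 fun ξ => ht.tendsto_partialHat 𝒩 ξ)

/-- The finite products are of uniform polynomial growth. -/
lemma IsRefinableMask.exists_growth (ht : IsRefinableMask t) (𝒩 : AdaptedNorm (toReal M)ᵀ⁻¹) :
    ∃ (p : ℕ), ∀ n ξ, ‖partialHat M t n ξ‖ ≤ (1 + 𝒩.N ξ) ^ p := by
  obtain ⟨L, hL, hLip⟩ := ht.exists_lipschitz
  obtain ⟨K, hK, hbd⟩ := ht.1.bounded
  set l := 𝒩.κ⁻¹ - 1 with hl
  have hl0 : 0 < l := by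
    rw [hl, sub_pos]; exact (one_lt_inv₀ 𝒩.κ_pos).2 𝒩.κ_lt
  -- The exponent satisfies `p l ≥ 2 (L + K)`, as needed for Bernoulli's inequality below; here `1 +
  -- l = κ⁻¹`.
  obtain ⟨p, hp⟩ := exists_nat_ge (2 * (L + K) / l)
  rw [div_le_iff₀ hl0] at hp
  -- One factor of the product is absorbed by the growth of `(1 + N)^p` under dilation. With `x =
  -- N(M^{*-1} ξ)`, the expression `x/(1 + x)` serves for the Lipschitz bound at small `x` and for
  -- the uniform bound at large `x`.
  have hstep : ∀ ξ, ‖t (act (toReal M)ᵀ⁻¹ ξ)‖ * (1 + 𝒩.N (act (toReal M)ᵀ⁻¹ ξ)) ^ p ≤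
      (1 + 𝒩.N ξ) ^ p := by
    intro ξ
    set η := act (toReal M)ᵀ⁻¹ ξ
    set x := 𝒩.N η with hx
    have hx0 : 0 ≤ x := 𝒩.nonneg _
    have hx1 : (1 + l) * x ≤ 𝒩.N ξ := by
      rw [hl, add_sub_cancel, inv_mul_le_iff₀ 𝒩.κ_pos]
      exact 𝒩.act_le ξ
    have h1x : 0 < 1 + x := by linarith
    have ht1 : ‖t η‖ ≤ 1 + 2 * (L + K) * (x / (1 + x)) := by
      rcases le_total x 1 with h | h
      · have h2 : ‖t η‖ ≤ 1 + L * x := by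
          have h3 := norm_le_norm_sub_add (t η) 1
          rw [norm_one] at h3
          have h4 := (hLip η).trans (mul_le_mul_of_nonneg_left (𝒩.norm_le η) hL)
          linarith
        refine h2.trans ?_
        have h5 : x ≤ 2 * (x / (1 + x)) := by
          rw [mul_div_assoc', le_div_iff₀ h1x]; nlinarith
        have h6 : 0 ≤ x / (1 + x) := by positivity
        nlinarith
      · refine (hbd η).trans ?_
        have h5 : 1 ≤ 2 * (x / (1 + x)) := by
          rw [mul_div_assoc', le_div_iff₀ h1x]; linarith
        nlinarith
    have hber := one_add_mul_le_pow (a := l * (x / (1 + x))) (by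
      have : 0 ≤ l * (x / (1 + x)) := by positivity
      linarith) p
    have h7 : ‖t η‖ ≤ (1 + l * (x / (1 + x))) ^ p := by
      refine ht1.trans (le_trans ?_ hber)
      have h6 : 0 ≤ x / (1 + x) := by positivity
      nlinarith
    calc ‖t η‖ * (1 + x) ^ p ≤ (1 + l * (x / (1 + x))) ^ p * (1 + x) ^ p :=
          mul_le_mul_of_nonneg_right h7 (by positivity)
      _ = (1 + (1 + l) * x) ^ p := by
          rw [← mul_pow]
          congr 1
          field_simp
          ring
      _ ≤ (1 + 𝒩.N ξ) ^ p := by gcongr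
  refine ⟨p, fun n => ?_⟩
  induction n with
  | zero =>
    intro ξ
    rw [partialHat, Finset.prod_range_zero, norm_one]
    exact one_le_pow₀ (by linarith [𝒩.nonneg ξ])
  | succ n ih =>
    intro ξ
    rw [partialHat_succ, norm_mul]
    exact (mul_le_mul_of_nonneg_left (ih _) (norm_nonneg _)).trans (hstep ξ)

lemma IsRefinableMask.exists_growth_refinableHat (ht : IsRefinableMask t)
    (𝒩 : AdaptedNorm (toReal M)ᵀ⁻¹) :
    ∃ (p : ℕ), ∀ ξ, ‖refinableHat M t ξ‖ ≤ (1 + 𝒩.N ξ) ^ p := by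
  obtain ⟨p, hp⟩ := ht.exists_growth (M := M) 𝒩
  exact ⟨p, fun ξ => le_of_tendsto (ht.tendsto_partialHat 𝒩 ξ).norm
    (Eventually.of_forall fun n => hp n ξ)⟩

/-- Use `|∏ t_j - 1| ≤ exp(∑ |t_j - 1|) - 1`, where the sum is dominated by a geometric series
proportional to `N ξ`. The bound is uniform in the number of factors. -/
lemma IsRefinableMask.tendsto_refinableHat_zero (ht : IsRefinableMask t)
    (𝒩 : AdaptedNorm (toReal M)ᵀ⁻¹) : Tendsto (refinableHat M t) (𝓝 0) (𝓝 1) := by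
  obtain ⟨L, hL, hLip⟩ := ht.exists_lipschitz
  have hκ : 0 < 1 - 𝒩.κ := sub_pos.2 𝒩.κ_lt
  have h1 : ∀ n ξ, ‖partialHat M t n ξ - 1‖ ≤ Real.exp (L * (𝒩.N ξ * (1 - 𝒩.κ)⁻¹)) - 1 := by
    intro n ξ
    have h2 := Finset.norm_prod_one_add_sub_one_le (Finset.range n)
      (fun j => t (act ((toReal M)ᵀ⁻¹ ^ (j + 1)) ξ) - 1)
    simp only [add_sub_cancel] at h2
    refine h2.trans (sub_le_sub_right (Real.exp_le_exp.2 ?_) 1)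
    calc ∑ j ∈ Finset.range n, ‖t (act ((toReal M)ᵀ⁻¹ ^ (j + 1)) ξ) - 1‖
        ≤ ∑ j ∈ Finset.range n, L * (𝒩.N ξ * 𝒩.κ ^ j) := by
          refine Finset.sum_le_sum fun j _ => (hLip _).trans
            (mul_le_mul_of_nonneg_left ((𝒩.norm_le _).trans ((𝒩.act_pow_le _ _).trans ?_)) hL)
          rw [mul_comm]
          refine mul_le_mul_of_nonneg_left ?_ (𝒩.nonneg _)
          exact pow_le_pow_of_le_one 𝒩.κ_pos.le 𝒩.κ_lt.le (Nat.le_succ j)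
      _ = L * (𝒩.N ξ * ∑ j ∈ Finset.range n, 𝒩.κ ^ j) := by
          rw [← Finset.mul_sum, ← Finset.mul_sum]
      _ ≤ _ := by
          refine mul_le_mul_of_nonneg_left (mul_le_mul_of_nonneg_left ?_ (𝒩.nonneg _)) hL
          rw [← tsum_geometric_of_lt_one 𝒩.κ_pos.le 𝒩.κ_lt]
          exact (summable_geometric_of_lt_one 𝒩.κ_pos.le 𝒩.κ_lt).sum_le_tsum _
            (fun j _ => pow_nonneg 𝒩.κ_pos.le j)
  have h2 : ∀ ξ, ‖refinableHat M t ξ - 1‖ ≤ Real.exp (L * (𝒩.N ξ * (1 - 𝒩.κ)⁻¹)) - 1 := fun ξ =>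
    le_of_tendsto ((ht.tendsto_partialHat 𝒩 ξ).sub_const 1).norm
      (Eventually.of_forall fun n => h1 n ξ)
  rw [tendsto_iff_norm_sub_tendsto_zero]
  refine squeeze_zero (fun _ => norm_nonneg _) h2 ?_
  have hc : Continuous fun ξ => Real.exp (L * (𝒩.N ξ * (1 - 𝒩.κ)⁻¹)) - 1 := by
    have := 𝒩.continuous
    fun_prop
  simpa [𝒩.N_zero] using hc.tendsto 0

end InfiniteProduct

/-! ### Bounded support of the Fourier transform of `|φ̂|²`. -/

section Correlation

open Filter Topology
open scoped SchwartzMap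

variable {d : ℕ} {M : Matrix (Fin d) (Fin d) ℤ} {t : V d → ℂ}

/-- Linear combinations of exponentials with frequencies in `A`. -/
def expSpan (A : Set (V d)) : Submodule ℂ (V d → ℂ) := Submodule.span ℂ (ex '' A)

lemma expSpan_mul {A B C : Set (V d)} (h : ∀ a ∈ A, ∀ b ∈ B, a + b ∈ C) {f g : V d → ℂ}
    (hf : f ∈ expSpan A) (hg : g ∈ expSpan B) : f * g ∈ expSpan C := by
  induction hf using Submodule.span_induction with
  | mem x hx =>
    obtain ⟨a, ha, rfl⟩ := hx
    induction hg using Submodule.span_induction with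
    | mem y hy =>
      obtain ⟨b, hb, rfl⟩ := hy
      refine Submodule.subset_span ⟨a + b, h a ha b hb, ?_⟩
      ext ξ
      exact ex_add_left a b ξ
    | zero => rw [mul_zero]; exact Submodule.zero_mem _
    | add x y _ _ hx hy => rw [mul_add]; exact Submodule.add_mem _ hx hy
    | smul c x _ hx => rw [mul_smul_comm]; exact Submodule.smul_mem _ c hx
  | zero => rw [zero_mul]; exact Submodule.zero_mem _
  | add x y _ _ hx hy => rw [add_mul]; exact Submodule.add_mem _ hx hy
  | smul c x _ hx => rw [smul_mul_assoc]; exact Submodule.smul_mem _ c hx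

lemma expSpan_conj {A C : Set (V d)} (h : ∀ a ∈ A, -a ∈ C) {f : V d → ℂ}
    (hf : f ∈ expSpan A) : (fun ξ => (starRingEnd ℂ) (f ξ)) ∈ expSpan C := by
  induction hf using Submodule.span_induction with
  | mem x hx =>
    obtain ⟨a, ha, rfl⟩ := hx
    exact Submodule.subset_span ⟨-a, h a ha, funext fun ξ => (conj_ex a ξ).symm⟩
  | zero => simp only [Pi.zero_apply, map_zero]; exact Submodule.zero_mem _
  | add x y _ _ hx hy => simp only [Pi.add_apply, map_add]; exact Submodule.add_mem _ hx hy
  | smul c x _ hx =>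
    simp only [Pi.smul_apply, smul_eq_mul, map_mul]; exact Submodule.smul_mem _ _ hx

lemma expSpan_comp {A C : Set (V d)} (P : Matrix (Fin d) (Fin d) ℝ) (h : ∀ a ∈ A, act Pᵀ a ∈ C)
    {f : V d → ℂ} (hf : f ∈ expSpan A) : (fun ξ => f (act P ξ)) ∈ expSpan C := by
  induction hf using Submodule.span_induction with
  | mem x hx =>
    obtain ⟨a, ha, rfl⟩ := hx
    refine Submodule.subset_span ⟨_, h a ha, funext fun ξ => ?_⟩
    rw [ex_act, Matrix.transpose_transpose]
  | zero => exact Submodule.zero_mem _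
  | add x y _ _ hx hy => exact Submodule.add_mem _ hx hy
  | smul c x _ hx => exact Submodule.smul_mem _ _ hx

lemma IsTrigPoly.exists_expSpan (ht : IsTrigPoly t) (𝒩 : AdaptedNorm (toReal M)⁻¹) :
    ∃ K, 0 ≤ K ∧ t ∈ expSpan {x | 𝒩.N x ≤ K} := by
  have hmono : ∀ {K L : ℝ}, K ≤ L → expSpan {x | 𝒩.N x ≤ K} ≤ expSpan {x | 𝒩.N x ≤ L} :=
    fun h => Submodule.span_mono (Set.image_mono fun x hx => le_trans hx h)
  induction ht using IsTrigPoly.induction with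
  | he k => exact ⟨𝒩.N (intVec k), 𝒩.nonneg _,
      Submodule.subset_span ⟨intVec k, le_refl (𝒩.N (intVec k)),
        funext fun ξ => (expo_eq_ex k ξ).symm⟩⟩
  | hs a f hf ih =>
    obtain ⟨K, hK, h⟩ := ih
    exact ⟨K, hK, Submodule.smul_mem _ a h⟩
  | ha f g hf hg ihf ihg =>
    obtain ⟨K, hK, h⟩ := ihf
    obtain ⟨L, hL, h'⟩ := ihg
    exact ⟨max K L, le_max_of_le_left hK, Submodule.add_mem _ (hmono (le_max_left K L) h)
      (hmono (le_max_right K L) h')⟩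

/-- The frequencies of the finite products are uniformly bounded. -/
lemma IsTrigPoly.exists_partialHat_mem (ht : IsTrigPoly t) (𝒩 : AdaptedNorm (toReal M)⁻¹) :
    ∃ R, 0 ≤ R ∧ ∀ n, partialHat M t n ∈ expSpan {x | 𝒩.N x ≤ R} := by
  obtain ⟨K, hK, h⟩ := ht.exists_expSpan (M := M) 𝒩
  have hκ : 0 < 1 - 𝒩.κ := sub_pos.2 𝒩.κ_lt
  have hκ0 := 𝒩.κ_pos
  -- The radius is the fixed point of `R ↦ κ (K + R)`: a further factor of the product adds
  -- frequencies up to `K`, and the dilation contracts the result by `κ`.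
  refine ⟨𝒩.κ * K / (1 - 𝒩.κ), by positivity, fun n => ?_⟩
  set R := 𝒩.κ * K / (1 - 𝒩.κ) with hR
  have hR0 : 0 ≤ R := by positivity
  have hRe : 𝒩.κ * (K + R) = R := by rw [hR]; field_simp; ring
  induction n with
  | zero =>
    refine Submodule.subset_span ⟨0, by simpa [𝒩.N_zero] using hR0, funext fun ξ => ?_⟩
    simp [partialHat, ex_zero_left]
  | succ n ih =>
    have h1 := expSpan_mul (C := {x | 𝒩.N x ≤ K + R})
      (fun a ha b hb => (𝒩.add_le a b).trans (add_le_add ha hb)) h ih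
    have h2 := expSpan_comp (C := {x | 𝒩.N x ≤ R}) (toReal M)ᵀ⁻¹ (fun a ha => by
      rw [Matrix.transpose_nonsing_inv, Matrix.transpose_transpose]
      exact (𝒩.act_le a).trans ((mul_le_mul_of_nonneg_left ha hκ0.le).trans hRe.le)) h1
    have h3 : partialHat M t (n + 1) =
        fun ξ => (t * partialHat M t n) (act (toReal M)ᵀ⁻¹ ξ) :=
      funext fun ξ => partialHat_succ n ξ
    rw [h3]
    exact h2

lemma fourierChar_neg_inner (v w : V d) : (Real.fourierChar (-inner ℝ v w) : ℂ) = ex (-w) v := by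
  rw [Real.fourierChar_apply, ex, inner_neg_left, real_inner_comm]
  congr 1
  push_cast
  ring

lemma fourierChar_inner (v w : V d) : (Real.fourierChar (inner ℝ v w) : ℂ) = ex w v := by
  rw [Real.fourierChar_apply, ex, real_inner_comm]
  congr 1
  push_cast
  ring

/-- Exponential sums annihilate transforms of test functions which vanish at the frequencies. -/
lemma integral_expSpan_mul_fourier {A : Set (V d)} {f : V d → ℂ} (hf : f ∈ expSpan A)
    (h : 𝓢(V d, ℂ)) (hA : ∀ x ∈ A, h x = 0) : Integrable (fun ξ => f ξ * 𝓕 h ξ) ∧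
      ∫ ξ, f ξ * 𝓕 h ξ = 0 := by
  induction hf using Submodule.span_induction with
  | mem y hy =>
    obtain ⟨x, hx, rfl⟩ := hy
    constructor
    · refine (𝓕 h).integrable.norm.mono' ((continuous_ex x).mul
        (𝓕 h).continuous).aestronglyMeasurable (Eventually.of_forall fun ξ => ?_)
      rw [norm_mul, norm_ex, one_mul]
    · have h1 : 𝓕⁻ (𝓕 h) x = h x := by rw [FourierTransform.fourierInv_fourier_eq]
      rw [hA x hx, SchwartzMap.fourierInv_coe, Real.fourierInv_eq] at h1
      rw [← h1]
      refine integral_congr_ae (Eventually.of_forall fun ξ => ?_)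
      simp only [Circle.smul_def, fourierChar_inner, smul_eq_mul]
  | zero => simp
  | add f g _ _ hf hg =>
    simp only [Pi.add_apply, add_mul]
    exact ⟨hf.1.add hg.1, by rw [integral_add hf.1 hg.1, hf.2, hg.2, add_zero]⟩
  | smul c f _ hf =>
    simp only [Pi.smul_apply, smul_eq_mul, mul_assoc]
    exact ⟨hf.1.const_mul c, by rw [integral_const_mul, hf.2, mul_zero]⟩

/-- The Fourier transform of the squared modulus of a refinable function has bounded support. -/
lemma IsRefinableMask.exists_correlation_eq_zero (ht : IsRefinableMask t)
    (𝒩 : AdaptedNorm (toReal M)⁻¹) (𝒩' : AdaptedNorm (toReal M)ᵀ⁻¹)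
    (hint : Integrable (fun ξ => ‖refinableHat M t ξ‖ ^ 2)) :
    ∃ R, 0 ≤ R ∧ ∀ x, R < ‖x‖ → ∫ ξ, ex x ξ * ((‖refinableHat M t ξ‖ ^ 2 : ℝ) : ℂ) = 0 := by
  obtain ⟨R, hR0, hR⟩ := ht.1.exists_partialHat_mem (M := M) 𝒩
  obtain ⟨p, hp⟩ := ht.exists_growth (M := M) 𝒩'
  refine ⟨R + R, by positivity, ?_⟩
  have hsq : ∀ n, (fun ξ => ((‖partialHat M t n ξ‖ ^ 2 : ℝ) : ℂ)) ∈
      expSpan {x | ‖x‖ ≤ R + R} := by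
    intro n
    have h1 : partialHat M t n ∈ expSpan {x | ‖x‖ ≤ R} :=
      Submodule.span_mono (Set.image_mono fun x hx => (𝒩.norm_le x).trans hx) (hR n)
    have h2 := expSpan_mul (C := {x | ‖x‖ ≤ R + R})
      (fun a ha b hb => (norm_add_le a b).trans (add_le_add ha hb)) h1
      (expSpan_conj (C := {x | ‖x‖ ≤ R}) (fun a ha => by simpa using ha) h1)
    convert h2 using 1
    ext ξ
    rw [Pi.mul_apply, Complex.mul_conj']
    push_cast
    rfl
  -- The integrals vanish for the finite products. Their uniform polynomial growth against a
  -- Schwartz function allows passage to the limit.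
  have hlim : ∀ h : 𝓢(V d, ℂ), (∀ x, ‖x‖ ≤ R + R → h x = 0) →
      ∫ ξ, ((‖refinableHat M t ξ‖ ^ 2 : ℝ) : ℂ) * 𝓕 h ξ = 0 := by
    intro h hh
    have h1 : Tendsto (fun n => ∫ ξ, ((‖partialHat M t n ξ‖ ^ 2 : ℝ) : ℂ) * 𝓕 h ξ) atTop
        (𝓝 (∫ ξ, ((‖refinableHat M t ξ‖ ^ 2 : ℝ) : ℂ) * 𝓕 h ξ)) := by
      refine tendsto_integral_of_dominated_convergence
        (fun ξ => 2 ^ (p * 2 - 1) * (‖ξ‖ ^ 0 * ‖𝓕 h ξ‖ +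
          𝒩'.C ^ (p * 2) * (‖ξ‖ ^ (p * 2) * ‖𝓕 h ξ‖))) (fun n => ?_) ?_ (fun n => ?_) ?_
      · have := ht.continuous_partialHat (M := M) n
        have h3 := (𝓕 h).continuous
        exact Continuous.aestronglyMeasurable (by fun_prop)
      · exact (((𝓕 h).integrable_pow_mul volume 0).add
          (((𝓕 h).integrable_pow_mul volume (p * 2)).const_mul _)).const_mul _
      · refine Eventually.of_forall fun ξ => ?_
        rw [norm_mul, Complex.norm_real, Real.norm_of_nonneg (by positivity)]
        have h4 : ‖partialHat M t n ξ‖ ^ 2 ≤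
            2 ^ (p * 2 - 1) * (1 + 𝒩'.C ^ (p * 2) * ‖ξ‖ ^ (p * 2)) := by
          calc ‖partialHat M t n ξ‖ ^ 2 ≤ ((1 + 𝒩'.N ξ) ^ p) ^ 2 := by gcongr; exact hp n ξ
            _ = (1 + 𝒩'.N ξ) ^ (p * 2) := (pow_mul _ _ _).symm
            _ ≤ 2 ^ (p * 2 - 1) * (1 ^ (p * 2) + 𝒩'.N ξ ^ (p * 2)) :=
              add_pow_le zero_le_one (𝒩'.nonneg ξ) _
            _ ≤ _ := by
              rw [one_pow, ← mul_pow]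
              have := 𝒩'.le_norm ξ
              have := 𝒩'.nonneg ξ
              gcongr
        refine (mul_le_mul_of_nonneg_right h4 (norm_nonneg _)).trans (le_of_eq ?_)
        ring
      · refine Eventually.of_forall fun ξ => ?_
        refine Tendsto.mul_const _ ?_
        exact (Complex.continuous_ofReal.tendsto _).comp
          ((ht.tendsto_partialHat 𝒩' ξ).norm.pow 2)
    refine tendsto_nhds_unique h1 ?_
    simp only [(integral_expSpan_mul_fourier (hsq _) h hh).2]
    exact tendsto_const_nhds
  set ρ : V d → ℂ := fun ξ => ((‖refinableHat M t ξ‖ ^ 2 : ℝ) : ℂ) with hρ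
  have hρi : Integrable ρ := hint.ofReal
  have hcont : Continuous (𝓕 ρ) := VectorFourier.fourierIntegral_continuous
    Real.continuous_fourierChar (L := innerₗ (V d)) continuous_inner hρi
  have hU : IsOpen {x : V d | R + R < ‖x‖} := isOpen_lt continuous_const continuous_norm
  -- Testing against smooth functions supported outside the ball shows that `𝓕 ρ` vanishes there
  -- almost everywhere; as `ρ` is integrable, `𝓕 ρ` is continuous, hence zero there.
  have hae : ∀ᵐ x, x ∈ {x : V d | R + R < ‖x‖} → 𝓕 ρ x = 0 := by
    refine hU.ae_eq_zero_of_integral_contDiff_smul_eq_zero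
      (hcont.locallyIntegrable.locallyIntegrableOn _) fun g hg hgc hgs => ?_
    have hgc' : HasCompactSupport (fun x => (g x : ℂ)) := hgc.comp_left Complex.ofReal_zero
    have hg' : ContDiff ℝ (⊤ : ℕ∞) (fun x => (g x : ℂ)) := Complex.ofRealCLM.contDiff.comp hg
    set h : 𝓢(V d, ℂ) := hgc'.toSchwartzMap hg' with hh
    have h1 := hlim h (fun x hx => by
      have : x ∉ tsupport g := fun hx' => absurd (hgs hx') (not_lt.2 hx)
      show (g x : ℂ) = 0
      rw [image_eq_zero_of_notMem_tsupport this, Complex.ofReal_zero])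
    have h2 := VectorFourier.integral_fourierIntegral_smul_eq_flip (L := innerₗ (V d))
      (μ := volume) (ν := volume) Real.continuous_fourierChar continuous_inner hρi h.integrable
    have h3 : ∫ x, 𝓕 ρ x * h x = 0 := by
      refine Eq.trans ?_ (h2.trans (Eq.trans ?_ h1))
      · rfl
      · refine integral_congr_ae (Eventually.of_forall fun ξ => ?_)
        simp only [smul_eq_mul]
        congr 1
        rw [flip_innerₗ]
        rfl
    rw [← h3]
    refine integral_congr_ae (Eventually.of_forall fun x => ?_)
    show g x • 𝓕 ρ x = 𝓕 ρ x * (g x : ℂ)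
    rw [Complex.real_smul, mul_comm]
  have hzero : Set.EqOn (𝓕 ρ) 0 {x : V d | R + R < ‖x‖} :=
    Measure.eqOn_open_of_ae_eq ((ae_restrict_iff' hU.measurableSet).2 hae) hU hcont.continuousOn
      continuousOn_const
  intro x hx
  -- The integral against `ex x` is the Fourier transform at `-x`.
  have h1 := hzero (show R + R < ‖-x‖ by rwa [norm_neg])
  rw [Pi.zero_apply, Real.fourier_eq] at h1
  rw [← h1]
  refine integral_congr_ae (Eventually.of_forall fun ξ => ?_)
  simp only [Circle.smul_def, fourierChar_neg_inner, neg_neg, smul_eq_mul, hρ]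

end Correlation

/-! ### Linear changes of variables. -/

section ChangeOfVariables

variable {d : ℕ}

lemma map_act_volume {A : Matrix (Fin d) (Fin d) ℝ} (hA : A.det ≠ 0) :
    Measure.map (act A) (volume : Measure (V d)) = ENNReal.ofReal |A.det|⁻¹ • volume := by
  have h1 : LinearMap.det (Matrix.toEuclideanCLM (n := Fin d) (𝕜 := ℝ) A).toLinearMap = A.det := by
    have : (Matrix.toEuclideanCLM (n := Fin d) (𝕜 := ℝ) A).toLinearMap =
        Matrix.toLin (PiLp.basisFun 2 ℝ (Fin d)) (PiLp.basisFun 2 ℝ (Fin d)) A := rfl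
    rw [this, LinearMap.det_toLin]
  have h2 := Measure.map_linearMap_addHaar_eq_smul_addHaar (volume : Measure (V d))
    (f := (Matrix.toEuclideanCLM (n := Fin d) (𝕜 := ℝ) A).toLinearMap) (by rwa [h1])
  rw [h1, abs_inv] at h2
  exact h2

lemma act_inv_act {A : Matrix (Fin d) (Fin d) ℝ} (hA : A.det ≠ 0) (x : V d) :
    act A⁻¹ (act A x) = x := by
  rw [← act_mul, Matrix.nonsing_inv_mul _ hA.isUnit, act_one]

lemma act_act_inv {A : Matrix (Fin d) (Fin d) ℝ} (hA : A.det ≠ 0) (x : V d) :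
    act A (act A⁻¹ x) = x := by
  rw [← act_mul, Matrix.mul_nonsing_inv _ hA.isUnit, act_one]

/-- An invertible matrix as a homeomorphism. -/
def actHomeomorph (A : Matrix (Fin d) (Fin d) ℝ) (hA : A.det ≠ 0) : V d ≃ₜ V d where
  toFun := act A
  invFun := act A⁻¹
  left_inv := act_inv_act hA
  right_inv := act_act_inv hA
  continuous_toFun := continuous_act A
  continuous_invFun := continuous_act A⁻¹

lemma measurableEmbedding_act {A : Matrix (Fin d) (Fin d) ℝ} (hA : A.det ≠ 0) :
    MeasurableEmbedding (act A) := (actHomeomorph A hA).measurableEmbedding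

lemma lintegral_comp_act {A : Matrix (Fin d) (Fin d) ℝ} (hA : A.det ≠ 0) (f : V d → ENNReal) :
    ∫⁻ ξ, f (act A ξ) = ENNReal.ofReal |A.det|⁻¹ * ∫⁻ ξ, f ξ := by
  rw [← (measurableEmbedding_act hA).lintegral_map, map_act_volume hA, lintegral_smul_measure,
    smul_eq_mul]

lemma integral_comp_act {E : Type*} [NormedAddCommGroup E] [NormedSpace ℝ E]
    {A : Matrix (Fin d) (Fin d) ℝ} (hA : A.det ≠ 0) (f : V d → E) :
    ∫ ξ, f (act A ξ) = |A.det|⁻¹ • ∫ ξ, f ξ := by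
  rw [← (measurableEmbedding_act hA).integral_map, map_act_volume hA, integral_smul_measure,
    ENNReal.toReal_ofReal (by positivity)]

lemma integrable_comp_act {E : Type*} [NormedAddCommGroup E]
    {A : Matrix (Fin d) (Fin d) ℝ} (hA : A.det ≠ 0) {f : V d → E} (hf : Integrable f) :
    Integrable (fun ξ => f (act A ξ)) := by
  have h1 : Integrable f (Measure.map (act A) volume) := by
    rw [map_act_volume hA]; exact hf.smul_measure ENNReal.ofReal_ne_top
  exact (measurableEmbedding_act hA).integrable_map_iff.1 h1

lemma quasiMeasurePreserving_act {A : Matrix (Fin d) (Fin d) ℝ} (hA : A.det ≠ 0) :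
    Measure.QuasiMeasurePreserving (act A) (volume : Measure (V d)) volume := by
  refine ⟨(continuous_act A).measurable, ?_⟩
  rw [map_act_volume hA]
  exact Measure.smul_absolutelyContinuous

end ChangeOfVariables

/-! ### Geometric decay of convergent linear orbits. -/

section Stability

open Filter Topology

/-- On a finite dimensional space, an orbit of a linear map which tends to zero does so
geometrically. -/
lemma exists_geometric_bound {E : Type*} [NormedAddCommGroup E] [NormedSpace ℂ E]
    [FiniteDimensional ℂ E] (f : E →ₗ[ℂ] E) (v : E)
    (hv : Tendsto (fun n : ℕ => (f ^ n) v) atTop (𝓝 0)) :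
    ∃ C θ : ℝ, 0 ≤ C ∧ 0 < θ ∧ θ < 1 ∧ ∀ n : ℕ, ‖(f ^ n) v‖ ≤ C * θ ^ n := by
  -- The map itself need not be stable. It is restricted to the invariant subspace of all vectors
  -- whose orbits tend to zero, where pointwise convergence on a basis gives convergence of the
  -- powers in operator norm.
  let W : Submodule ℂ E :=
    { carrier := {w | Tendsto (fun n : ℕ => (f ^ n) w) atTop (𝓝 0)}
      add_mem' := fun {a b} ha hb => by simpa using Tendsto.add ha hb
      zero_mem' := by simp
      smul_mem' := fun c w hw => by simpa using Tendsto.const_smul hw c }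
  have hW : ∀ (n : ℕ) (w : E), w ∈ W → (f ^ n) w ∈ W := by
    intro n w hw
    show Tendsto (fun k : ℕ => (f ^ k) ((f ^ n) w)) atTop (𝓝 0)
    refine (Tendsto.comp hw (tendsto_add_atTop_nat n)).congr fun k => ?_
    rw [Function.comp_apply, pow_add, Module.End.mul_apply]
  let b := Module.finBasis ℂ W
  obtain ⟨K, hK, hb⟩ := b.exists_opNorm_le (F := E)
  let g : ℕ → W →L[ℂ] E := fun n => LinearMap.toContinuousLinearMap ((f ^ n).comp W.subtype)
  have hg : ∀ i, Tendsto (fun n => ‖g n (b i)‖) atTop (𝓝 0) := fun i => by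
    have h0 : Tendsto (fun n : ℕ => (f ^ n) (b i : E)) atTop (𝓝 0) := (b i).2
    simpa [g] using h0.norm
  have hsum : Tendsto (fun n => K * ∑ i, ‖g n (b i)‖) atTop (𝓝 0) := by
    simpa using (tendsto_finsetSum Finset.univ (fun i _ => hg i)).const_mul K
  obtain ⟨n, hn, hn0⟩ := ((hsum.eventually_le_const (by norm_num : (0 : ℝ) < 1 / 2)).and
    (eventually_gt_atTop 0)).exists
  have hgn : ∀ w ∈ W, ‖(f ^ n) w‖ ≤ 1 / 2 * ‖w‖ := by
    intro w hw
    have h1 := hb (u := g n) (M := ∑ i, ‖g n (b i)‖) (by positivity)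
      (fun i => Finset.single_le_sum (f := fun i => ‖g n (b i)‖) (fun _ _ => norm_nonneg _)
        (Finset.mem_univ i))
    exact ((g n).le_opNorm ⟨w, hw⟩).trans (mul_le_mul_of_nonneg_right (h1.trans hn) (norm_nonneg w))
  -- The same renorming as in `exists_adaptedNorm`.
  set c : ℝ := 2 ^ (1 / n : ℝ) with hc
  have hn' : (n : ℝ) ≠ 0 := Nat.cast_ne_zero.2 hn0.ne'
  have hcn : c ^ n = 2 := by
    rw [hc, ← Real.rpow_natCast, ← Real.rpow_mul (by norm_num), one_div, inv_mul_cancel₀ hn',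
      Real.rpow_one]
  have hc1 : 1 < c := Real.one_lt_rpow (by norm_num) (by positivity)
  have hc0 : 0 < c := by linarith
  let N : E → ℝ := fun x => ∑ i ∈ Finset.range n, c ^ i * ‖(f ^ i) x‖
  have hN : ∀ x, ‖x‖ ≤ N x := fun x => by
    have h2 := Finset.single_le_sum (f := fun i => c ^ i * ‖(f ^ i) x‖)
      (fun i _ => by positivity) (Finset.mem_range.2 hn0)
    simpa using h2
  have hstep : ∀ x ∈ W, N (f x) ≤ c⁻¹ * N x := by
    intro x hx
    have h2 := Finset.sum_range_succ (fun i => c ^ i * ‖(f ^ i) x‖) n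
    have h3 := Finset.sum_range_succ' (fun i => c ^ i * ‖(f ^ i) x‖) n
    simp only [pow_zero, Module.End.one_apply, one_mul] at h3
    have h4 : c * ∑ i ∈ Finset.range n, c ^ i * ‖(f ^ i) (f x)‖ =
        ∑ i ∈ Finset.range n, c ^ (i + 1) * ‖(f ^ (i + 1)) x‖ := by
      rw [Finset.mul_sum]
      refine Finset.sum_congr rfl fun i _ => ?_
      rw [pow_succ f, Module.End.mul_apply, pow_succ]
      ring
    have h5 := hgn x hx
    rw [hcn] at h2
    rw [inv_mul_eq_div, le_div_iff₀ hc0, mul_comm _ c, h4]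
    linarith
  refine ⟨N v, c⁻¹, by positivity, inv_pos.2 hc0, inv_lt_one_of_one_lt₀ hc1, fun k => ?_⟩
  refine (hN _).trans ?_
  induction k with
  | zero => simp
  | succ k ih =>
    rw [pow_succ', Module.End.mul_apply, pow_succ]
    refine (hstep _ (hW k v hv)).trans ?_
    have := mul_le_mul_of_nonneg_left ih (inv_pos.2 hc0).le
    linarith

end Stability

/-! ### Weighted Bessel inequalities for integer shifts. -/

section Gram

variable {d : ℕ}

/-- The trigonometric polynomial with the coefficients `c k`, `k ∈ S`. -/
def trigSum (S : Finset (Fin d → ℤ)) (c : (Fin d → ℤ) → ℂ) (ξ : V d) : ℂ :=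
  ∑ k ∈ S, c k * expo k ξ

@[fun_prop]
lemma continuous_trigSum (S : Finset (Fin d → ℤ)) (c : (Fin d → ℤ) → ℂ) :
    Continuous (trigSum S c) := by
  have : ∀ k : Fin d → ℤ, Continuous (expo k) := continuous_expo
  unfold trigSum
  fun_prop

/-- The Bessel type inequality for the shifts of a function with Fourier transform `p`, with a
weight `u`. -/
def WeightedBessel (p : V d → ℂ) (u : V d → ℝ) (D : ℝ) : Prop :=
  ∀ (S : Finset (Fin d → ℤ)) (c : (Fin d → ℤ) → ℂ),
    ∫⁻ ξ, ENNReal.ofReal (‖trigSum S c ξ‖ ^ 2 * (‖p ξ‖ ^ 2 * u ξ)) ≤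
      ENNReal.ofReal (D * ∑ k ∈ S, ‖c k‖ ^ 2)

/-- Schur's test for a finitely supported convolution kernel. -/
lemma norm_sum_toeplitz_le {Ω : Finset (Fin d → ℤ)} {a : (Fin d → ℤ) → ℂ}
    (ha : ∀ l ∉ Ω, a l = 0) (S : Finset (Fin d → ℤ)) (c : (Fin d → ℤ) → ℂ) :
    ‖∑ k ∈ S, ∑ l ∈ S, c k * (starRingEnd ℂ) (c l) * a (k - l)‖ ≤
      (∑ l ∈ Ω, ‖a l‖) * ∑ k ∈ S, ‖c k‖ ^ 2 := by
  have hinj : ∀ (g : (Fin d → ℤ) → Fin d → ℤ), Function.Injective g →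
      ∑ l ∈ S, ‖a (g l)‖ ≤ ∑ l ∈ Ω, ‖a l‖ := by
    intro g hg
    classical
    rw [← Finset.sum_image (f := fun l => ‖a l‖) (s := S) (g := g) hg.injOn]
    rw [← Finset.sum_filter_ne_zero]
    refine Finset.sum_le_sum_of_subset_of_nonneg (fun x hx => ?_) fun _ _ _ => norm_nonneg _
    by_contra h
    exact (Finset.mem_filter.1 hx).2 (by rw [ha x h, norm_zero])
  have h1 : ∀ k l, ‖c k * (starRingEnd ℂ) (c l) * a (k - l)‖ ≤
      1 / 2 * (‖c k‖ ^ 2 * ‖a (k - l)‖) + 1 / 2 * (‖c l‖ ^ 2 * ‖a (k - l)‖) := by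
    intro k l
    rw [norm_mul, norm_mul, RCLike.norm_conj]
    nlinarith [sq_nonneg (‖c k‖ - ‖c l‖), norm_nonneg (a (k - l))]
  have h2 : ∑ k ∈ S, ∑ l ∈ S, ‖c k‖ ^ 2 * ‖a (k - l)‖ ≤
      (∑ l ∈ Ω, ‖a l‖) * ∑ k ∈ S, ‖c k‖ ^ 2 := by
    rw [Finset.mul_sum]
    refine Finset.sum_le_sum fun k _ => ?_
    rw [← Finset.mul_sum, mul_comm]
    exact mul_le_mul_of_nonneg_right (hinj (fun l => k - l) (sub_right_injective)) (by positivity)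
  have h3 : ∑ k ∈ S, ∑ l ∈ S, ‖c l‖ ^ 2 * ‖a (k - l)‖ ≤
      (∑ l ∈ Ω, ‖a l‖) * ∑ k ∈ S, ‖c k‖ ^ 2 := by
    rw [Finset.sum_comm, Finset.mul_sum]
    refine Finset.sum_le_sum fun k _ => ?_
    rw [← Finset.mul_sum, mul_comm]
    exact mul_le_mul_of_nonneg_right (hinj (fun l => l - k) (sub_left_injective)) (by positivity)
  refine (norm_sum_le _ _).trans ((Finset.sum_le_sum fun k _ => norm_sum_le _ _).trans
    ((Finset.sum_le_sum fun k _ => Finset.sum_le_sum fun l _ => h1 k l).trans ?_))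
  simp only [Finset.sum_add_distrib]
  simp only [← Finset.mul_sum] at h2 h3 ⊢
  linarith

/-- Expanding `|∑ c_k e(k)|²` turns the integral into the quadratic form of the Toeplitz matrix of
correlations, which Schur's test bounds when only finitely many correlations are nonzero. -/
lemma weightedBessel_of_correlation {p : V d → ℂ} {u : V d → ℝ} (hu : ∀ ξ, 0 ≤ u ξ)
    (hi : Integrable (fun ξ => ‖p ξ‖ ^ 2 * u ξ)) {Ω : Finset (Fin d → ℤ)}
    (ha : ∀ l ∉ Ω, ∫ ξ, expo l ξ * ((‖p ξ‖ ^ 2 * u ξ : ℝ) : ℂ) = 0) :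
    WeightedBessel p u (∑ l ∈ Ω, ‖∫ ξ, expo l ξ * ((‖p ξ‖ ^ 2 * u ξ : ℝ) : ℂ)‖) := by
  intro S c
  set w : V d → ℝ := fun ξ => ‖p ξ‖ ^ 2 * u ξ with hw
  have hw0 : ∀ ξ, 0 ≤ w ξ := fun ξ => mul_nonneg (by positivity) (hu ξ)
  have hie : ∀ l : Fin d → ℤ, Integrable (fun ξ => expo l ξ * (w ξ : ℂ)) := fun l =>
    hi.ofReal.bdd_mul (c := 1) (continuous_expo l).aestronglyMeasurable
      (Filter.Eventually.of_forall fun ξ => (norm_expo l ξ).le)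
  have hexp : ∀ ξ, ((‖trigSum S c ξ‖ ^ 2 * w ξ : ℝ) : ℂ) =
      ∑ k ∈ S, ∑ l ∈ S, c k * (starRingEnd ℂ) (c l) * (expo (k - l) ξ * (w ξ : ℂ)) := by
    intro ξ
    push_cast
    rw [← Complex.mul_conj', trigSum, map_sum, Finset.sum_mul_sum, Finset.sum_mul]
    refine Finset.sum_congr rfl fun k _ => ?_
    rw [Finset.sum_mul]
    refine Finset.sum_congr rfl fun l _ => ?_
    rw [map_mul, conj_expo, sub_eq_add_neg, expo_add]
    ring
  have hI : Integrable (fun ξ => ((‖trigSum S c ξ‖ ^ 2 * w ξ : ℝ) : ℂ)) := by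
    simp only [hexp]
    exact integrable_finsetSum _ fun k _ => integrable_finsetSum _ fun l _ => (hie _).const_mul _
  have hIr : Integrable (fun ξ => ‖trigSum S c ξ‖ ^ 2 * w ξ) := by
    exact hI.re
  rw [← ofReal_integral_eq_lintegral_ofReal hIr
    (Filter.Eventually.of_forall fun ξ => mul_nonneg (by positivity) (hw0 ξ))]
  refine ENNReal.ofReal_le_ofReal ?_
  have h1 := norm_sum_toeplitz_le ha S c
  refine le_trans ?_ h1
  rw [← Real.norm_of_nonneg (integral_nonneg fun ξ => mul_nonneg (by positivity) (hw0 ξ)),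
    ← Complex.norm_real, ← integral_complex_ofReal]
  refine le_of_eq (congrArg _ ?_)
  simp only [hexp]
  rw [integral_finsetSum _ fun k _ => integrable_finsetSum _ fun l _ => (hie _).const_mul _]
  refine Finset.sum_congr rfl fun k _ => ?_
  rw [integral_finsetSum _ fun l _ => (hie _).const_mul _]
  exact Finset.sum_congr rfl fun l _ => integral_const_mul _ _

end Gram

/-! ### Weighted correlations and the transfer operator. -/

section Decay

open Filter Topology

variable {d : ℕ} {M : Matrix (Fin d) (Fin d) ℤ} {t : V d → ℂ}

/-- A trigonometric polynomial which is comparable to the squared distance to the lattice. -/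
def latticeGap (ξ : V d) : ℝ := ∑ j : Fin d, ‖1 - expo (Pi.single j 1) ξ‖ ^ 2

lemma latticeGap_nonneg (ξ : V d) : 0 ≤ latticeGap ξ :=
  Finset.sum_nonneg fun _ _ => by positivity

@[fun_prop]
lemma continuous_latticeGap : Continuous (latticeGap : V d → ℝ) := by
  unfold latticeGap; fun_prop

lemma latticeGap_le (ξ : V d) : latticeGap ξ ≤ 4 * d := by
  have h1 : ∀ j : Fin d, ‖1 - expo (Pi.single j 1) ξ‖ ^ 2 ≤ 4 := fun j => by
    have := norm_sub_le (1 : ℂ) (expo (Pi.single j 1) ξ)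
    rw [norm_one, norm_expo] at this
    nlinarith [norm_nonneg (1 - expo (Pi.single j 1) ξ)]
  refine (Finset.sum_le_sum fun j _ => h1 j).trans (le_of_eq ?_)
  simp [mul_comm]

lemma exists_latticeGap_le_sq : ∃ K, 0 ≤ K ∧ ∀ ξ : V d, latticeGap ξ ≤ K * ‖ξ‖ ^ 2 := by
  choose L hL h using fun j : Fin d =>
    (isTrigPoly_expo (Pi.single j 1 : Fin d → ℤ)).lipschitz_zero
  refine ⟨∑ j, L j ^ 2, by positivity, fun ξ => ?_⟩
  rw [Finset.sum_mul]
  refine Finset.sum_le_sum fun j _ => ?_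
  rw [← mul_pow, norm_sub_rev]
  have := h j ξ
  rw [expo_zero_right] at this
  gcongr

lemma expo_single (j : Fin d) (ξ : V d) :
    expo (Pi.single j 1) ξ = Complex.exp (Complex.I * ((2 * Real.pi * ξ j : ℝ) : ℂ)) := by
  rw [expo]
  congr 1
  rw [Finset.sum_eq_single j (fun i _ hi => by simp [Pi.single_eq_of_ne hi]) (by simp)]
  simp
  ring

/-- In each coordinate `|1 - e^{2πix}| = 2 |sin πx| ≥ 4 |x|` for `|x| ≤ 1/2`, whence the factor
`16`. -/
lemma le_latticeGap {ξ : V d} (h : ‖ξ‖ ≤ 1 / 2) : 16 * ‖ξ‖ ^ 2 ≤ latticeGap ξ := by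
  rw [EuclideanSpace.norm_sq_eq, Finset.mul_sum]
  refine Finset.sum_le_sum fun j _ => ?_
  rw [norm_sub_rev, expo_single, Complex.norm_exp_I_mul_ofReal_sub_one]
  have hj : |ξ j| ≤ 1 / 2 := (PiLp.norm_apply_le ξ j).trans h
  have h1 := Real.mul_abs_le_abs_sin (x := 2 * Real.pi * ξ j / 2) (by
    rw [mul_assoc, mul_div_cancel_left₀ _ (two_ne_zero), abs_mul, abs_of_pos Real.pi_pos]
    nlinarith [Real.pi_pos])
  have h2 : 2 / Real.pi * |2 * Real.pi * ξ j / 2| = 2 * |ξ j| := by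
    rw [mul_assoc, mul_div_cancel_left₀ _ (two_ne_zero), abs_mul, abs_of_pos Real.pi_pos]
    field_simp
  rw [h2] at h1
  rw [norm_mul, Real.norm_ofNat, Real.norm_eq_abs, Real.norm_eq_abs]
  nlinarith [abs_nonneg (ξ j)]

lemma norm_one_sub_expo_sq (k : Fin d → ℤ) (ξ : V d) :
    ((‖1 - expo k ξ‖ ^ 2 : ℝ) : ℂ) = 2 - expo k ξ - expo (-k) ξ := by
  push_cast
  rw [← Complex.mul_conj', map_sub, map_one, conj_expo]
  linear_combination expo_mul_neg k ξ

lemma IsDilation.transpose_det_ne_zero (hM : IsDilation M) : (toReal M)ᵀ.det ≠ 0 := by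
  rw [Matrix.det_transpose, toReal_det]
  exact Int.cast_ne_zero.2 hM.det_ne_zero

lemma IsDilation.transpose_inv_det_ne_zero (hM : IsDilation M) : (toReal M)ᵀ⁻¹.det ≠ 0 := by
  exact (Matrix.isUnit_nonsing_inv_det _ hM.transpose_det_ne_zero.isUnit).ne_zero

lemma exists_finset_lattice (R : ℝ) :
    ∃ Ω : Finset (Fin d → ℤ), ∀ l ∉ Ω, R < ‖intVec l‖ := by
  refine ⟨Fintype.piFinset fun _ => Finset.Icc (-⌈R⌉) ⌈R⌉, fun l hl => ?_⟩
  simp only [Fintype.mem_piFinset, Finset.mem_Icc, not_forall] at hl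
  obtain ⟨j, hj⟩ := hl
  have h1 : ⌈R⌉ < |l j| := by
    by_contra h
    exact hj (abs_le.1 (not_lt.1 h))
  have h2 : (⌈R⌉ : ℝ) < |(l j : ℝ)| := by exact_mod_cast h1
  exact (Int.le_ceil R).trans_lt (h2.trans_le (PiLp.norm_apply_le (intVec l) j))

/-- The correlations of the refinable function with the weight `latticeGap (M^{*-i} ξ)`. -/
def gapCorr (M : Matrix (Fin d) (Fin d) ℤ) (t : V d → ℂ) (i : ℕ) (l : Fin d → ℤ) : ℂ :=
  ∫ ξ, expo l ξ * ((‖refinableHat M t ξ‖ ^ 2 * latticeGap (act ((toReal M)ᵀ⁻¹ ^ i) ξ) : ℝ) : ℂ)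

lemma integrable_mul_latticeGap {ρ : V d → ℝ} (hρ : Integrable ρ)
    (A : Matrix (Fin d) (Fin d) ℝ) : Integrable (fun ξ => ρ ξ * latticeGap (act A ξ)) :=
  hρ.mul_bdd (c := 4 * d) (by fun_prop) (Eventually.of_forall fun ξ => by
    rw [Real.norm_of_nonneg (latticeGap_nonneg _)]; exact latticeGap_le _)

/-- The weight is a combination of exponentials with frequencies `0` and `±M^{-i} e_j`. These are
bounded uniformly in `i`, so the support of the correlations is enlarged by a bounded amount and one
finite set serves for all `i`. -/
lemma IsRefinableMask.exists_gapCorr_support (ht : IsRefinableMask t)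
    (𝒩 : AdaptedNorm (toReal M)⁻¹) (𝒩' : AdaptedNorm (toReal M)ᵀ⁻¹)
    (hint : Integrable (fun ξ => ‖refinableHat M t ξ‖ ^ 2)) :
    ∃ Ω : Finset (Fin d → ℤ), ∀ i, ∀ l ∉ Ω, gapCorr M t i l = 0 := by
  obtain ⟨R, hR0, hR⟩ := ht.exists_correlation_eq_zero 𝒩 𝒩' hint
  obtain ⟨Ω, hΩ⟩ := exists_finset_lattice (d := d)
    (R + ∑ j : Fin d, 𝒩.N (intVec (Pi.single j 1)))
  refine ⟨Ω, fun i l hl => ?_⟩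
  have hl := hΩ l hl
  have hex : ∀ x : V d, Integrable (fun ξ => ex x ξ * ((‖refinableHat M t ξ‖ ^ 2 : ℝ) : ℂ)) :=
    fun x => hint.ofReal.bdd_mul (c := 1) (continuous_ex x).aestronglyMeasurable
      (Eventually.of_forall fun ξ => (norm_ex x ξ).le)
  set y : Fin d → V d := fun j => act ((toReal M)⁻¹ ^ i) (intVec (Pi.single j 1)) with hy
  have hyn : ∀ j, ‖y j‖ ≤ ∑ j : Fin d, 𝒩.N (intVec (Pi.single j 1)) := fun j => by
    refine ((𝒩.norm_le _).trans ((𝒩.act_pow_le i _).trans (mul_le_of_le_one_left (𝒩.nonneg _)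
      (pow_le_one₀ 𝒩.κ_pos.le 𝒩.κ_lt.le)))).trans ?_
    exact Finset.single_le_sum (f := fun j => 𝒩.N (intVec (Pi.single j 1)))
      (fun j _ => 𝒩.nonneg _) (Finset.mem_univ j)
  have hT : ((toReal M)ᵀ⁻¹ ^ i) = ((toReal M)⁻¹ ^ i)ᵀ := by
    rw [Matrix.transpose_pow, Matrix.transpose_nonsing_inv]
  have hpt : ∀ ξ, expo l ξ *
      ((‖refinableHat M t ξ‖ ^ 2 * latticeGap (act ((toReal M)ᵀ⁻¹ ^ i) ξ) : ℝ) : ℂ) =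
      ∑ j, (2 * (ex (intVec l) ξ * ((‖refinableHat M t ξ‖ ^ 2 : ℝ) : ℂ)) -
        ex (intVec l + y j) ξ * ((‖refinableHat M t ξ‖ ^ 2 : ℝ) : ℂ) -
        ex (intVec l - y j) ξ * ((‖refinableHat M t ξ‖ ^ 2 : ℝ) : ℂ)) := by
    intro ξ
    rw [latticeGap, Complex.ofReal_mul, Complex.ofReal_sum, Finset.mul_sum, Finset.mul_sum]
    refine Finset.sum_congr rfl fun j _ => ?_
    rw [norm_one_sub_expo_sq, sub_eq_add_neg (intVec l), ex_add_left, ex_add_left,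
      expo_eq_ex, expo_eq_ex, expo_eq_ex, intVec_neg, hT, ← ex_act, ← ex_act, act_neg]
    ring
  rw [gapCorr]
  simp only [hpt]
  have hsub : ∀ x z : V d, Integrable (fun ξ =>
      2 * (ex x ξ * ((‖refinableHat M t ξ‖ ^ 2 : ℝ) : ℂ)) -
        ex z ξ * ((‖refinableHat M t ξ‖ ^ 2 : ℝ) : ℂ)) :=
    fun x z => ((hex x).const_mul 2).sub (hex z)
  have hsub' : ∀ x z z' : V d, Integrable (fun ξ =>
      2 * (ex x ξ * ((‖refinableHat M t ξ‖ ^ 2 : ℝ) : ℂ)) -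
        ex z ξ * ((‖refinableHat M t ξ‖ ^ 2 : ℝ) : ℂ) -
        ex z' ξ * ((‖refinableHat M t ξ‖ ^ 2 : ℝ) : ℂ)) :=
    fun x z z' => (hsub x z).sub (hex z')
  rw [integral_finsetSum _ fun j _ => hsub' _ _ _]
  refine Finset.sum_eq_zero fun j _ => ?_
  rw [integral_sub (hsub _ _) (hex _), integral_sub ((hex _).const_mul 2) (hex _),
    integral_const_mul, hR, hR, hR]
  · simp
  · have := norm_sub_norm_le (intVec l) (y j)
    linarith [hyn j]
  · have := norm_sub_norm_le (intVec l) (-(y j))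
    rw [sub_neg_eq_add, norm_neg] at this
    linarith [hyn j]
  · linarith [(norm_nonneg _).trans (hyn j)]

/-- Dominated convergence: the weight is bounded by `4 d` and tends to its value `0` at the origin
pointwise. -/
lemma IsRefinableMask.tendsto_gapCorr (ht : IsRefinableMask t) (𝒩' : AdaptedNorm (toReal M)ᵀ⁻¹)
    (hint : Integrable (fun ξ => ‖refinableHat M t ξ‖ ^ 2)) (l : Fin d → ℤ) :
    Tendsto (fun i => gapCorr M t i l) atTop (𝓝 0) := by
  have hmeas := ht.measurable_refinableHat 𝒩'
  have h1 : Tendsto (fun i => gapCorr M t i l) atTop (𝓝 (∫ _ : V d, (0 : ℂ))) := by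
    refine tendsto_integral_of_dominated_convergence
      (fun ξ => ‖refinableHat M t ξ‖ ^ 2 * (4 * d)) (fun i => ?_) (hint.mul_const _)
      (fun i => Eventually.of_forall fun ξ => ?_) (Eventually.of_forall fun ξ => ?_)
    · have h2 : Measurable (fun ξ : V d => latticeGap (act ((toReal M)ᵀ⁻¹ ^ i) ξ)) :=
        (by fun_prop : Continuous _).measurable
      have h3 := (continuous_expo l).measurable
      exact Measurable.aestronglyMeasurable (by fun_prop)
    · rw [norm_mul, norm_expo, one_mul, Complex.norm_real, Real.norm_of_nonneg
        (mul_nonneg (by positivity) (latticeGap_nonneg _))]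
      gcongr
      exact latticeGap_le _
    · have h2 : Tendsto (fun i => act ((toReal M)ᵀ⁻¹ ^ i) ξ) atTop (𝓝 0) := by
        refine squeeze_zero_norm (fun i => (𝒩'.norm_le _).trans (𝒩'.act_pow_le i ξ)) ?_
        simpa using (tendsto_pow_atTop_nhds_zero_of_lt_one 𝒩'.κ_pos.le 𝒩'.κ_lt).mul_const (𝒩'.N ξ)
      have h3 : Tendsto (fun i => latticeGap (act ((toReal M)ᵀ⁻¹ ^ i) ξ)) atTop (𝓝 0) := by
        have := (continuous_latticeGap.tendsto (0 : V d)).comp h2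
        have h0 : latticeGap (0 : V d) = 0 := by simp [latticeGap, expo_zero_right]
        rwa [h0] at this
      have h4 := (Complex.continuous_ofReal.tendsto _).comp
        (h3.const_mul (‖refinableHat M t ξ‖ ^ 2))
      have h5 := h4.const_mul (expo l ξ)
      simpa [Function.comp_def] using h5
  simpa using h1

/-- Substitute `M^* ξ` and use the refinement equation: `|t|²` contributes its Fourier coefficients
`b`, and the weight with index `i + 1` becomes the one with index `i`. The linear recursion does not
depend on `i`. -/
lemma IsRefinableMask.gapCorr_succ (ht : IsRefinableMask t) (hM : IsDilation M)
    (𝒩' : AdaptedNorm (toReal M)ᵀ⁻¹)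
    (hint : Integrable (fun ξ => ‖refinableHat M t ξ‖ ^ 2)) {b : (Fin d → ℤ) →₀ ℂ}
    (hb : ∀ ξ, ((‖t ξ‖ : ℂ)) ^ 2 = b.sum (fun k a => a * expo k ξ)) (i : ℕ) (l : Fin d → ℤ) :
    gapCorr M t (i + 1) l = (absDet M : ℂ) * b.sum (fun k a => a * gapCorr M t i (M *ᵥ l + k)) := by
  have hdet := hM.transpose_det_ne_zero
  have hie : ∀ k : Fin d → ℤ, Integrable (fun ξ => expo k ξ *
      ((‖refinableHat M t ξ‖ ^ 2 * latticeGap (act ((toReal M)ᵀ⁻¹ ^ i) ξ) : ℝ) : ℂ)) := fun k =>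
    (integrable_mul_latticeGap hint _).ofReal.bdd_mul (c := 1)
      (continuous_expo k).aestronglyMeasurable (Eventually.of_forall fun ξ => (norm_expo k ξ).le)
  have h1 := integral_comp_act hdet (fun ξ => expo l ξ *
    ((‖refinableHat M t ξ‖ ^ 2 * latticeGap (act ((toReal M)ᵀ⁻¹ ^ (i + 1)) ξ) : ℝ) : ℂ))
  rw [Matrix.det_transpose, toReal_det, ← absDet, ← gapCorr] at h1
  have hm : (absDet M : ℂ) ≠ 0 := by
    exact_mod_cast (absDet_pos hM.det_ne_zero).ne'
  have h2 : gapCorr M t (i + 1) l = (absDet M : ℂ) * ((absDet M)⁻¹ • gapCorr M t (i + 1) l) := by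
    rw [Complex.real_smul, Complex.ofReal_inv, mul_inv_cancel_left₀ hm]
  rw [h2, ← h1]
  congr 1
  have hpt : ∀ ξ, expo l (act (toReal M)ᵀ ξ) *
      ((‖refinableHat M t (act (toReal M)ᵀ ξ)‖ ^ 2 *
        latticeGap (act ((toReal M)ᵀ⁻¹ ^ (i + 1)) (act (toReal M)ᵀ ξ)) : ℝ) : ℂ) =
      ∑ k ∈ b.support, b k * (expo (M *ᵥ l + k) ξ *
      ((‖refinableHat M t ξ‖ ^ 2 * latticeGap (act ((toReal M)ᵀ⁻¹ ^ i) ξ) : ℝ) : ℂ)) := by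
    intro ξ
    rw [ht.refinableHat_eq 𝒩', pow_succ (toReal M)ᵀ⁻¹, act_mul, act_inv_act hdet, norm_mul, mul_pow,
      ← expo_mulVec]
    push_cast
    rw [hb, Finsupp.sum, Finset.sum_mul, Finset.sum_mul, Finset.mul_sum]
    refine Finset.sum_congr rfl fun k _ => ?_
    rw [expo_add]
    ring
  simp only [hpt]
  rw [integral_finsetSum _ fun k _ => (hie _).const_mul _, Finsupp.sum]
  exact Finset.sum_congr rfl fun k _ => integral_const_mul _ _

/-- Geometric decay of the weighted correlations. -/
lemma IsRefinableMask.exists_gapCorr_decay (ht : IsRefinableMask t) (hM : IsDilation M)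
    (hint : Integrable (fun ξ => ‖refinableHat M t ξ‖ ^ 2)) :
    ∃ C θ : ℝ, 0 ≤ C ∧ 0 < θ ∧ θ < 1 ∧ ∀ i,
      WeightedBessel (refinableHat M t) (fun ξ => latticeGap (act ((toReal M)ᵀ⁻¹ ^ i) ξ))
        (C * θ ^ i) := by
  obtain ⟨𝒩⟩ := hM.nonempty_adaptedNorm
  obtain ⟨𝒩'⟩ := hM.nonempty_adaptedNorm_transpose
  obtain ⟨Ω, hΩ⟩ := ht.exists_gapCorr_support 𝒩 𝒩' hint
  obtain ⟨b, hb⟩ := ht.1.normSq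
  classical
  -- The transfer operator truncated to `Ω`. On the correlation vectors nothing is lost, since the
  -- correlations vanish off `Ω`.
  let f : (Ω → ℂ) →ₗ[ℂ] (Ω → ℂ) := LinearMap.pi fun l =>
    (absDet M : ℂ) • ∑ k ∈ b.support, b k •
      (if h : M *ᵥ l.1 + k ∈ Ω then LinearMap.proj (⟨_, h⟩ : Ω) else 0)
  let v : ℕ → Ω → ℂ := fun i l => gapCorr M t i l
  have hf : ∀ i, f (v i) = v (i + 1) := by
    intro i
    ext l
    simp only [f, v, LinearMap.pi_apply, LinearMap.smul_apply, LinearMap.sum_apply, smul_eq_mul]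
    rw [ht.gapCorr_succ hM 𝒩' hint hb, Finsupp.sum]
    congr 1
    refine Finset.sum_congr rfl fun k _ => ?_
    congr 1
    split_ifs with h
    · rfl
    · exact (hΩ i _ h).symm
  have hfp : ∀ i, (f ^ i) (v 0) = v i := by
    intro i
    induction i with
    | zero => rfl
    | succ i ih => rw [pow_succ', Module.End.mul_apply, ih, hf]
  obtain ⟨C, θ, hC, hθ0, hθ1, h⟩ := exists_geometric_bound f (v 0) (by
    simp only [hfp]
    exact tendsto_pi_nhds.2 fun l => ht.tendsto_gapCorr 𝒩' hint l)
  refine ⟨Ω.card * C, θ, by positivity, hθ0, hθ1, fun i => ?_⟩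
  have h1 := weightedBessel_of_correlation (p := refinableHat M t)
    (u := fun ξ => latticeGap (act ((toReal M)ᵀ⁻¹ ^ i) ξ)) (fun ξ => latticeGap_nonneg _)
    (integrable_mul_latticeGap hint _) (hΩ i)
  intro S c
  refine (h1 S c).trans (ENNReal.ofReal_le_ofReal ?_)
  refine mul_le_mul_of_nonneg_right ?_ (by positivity)
  rw [mul_assoc, ← nsmul_eq_mul]
  refine Finset.sum_le_card_nsmul _ _ _ fun l hl => ?_
  have h2 := (norm_le_pi_norm (v i) ⟨l, hl⟩)
  rw [← hfp] at h2
  refine le_trans (le_of_eq ?_) (h2.trans (h i))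
  rw [hfp]
  rfl

lemma IsRefinableMask.exists_weightedBessel_one (ht : IsRefinableMask t) (hM : IsDilation M)
    (hint : Integrable (fun ξ => ‖refinableHat M t ξ‖ ^ 2)) :
    ∃ D, 0 ≤ D ∧ WeightedBessel (refinableHat M t) (fun _ => 1) D := by
  obtain ⟨𝒩⟩ := hM.nonempty_adaptedNorm
  obtain ⟨𝒩'⟩ := hM.nonempty_adaptedNorm_transpose
  obtain ⟨R, hR0, hR⟩ := ht.exists_correlation_eq_zero 𝒩 𝒩' hint
  obtain ⟨Ω, hΩ⟩ := exists_finset_lattice (d := d) R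
  refine ⟨_, by positivity, weightedBessel_of_correlation (Ω := Ω) (fun _ => zero_le_one)
    (by simpa using hint) fun l hl => ?_⟩
  simp only [expo_eq_ex, mul_one]
  exact hR _ (hΩ l hl)

end Decay

/-! ### Dilations on the Fourier side and the one-scale Bessel inequality. -/

section Dilation

open Filter Topology

variable {d : ℕ} {M : Matrix (Fin d) (Fin d) ℤ} {t : V d → ℂ}

/-- The point `M^{*-j} ξ`. -/
def scale (M : Matrix (Fin d) (Fin d) ℤ) (j : ℤ) (ξ : V d) : V d := act ((toReal M)ᵀ⁻¹ ^ j) ξ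

@[fun_prop]
lemma continuous_scale (j : ℤ) : Continuous (scale M j) := continuous_act _

lemma scale_zero (ξ : V d) : scale M 0 ξ = ξ := by rw [scale, zpow_zero, act_one]

lemma scale_one (ξ : V d) : scale M 1 ξ = act (toReal M)ᵀ⁻¹ ξ := by rw [scale, zpow_one]

lemma scale_natCast (n : ℕ) (ξ : V d) : scale M n ξ = act ((toReal M)ᵀ⁻¹ ^ n) ξ := by
  rw [scale, zpow_natCast]

lemma IsDilation.scale_add (hM : IsDilation M) (i j : ℤ) (ξ : V d) :
    scale M (i + j) ξ = scale M i (scale M j ξ) := by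
  rw [scale, Matrix.zpow_add hM.transpose_inv_det_ne_zero.isUnit, act_mul]; rfl

lemma IsDilation.scale_add_one (hM : IsDilation M) (j : ℤ) (ξ : V d) :
    scale M (j + 1) ξ = act (toReal M)ᵀ⁻¹ (scale M j ξ) := by
  rw [add_comm, hM.scale_add, scale_one]

lemma IsDilation.act_scale_add_one (hM : IsDilation M) (j : ℤ) (ξ : V d) :
    act (toReal M)ᵀ (scale M (j + 1) ξ) = scale M j ξ := by
  rw [hM.scale_add_one, act_act_inv hM.transpose_det_ne_zero]

lemma IsDilation.det_zpow_ne_zero (hM : IsDilation M) (j : ℤ) :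
    ((toReal M)ᵀ⁻¹ ^ j).det ≠ 0 := (hM.transpose_inv_det_ne_zero.isUnit.det_zpow j).ne_zero

lemma IsDilation.scale_ne_zero (hM : IsDilation M) (j : ℤ) {ξ : V d} (hξ : ξ ≠ 0) :
    scale M j ξ ≠ 0 := by
  intro h
  have h1 := hM.scale_add (-j) j ξ
  rw [neg_add_cancel, scale_zero, h, scale, act_zero] at h1
  exact hξ h1

lemma IsDilation.abs_det_zpow (hM : IsDilation M) (j : ℤ) :
    |((toReal M)ᵀ⁻¹ ^ j).det| = absDet M ^ (-j) := by
  have hm := (absDet_pos hM.det_ne_zero).ne'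
  have h1 : |(toReal M)ᵀ⁻¹.det| = (absDet M)⁻¹ := by
    rw [Matrix.det_nonsing_inv, Ring.inverse_eq_inv', abs_inv, Matrix.det_transpose, toReal_det]
    rfl
  induction j using Int.induction_on with
  | zero => simp
  | succ n ih =>
    rw [Matrix.zpow_add_one hM.transpose_inv_det_ne_zero.isUnit, Matrix.det_mul, abs_mul, ih, h1,
      neg_add, zpow_add₀ hm, _root_.zpow_neg_one]
  | pred n ih =>
    rw [Matrix.zpow_sub_one hM.transpose_inv_det_ne_zero.isUnit, Matrix.det_mul, abs_mul, ih,
      Matrix.det_nonsing_inv, Ring.inverse_eq_inv', abs_inv, h1, inv_inv, neg_sub, sub_neg_eq_add,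
      neg_neg, add_comm, zpow_add_one₀ hm]

lemma lintegral_comp_scale (hM : IsDilation M) (j : ℤ) (f : V d → ENNReal) :
    ∫⁻ ξ, f (scale M j ξ) = ENNReal.ofReal (absDet M ^ j) * ∫⁻ ξ, f ξ := by
  have := lintegral_comp_act (hM.det_zpow_ne_zero j) f
  rwa [hM.abs_det_zpow, _root_.zpow_neg, inv_inv] at this

lemma integral_comp_scale {E : Type*} [NormedAddCommGroup E] [NormedSpace ℝ E]
    (hM : IsDilation M) (j : ℤ) (f : V d → E) :
    ∫ ξ, f (scale M j ξ) = absDet M ^ j • ∫ ξ, f ξ := by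
  have := integral_comp_act (hM.det_zpow_ne_zero j) f
  rwa [hM.abs_det_zpow, _root_.zpow_neg, inv_inv] at this

/-- The normalizing factor `m^{-j/2}`. -/
def scaleFactor (M : Matrix (Fin d) (Fin d) ℤ) (j : ℤ) : ℝ := absDet M ^ (-(j : ℝ) / 2)

lemma IsDilation.scaleFactor_pos (hM : IsDilation M) (j : ℤ) : 0 < scaleFactor M j :=
  Real.rpow_pos_of_pos (absDet_pos hM.det_ne_zero) _

lemma IsDilation.scaleFactor_sq (hM : IsDilation M) (j : ℤ) :
    scaleFactor M j ^ 2 = absDet M ^ (-j) := by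
  rw [scaleFactor, ← Real.rpow_natCast, ← Real.rpow_mul (absDet_pos hM.det_ne_zero).le,
    ← Real.rpow_intCast]
  congr 1
  push_cast
  ring

lemma IsDilation.scaleFactor_add_one (hM : IsDilation M) (j : ℤ) :
    scaleFactor M j = Real.sqrt (absDet M) * scaleFactor M (j + 1) := by
  rw [scaleFactor, scaleFactor, Real.sqrt_eq_rpow, ← Real.rpow_add (absDet_pos hM.det_ne_zero)]
  congr 1
  push_cast
  ring

/-- The Fourier transform of `m^{j/2} f (M^j · + k)` for a function `f` with Fourier
transform `p`. -/
def dilHat (M : Matrix (Fin d) (Fin d) ℤ) (p : V d → ℂ) (j : ℤ) (k : Fin d → ℤ) (ξ : V d) : ℂ :=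
  scaleFactor M j * (expo k (scale M j ξ) * p (scale M j ξ))

/-- The inner products with the functions `dilHat M p j k`. -/
def coef (M : Matrix (Fin d) (Fin d) ℤ) (p : V d → ℂ) (j : ℤ) (k : Fin d → ℤ) (F : V d → ℂ) : ℂ :=
  ∫ ξ, (starRingEnd ℂ) (dilHat M p j k ξ) * F ξ

lemma memLp_dilHat (hM : IsDilation M) {p : V d → ℂ} (hpm : Measurable p) (hp : MemLp p 2)
    (j : ℤ) (k : Fin d → ℤ) : MemLp (dilHat M p j k) 2 := by
  have h1 : Measurable (dilHat M p j k) := by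
    have h2 := (continuous_expo k).measurable
    have h3 := (continuous_scale (M := M) j).measurable
    unfold dilHat
    fun_prop
  rw [memLp_two_iff_integrable_sq_norm h1.aestronglyMeasurable]
  have h2 := integrable_comp_act (hM.det_zpow_ne_zero j)
    ((memLp_two_iff_integrable_sq_norm hpm.aestronglyMeasurable).1 hp)
  refine (h2.const_mul (scaleFactor M j ^ 2)).congr (Eventually.of_forall fun ξ => ?_)
  simp only [dilHat, norm_mul, norm_expo, one_mul, mul_pow, Complex.norm_real, Real.norm_eq_abs,
    sq_abs]
  rfl

lemma integrable_conj_mul {f g : V d → ℂ} (hf : MemLp f 2) (hg : MemLp g 2) :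
    Integrable (fun ξ => (starRingEnd ℂ) (f ξ) * g ξ) :=
  hf.star.integrable_mul hg

/-- The Bessel inequality on one scale. -/
lemma WeightedBessel.sum_coef_le (hM : IsDilation M) {p : V d → ℂ} {u : V d → ℝ} {D : ℝ}
    (hB : WeightedBessel p u D) (hD : 0 < D) (hpm : Measurable p) (hp : MemLp p 2)
    (hum : Measurable u) (hu : ∀ ξ, 1 ≤ u ξ) {F : V d → ℂ} (hF : MemLp F 2) (j : ℤ)
    (S : Finset (Fin d → ℤ)) :
    ∑ k ∈ S, ‖coef M p j k F‖ ^ 2 ≤ D * ∫ ξ, ‖F ξ‖ ^ 2 / u (scale M j ξ) := by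
  -- A duality argument: `X = ∑ |a_k|²` is the inner product of `F` with `A = ∑ a_k dilHat`, while
  -- the weighted Bessel inequality bounds `∫ |A|² u` by `D X`.
  set a : (Fin d → ℤ) → ℂ := fun k => coef M p j k F with ha
  set A : V d → ℂ := fun ξ => ∑ k ∈ S, a k * dilHat M p j k ξ with hA
  set X : ℝ := ∑ k ∈ S, ‖a k‖ ^ 2 with hX
  have hsm := (continuous_scale (M := M) j).measurable
  have hAeq : ∀ ξ, A ξ = scaleFactor M j * (trigSum S a (scale M j ξ) * p (scale M j ξ)) := by
    intro ξ
    simp only [hA, dilHat, trigSum, Finset.sum_mul, Finset.mul_sum]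
    exact Finset.sum_congr rfl fun k _ => by ring
  have hAm : Measurable A := by
    have h3 := (continuous_trigSum S a).measurable
    rw [funext hAeq]
    fun_prop
  have hAL : MemLp A 2 := memLp_finsetSum _ fun k _ => (memLp_dilHat hM hpm hp j k).const_mul _
  have hAu : ∫⁻ ξ, ENNReal.ofReal (‖A ξ‖ ^ 2 * u (scale M j ξ)) ≤ ENNReal.ofReal (D * X) := by
    have h1 := lintegral_comp_scale hM j
      (fun ξ => ENNReal.ofReal (‖trigSum S a ξ‖ ^ 2 * (‖p ξ‖ ^ 2 * u ξ)))
    have h2 : ∀ ξ, ENNReal.ofReal (‖A ξ‖ ^ 2 * u (scale M j ξ)) =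
        ENNReal.ofReal (absDet M ^ (-j)) * ENNReal.ofReal (‖trigSum S a (scale M j ξ)‖ ^ 2 *
          (‖p (scale M j ξ)‖ ^ 2 * u (scale M j ξ))) := by
      intro ξ
      rw [← ENNReal.ofReal_mul (zpow_nonneg (absDet_pos hM.det_ne_zero).le _), ← hM.scaleFactor_sq,
        hAeq, norm_mul, norm_mul, Complex.norm_real, Real.norm_of_nonneg (hM.scaleFactor_pos j).le]
      congr 1
      ring
    simp only [h2]
    rw [lintegral_const_mul' _ _ ENNReal.ofReal_ne_top, h1, ← mul_assoc, ← ENNReal.ofReal_mul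
      (zpow_nonneg (absDet_pos hM.det_ne_zero).le _), ← zpow_add₀ (absDet_pos hM.det_ne_zero).ne',
      neg_add_cancel, zpow_zero, ENNReal.ofReal_one, one_mul]
    exact hB S a
  have hu0 : ∀ ξ, 0 < u ξ := fun ξ => zero_lt_one.trans_le (hu ξ)
  have hmeas1 : AEStronglyMeasurable (fun ξ => ‖A ξ‖ ^ 2 * u (scale M j ξ)) volume :=
    Measurable.aestronglyMeasurable (by fun_prop)
  have hnn1 : 0 ≤ᵐ[volume] fun ξ => ‖A ξ‖ ^ 2 * u (scale M j ξ) :=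
    Eventually.of_forall fun ξ => mul_nonneg (by positivity) (hu0 _).le
  have hI1 : Integrable (fun ξ => ‖A ξ‖ ^ 2 * u (scale M j ξ)) :=
    ⟨hmeas1, (hasFiniteIntegral_iff_ofReal hnn1).2 (hAu.trans_lt ENNReal.ofReal_lt_top)⟩
  have hX0 : 0 ≤ X := Finset.sum_nonneg fun _ _ => by positivity
  have hI1' : ∫ ξ, ‖A ξ‖ ^ 2 * u (scale M j ξ) ≤ D * X := by
    rw [integral_eq_lintegral_of_nonneg_ae hnn1 hmeas1]
    exact ENNReal.toReal_le_of_le_ofReal (by positivity) hAu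
  have hI2 : Integrable (fun ξ => ‖F ξ‖ ^ 2 / u (scale M j ξ)) := by
    refine ((memLp_two_iff_integrable_sq_norm hF.1).1 hF).mono' ?_ (Eventually.of_forall fun ξ => ?_)
    · have := hF.1
      exact ((this.norm.aemeasurable.pow_const 2).div (hum.comp hsm).aemeasurable).aestronglyMeasurable
    · rw [Real.norm_of_nonneg (div_nonneg (by positivity) (hu0 _).le)]
      exact div_le_self (by positivity) (hu _)
  have hXeq : (X : ℂ) = ∫ ξ, (starRingEnd ℂ) (A ξ) * F ξ := by
    have h1 : ∀ ξ, (starRingEnd ℂ) (A ξ) * F ξ =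
        ∑ k ∈ S, (starRingEnd ℂ) (a k) * ((starRingEnd ℂ) (dilHat M p j k ξ) * F ξ) := by
      intro ξ
      simp only [hA, map_sum, map_mul, Finset.sum_mul, mul_assoc]
    simp only [h1]
    rw [integral_finsetSum _ fun k _ => (integrable_conj_mul (memLp_dilHat hM hpm hp j k)
      hF).const_mul _]
    simp only [integral_const_mul, hX]
    push_cast
    refine Finset.sum_congr rfl fun k _ => ?_
    rw [← Complex.conj_mul']
    rfl
  have hX1 : X ≤ ∫ ξ, ‖A ξ‖ * ‖F ξ‖ := by
    have h1 : X = ‖(X : ℂ)‖ := by rw [Complex.norm_real, Real.norm_of_nonneg hX0]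
    rw [h1, hXeq]
    refine (norm_integral_le_integral_norm _).trans (le_of_eq ?_)
    simp only [norm_mul, RCLike.norm_conj]
  -- Young's inequality with the weight split between the factors. The constants are such that the
  -- first term is at most `X / 2` and can be absorbed.
  have hX2 : ∫ ξ, ‖A ξ‖ * ‖F ξ‖ ≤ ∫ ξ, ((2 * D)⁻¹ * (‖A ξ‖ ^ 2 * u (scale M j ξ)) +
      D / 2 * (‖F ξ‖ ^ 2 / u (scale M j ξ))) := by
    refine integral_mono_ae ?_ ((hI1.const_mul _).add (hI2.const_mul _))
      (Eventually.of_forall fun ξ => ?_)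
    · simpa only [norm_mul, RCLike.norm_conj] using (integrable_conj_mul hAL hF).norm
    · have h1 := hu0 (scale M j ξ)
      show ‖A ξ‖ * ‖F ξ‖ ≤ (2 * D)⁻¹ * (‖A ξ‖ ^ 2 * u (scale M j ξ)) +
        D / 2 * (‖F ξ‖ ^ 2 / u (scale M j ξ))
      have h2 : (2 * D)⁻¹ * (‖A ξ‖ ^ 2 * u (scale M j ξ)) +
          D / 2 * (‖F ξ‖ ^ 2 / u (scale M j ξ)) - ‖A ξ‖ * ‖F ξ‖ =
          (‖A ξ‖ * u (scale M j ξ) - D * ‖F ξ‖) ^ 2 / (2 * D * u (scale M j ξ)) := by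
        field_simp
        ring
      have h3 : 0 ≤ (‖A ξ‖ * u (scale M j ξ) - D * ‖F ξ‖) ^ 2 / (2 * D * u (scale M j ξ)) := by
        positivity
      linarith
  rw [integral_add (hI1.const_mul _) (hI2.const_mul _), integral_const_mul, integral_const_mul]
    at hX2
  have hX3 : (2 * D)⁻¹ * ∫ ξ, ‖A ξ‖ ^ 2 * u (scale M j ξ) ≤ X / 2 := by
    rw [inv_mul_le_iff₀ (by positivity)]
    linarith
  linarith

end Dilation

/-! ### The growing weight and its behavior along dilation orbits. -/

section Weights

open Filter Topology

variable {d : ℕ} {M : Matrix (Fin d) (Fin d) ℤ} {t : V d → ℂ}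

lemma WeightedBessel.mono {p : V d → ℂ} {u : V d → ℝ} {D D' : ℝ} (h : WeightedBessel p u D)
    (hD : D ≤ D') : WeightedBessel p u D' := fun S c =>
  (h S c).trans (ENNReal.ofReal_le_ofReal (mul_le_mul_of_nonneg_right hD (by positivity)))

/-- Comparison of weights. -/
lemma WeightedBessel.of_le {p p' : V d → ℂ} {u u' : V d → ℝ} {D K : ℝ}
    (h : WeightedBessel p u D) (hK : 0 ≤ K)
    (hle : ∀ ξ, ‖p' ξ‖ ^ 2 * u' ξ ≤ K * (‖p ξ‖ ^ 2 * u ξ)) :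
    WeightedBessel p' u' (K * D) := by
  intro S c
  calc ∫⁻ ξ, ENNReal.ofReal (‖trigSum S c ξ‖ ^ 2 * (‖p' ξ‖ ^ 2 * u' ξ))
      ≤ ∫⁻ ξ, ENNReal.ofReal K * ENNReal.ofReal (‖trigSum S c ξ‖ ^ 2 * (‖p ξ‖ ^ 2 * u ξ)) := by
        refine lintegral_mono fun ξ => ?_
        rw [← ENNReal.ofReal_mul hK]
        refine ENNReal.ofReal_le_ofReal ?_
        have := mul_le_mul_of_nonneg_left (hle ξ) (sq_nonneg ‖trigSum S c ξ‖)
        linarith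
    _ = ENNReal.ofReal K * ∫⁻ ξ, ENNReal.ofReal (‖trigSum S c ξ‖ ^ 2 * (‖p ξ‖ ^ 2 * u ξ)) :=
        lintegral_const_mul' _ _ ENNReal.ofReal_ne_top
    _ ≤ ENNReal.ofReal K * ENNReal.ofReal (D * ∑ k ∈ S, ‖c k‖ ^ 2) := by gcongr; exact h S c
    _ = _ := by rw [← ENNReal.ofReal_mul hK, mul_assoc]

lemma WeightedBessel.add {p : V d → ℂ} {u u' : V d → ℝ} {D D' : ℝ}
    (h : WeightedBessel p u D) (h' : WeightedBessel p u' D') (hD : 0 ≤ D) (hD' : 0 ≤ D')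
    (hp : Measurable p) (hu : Measurable u) :
    WeightedBessel p (fun ξ => u ξ + u' ξ) (D + D') := by
  intro S c
  have hc := (continuous_trigSum S c).measurable
  refine (lintegral_mono fun ξ => ?_).trans ((lintegral_add_left (μ := volume)
    (f := fun ξ => ENNReal.ofReal (‖trigSum S c ξ‖ ^ 2 * (‖p ξ‖ ^ 2 * u ξ))) (by fun_prop)
    (fun ξ => ENNReal.ofReal (‖trigSum S c ξ‖ ^ 2 * (‖p ξ‖ ^ 2 * u' ξ)))).le.trans ?_)
  · rw [mul_add, mul_add]
    exact ENNReal.ofReal_add_le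
  · rw [add_mul, ENNReal.ofReal_add (by positivity) (by positivity)]
    exact add_le_add (h S c) (h' S c)

lemma WeightedBessel.tsum {p : V d → ℂ} {u : ℕ → V d → ℝ} {D : ℕ → ℝ}
    (h : ∀ i, WeightedBessel p (u i) (D i)) (hD : ∀ i, 0 ≤ D i) (hDs : Summable D)
    (hp : Measurable p) (hu : ∀ i, Measurable (u i)) (hu0 : ∀ i ξ, 0 ≤ u i ξ)
    (hus : ∀ ξ, Summable (fun i => u i ξ)) :
    WeightedBessel p (fun ξ => ∑' i, u i ξ) (∑' i, D i) := by
  intro S c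
  have hc := (continuous_trigSum S c).measurable
  have h1 : ∀ ξ, ENNReal.ofReal (‖trigSum S c ξ‖ ^ 2 * (‖p ξ‖ ^ 2 * ∑' i, u i ξ)) =
      ∑' i, ENNReal.ofReal (‖trigSum S c ξ‖ ^ 2 * (‖p ξ‖ ^ 2 * u i ξ)) := by
    intro ξ
    rw [← tsum_mul_left, ← tsum_mul_left, ENNReal.ofReal_tsum_of_nonneg]
    · exact fun i => mul_nonneg (by positivity) (mul_nonneg (by positivity) (hu0 i ξ))
    · exact ((hus ξ).mul_left _).mul_left _
  simp only [h1]
  rw [lintegral_tsum fun i => Measurable.aemeasurable (by have := hu i; fun_prop), ← tsum_mul_right,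
    ENNReal.ofReal_tsum_of_nonneg (fun i => mul_nonneg (hD i) (by positivity)) (hDs.mul_right _)]
  exact ENNReal.tsum_le_tsum fun i => h i S c

/-- The weight is `W = 1 + ∑ s^i latticeGap(M^{*-i} ξ)`. The geometric decay of the Bessel constants
leaves room for a growth factor `s > 1`, which later yields decay of `1/W` on large points. -/
lemma IsRefinableMask.exists_gapWeight (ht : IsRefinableMask t) (hM : IsDilation M)
    (𝒩 : AdaptedNorm (toReal M)ᵀ⁻¹) (hint : Integrable (fun ξ => ‖refinableHat M t ξ‖ ^ 2)) :
    ∃ (W : V d → ℝ) (D s : ℝ), 0 < D ∧ 1 < s ∧ Measurable W ∧ (∀ ξ, 1 ≤ W ξ) ∧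
      WeightedBessel (refinableHat M t) W D ∧
      ∀ (i : ℕ) ξ, s ^ i * latticeGap (scale M i ξ) ≤ W ξ := by
  obtain ⟨C, θ, hC, hθ0, hθ1, hdec⟩ := ht.exists_gapCorr_decay hM hint
  obtain ⟨D₁, hD₁, hone⟩ := ht.exists_weightedBessel_one hM hint
  obtain ⟨K, hK, hgap⟩ := exists_latticeGap_le_sq (d := d)
  have hκ0 := 𝒩.κ_pos
  have hκ1 := 𝒩.κ_lt
  -- With `s = r^{-1/2}` both `s θ < 1`, for the sum of the Bessel constants, and `s κ² < 1`, for
  -- pointwise convergence of the weight.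
  set r : ℝ := max θ (𝒩.κ ^ 2) with hr
  have hr0 : 0 < r := lt_max_of_lt_left hθ0
  have hr1 : r < 1 := max_lt hθ1 (by nlinarith)
  set s : ℝ := (Real.sqrt r)⁻¹ with hs
  have hsr0 : 0 < Real.sqrt r := Real.sqrt_pos.2 hr0
  have hsr1 : Real.sqrt r < 1 := by rw [Real.sqrt_lt' one_pos]; simpa using hr1
  have hs1 : 1 < s := (one_lt_inv₀ hsr0).2 hsr1
  have hsr : s * r = Real.sqrt r := by
    rw [hs]
    nth_rewrite 2 [← Real.mul_self_sqrt hr0.le]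
    rw [inv_mul_cancel_left₀ hsr0.ne']
  have hlt : ∀ x, x ≤ r → s * x < 1 := fun x hx =>
    ((mul_le_mul_of_nonneg_left hx (by linarith)).trans hsr.le).trans_lt hsr1
  set u : ℕ → V d → ℝ := fun i ξ => s ^ i * latticeGap (act ((toReal M)ᵀ⁻¹ ^ i) ξ) with hu
  have hu0 : ∀ i ξ, 0 ≤ u i ξ := fun i ξ => mul_nonneg (by positivity) (latticeGap_nonneg _)
  have hum : ∀ i, Measurable (u i) := fun i => (by fun_prop : Continuous (u i)).measurable
  have hus : ∀ ξ, Summable (fun i => u i ξ) := by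
    intro ξ
    have hg := summable_geometric_of_lt_one (by positivity) (hlt _ (le_max_right θ (𝒩.κ ^ 2)))
    refine Summable.of_nonneg_of_le (fun i => hu0 i ξ) (fun i => ?_) (hg.mul_left (K * 𝒩.N ξ ^ 2))
    have h1 : ‖act ((toReal M)ᵀ⁻¹ ^ i) ξ‖ ^ 2 ≤ (𝒩.κ ^ i * 𝒩.N ξ) ^ 2 := by
      gcongr
      exact (𝒩.norm_le _).trans (𝒩.act_pow_le i ξ)
    calc u i ξ ≤ s ^ i * (K * (𝒩.κ ^ i * 𝒩.N ξ) ^ 2) := by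
          refine mul_le_mul_of_nonneg_left ((hgap _).trans ?_) (by positivity)
          gcongr
      _ = _ := by rw [mul_pow s, ← pow_mul 𝒩.κ, mul_comm 2 i, pow_mul]; ring
  have hφ := ht.measurable_refinableHat 𝒩
  have hui : ∀ i, WeightedBessel (refinableHat M t) (u i) (s ^ i * (C * θ ^ i)) := fun i =>
    (hdec i).of_le (by positivity) fun ξ => le_of_eq (by simp only [hu]; ring)
  have hDs : Summable fun i : ℕ => s ^ i * (C * θ ^ i) := by
    have hg := summable_geometric_of_lt_one (by positivity) (hlt _ (le_max_left θ (𝒩.κ ^ 2)))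
    refine (hg.mul_left C).congr fun i => ?_
    rw [mul_pow]; ring
  have hD0 : ∀ i : ℕ, 0 ≤ s ^ i * (C * θ ^ i) := fun i => by positivity
  have hall := WeightedBessel.tsum hui hD0 hDs hφ hum hu0 hus
  refine ⟨fun ξ => 1 + ∑' i, u i ξ, D₁ + ∑' i, (s ^ i * (C * θ ^ i)) + 1, s, ?_, hs1, ?_, ?_, ?_, ?_⟩
  · have : 0 ≤ ∑' i, s ^ i * (C * θ ^ i) := tsum_nonneg hD0
    positivity
  · exact measurable_const.add (Measurable.tsum hum)
  · intro ξ
    have : 0 ≤ ∑' i, u i ξ := tsum_nonneg fun i => hu0 i ξ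
    linarith
  · exact (hone.add hall hD₁ (tsum_nonneg hD0) hφ measurable_const).mono (by linarith)
  · intro i ξ
    have := (hus ξ).le_tsum i fun j _ => hu0 j ξ
    rw [scale_natCast]
    simp only [hu] at this ⊢
    linarith

/-- Along the orbit of a point under the dilations, the weight grows in one direction and the
adapted norm decays in the other. -/
lemma exists_orbit_bounds (hM : IsDilation M) (𝒩 : AdaptedNorm (toReal M)ᵀ⁻¹) {W : V d → ℝ}
    {s : ℝ} (hs : 1 < s) (hW : ∀ (i : ℕ) ξ, s ^ i * latticeGap (scale M i ξ) ≤ W ξ) :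
    ∃ lam K : ℝ, 0 < lam ∧ lam < 1 ∧ 0 < K ∧ ∀ ξ : V d, ξ ≠ 0 → ∃ j₀ : ℤ,
      (∀ j < j₀, 1 / W (scale M j ξ) ≤ K * lam ^ (j - j₀).natAbs) ∧
      ∀ j ≥ j₀, 𝒩.N (scale M j ξ) ^ 2 ≤ K * lam ^ (j - j₀).natAbs := by
  have hκ0 := 𝒩.κ_pos
  have hκ1 := 𝒩.κ_lt
  set L : ℝ := ‖Matrix.toEuclideanCLM (n := Fin d) (𝕜 := ℝ) (toReal M)ᵀ‖ + 1 with hL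
  have hL0 : 0 < L := by positivity
  have hBL : ∀ x : V d, ‖act (toReal M)ᵀ x‖ ≤ L * ‖x‖ := fun x => by
    refine ((Matrix.toEuclideanCLM (n := Fin d) (𝕜 := ℝ) (toReal M)ᵀ).le_opNorm x).trans ?_
    gcongr
    linarith
  have hC0 := 𝒩.C_pos
  -- A lower bound of `latticeGap` at the first orbit point `η` with `N η < 1/2`: its predecessor
  -- `M^* η` has norm `N` at least `1/2`, so `‖η‖ ≥ 1/(2 C L)`.
  set g : ℝ := 16 * (1 / (2 * (𝒩.C * L))) ^ 2 with hg
  have hg0 : 0 < g := by positivity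
  refine ⟨max (𝒩.κ ^ 2) s⁻¹, max 1 g⁻¹, by positivity,
    max_lt (by nlinarith) (inv_lt_one_of_one_lt₀ hs), by positivity, fun ξ hξ => ?_⟩
  have hstep : ∀ j (n : ℕ), 𝒩.N (scale M (n + j) ξ) ≤ 𝒩.κ ^ n * 𝒩.N (scale M j ξ) := by
    intro j n
    rw [hM.scale_add, scale_natCast]
    exact 𝒩.act_pow_le n _
  have hpos : 0 < 𝒩.N ξ := (norm_pos_iff.2 hξ).trans_le (𝒩.norm_le ξ)
  have hpow := tendsto_pow_atTop_nhds_zero_of_lt_one hκ0.le hκ1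
  -- The contraction makes `N` small for large positive indices and large for large negative ones,
  -- so a first index with `N < 1/2` exists.
  obtain ⟨j₀, hj₀, hmin⟩ := Int.exists_least_of_bdd (P := fun j => 𝒩.N (scale M j ξ) < 1 / 2) (by
    obtain ⟨n, hn⟩ := ((hpow.mul_const (1 / 2)).eventually_lt_const
      (show 0 * (1 / 2) < 𝒩.N ξ by simpa using hpos)).exists
    refine ⟨-n, fun z hz => ?_⟩
    by_contra hlt
    obtain ⟨k, hk⟩ := Int.eq_ofNat_of_zero_le (show 0 ≤ -z by omega)
    have h1 := hstep z k
    rw [← hk, neg_add_cancel, scale_zero] at h1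
    have h2 : 𝒩.κ ^ k ≤ 𝒩.κ ^ n := pow_le_pow_of_le_one hκ0.le hκ1.le (by omega)
    have h3 : 𝒩.κ ^ k * 𝒩.N (scale M z ξ) ≤ 𝒩.κ ^ n * (1 / 2) :=
      mul_le_mul h2 hz.le (𝒩.nonneg _) (by positivity)
    linarith) (by
    obtain ⟨n, hn⟩ := ((hpow.mul_const (𝒩.N ξ)).eventually_lt_const
      (show 0 * 𝒩.N ξ < 1 / 2 by norm_num)).exists
    refine ⟨n, ?_⟩
    have h1 := hstep 0 n
    rw [scale_zero, add_zero] at h1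
    exact h1.trans_lt hn)
  refine ⟨j₀, fun j hj => ?_, fun j hj => ?_⟩
  · set η := scale M j₀ ξ with hη
    have h1 : 1 / 2 ≤ 𝒩.N (scale M (j₀ - 1) ξ) := by
      by_contra h
      have := hmin _ (not_le.1 h)
      omega
    have h2 : scale M (j₀ - 1) ξ = act (toReal M)ᵀ η := by
      rw [hη, ← hM.act_scale_add_one (j₀ - 1), sub_add_cancel]
    rw [h2] at h1
    have h3 : 1 / 2 ≤ 𝒩.C * L * ‖η‖ := by
      refine h1.trans ((𝒩.le_norm _).trans ?_)
      rw [mul_assoc]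
      exact mul_le_mul_of_nonneg_left (hBL η) hC0.le
    have h4 : 1 / (2 * (𝒩.C * L)) ≤ ‖η‖ := by
      rw [div_le_iff₀ (by positivity)]
      linarith
    have h5 : g ≤ latticeGap η := by
      refine le_trans ?_ (le_latticeGap ((𝒩.norm_le η).trans hj₀.le))
      rw [hg]
      gcongr
    -- The summand of `W` with index `j₀ - j`, evaluated at the `j`-th orbit point, sees the `j₀`-th
    -- point, where the gap is at least `g`.
    have h6 := hW (j - j₀).natAbs (scale M j ξ)
    rw [← hM.scale_add, show ((j - j₀).natAbs : ℤ) + j = j₀ by omega] at h6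
    have hs0 : 0 < s := by linarith
    have h7 : s ^ (j - j₀).natAbs * g ≤ W (scale M j ξ) :=
      (mul_le_mul_of_nonneg_left h5 (by positivity)).trans h6
    have h8 : 1 / W (scale M j ξ) ≤ 1 / (s ^ (j - j₀).natAbs * g) :=
      one_div_le_one_div_of_le (by positivity) h7
    refine h8.trans ?_
    rw [one_div, mul_inv, ← inv_pow, mul_comm]
    exact mul_le_mul (le_max_right _ _)
      (pow_le_pow_left₀ (by positivity) (le_max_right _ _) _) (by positivity) (by positivity)
  · have h1 := hstep j₀ (j - j₀).natAbs
    rw [show ((j - j₀).natAbs : ℤ) + j₀ = j by omega] at h1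
    have h2 : 𝒩.N (scale M j ξ) ≤ 𝒩.κ ^ (j - j₀).natAbs * 1 :=
      h1.trans (mul_le_mul_of_nonneg_left (by linarith) (by positivity))
    calc 𝒩.N (scale M j ξ) ^ 2 ≤ (𝒩.κ ^ (j - j₀).natAbs * 1) ^ 2 := by
          gcongr
          exact 𝒩.nonneg _
      _ = 1 * (𝒩.κ ^ 2) ^ (j - j₀).natAbs := by rw [mul_one, one_mul, ← pow_mul, ← pow_mul, mul_comm]
      _ ≤ _ := mul_le_mul (le_max_left _ _)
          (pow_le_pow_left₀ (by positivity) (le_max_left _ _) _) (by positivity) (by positivity)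

lemma summable_pow_natAbs {lam : ℝ} (h0 : 0 < lam) (h1 : lam < 1) :
    Summable fun j : ℤ => lam ^ j.natAbs := by
  refine Summable.of_nat_of_neg ?_ ?_
  · simpa using summable_geometric_of_lt_one h0.le h1
  · simpa using summable_geometric_of_lt_one h0.le h1

lemma hasSum_pow_natAbs_sub {lam : ℝ} (h0 : 0 < lam) (h1 : lam < 1) (j₀ : ℤ) :
    HasSum (fun j : ℤ => lam ^ (j - j₀).natAbs) (∑' j : ℤ, lam ^ j.natAbs) := by
  have h := (Equiv.subRight j₀).hasSum_iff (f := fun j : ℤ => lam ^ j.natAbs)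
    (a := ∑' j : ℤ, lam ^ j.natAbs)
  exact h.2 (summable_pow_natAbs h0 h1).hasSum

end Weights

/-! ### Bessel inequalities over all scales. -/

section BesselBounds

open Filter Topology

variable {d : ℕ} {M : Matrix (Fin d) (Fin d) ℤ} {t w : V d → ℂ}

lemma memLp_mul_refinableHat (ht : IsRefinableMask t) (𝒩 : AdaptedNorm (toReal M)ᵀ⁻¹)
    (hφ : MemLp (refinableHat M t) 2) (hw : IsTrigPoly w) :
    MemLp (fun ξ => w ξ * refinableHat M t ξ) 2 := by
  obtain ⟨K, hK, hb⟩ := hw.bounded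
  have h1 := ht.measurable_refinableHat 𝒩
  have h2 := hw.continuous.measurable
  refine (hφ.const_mul (K : ℂ)).mono (Measurable.aestronglyMeasurable (by fun_prop))
    (Eventually.of_forall fun ξ => ?_)
  rw [norm_mul, norm_mul, Complex.norm_real, Real.norm_of_nonneg hK]
  exact mul_le_mul_of_nonneg_right (hb ξ) (norm_nonneg _)

/-- The Bessel inequality for the wavelet functions, all scales together. -/
lemma exists_wavelet_bessel (hd : 0 < d) (hM : IsDilation M) (ht : IsRefinableMask t)
    (hφ : MemLp (refinableHat M t) 2) (hw : IsTrigPoly w) (hw0 : w 0 = 0) :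
    ∃ K, 0 ≤ K ∧ ∀ F : V d → ℂ, MemLp F 2 → ∀ (J : Finset ℤ) (S : Finset (Fin d → ℤ)),
      ∑ j ∈ J, ∑ k ∈ S, ‖coef M (fun ξ => w ξ * refinableHat M t ξ) j k F‖ ^ 2 ≤
        K * ∫ ξ, ‖F ξ‖ ^ 2 := by
  obtain ⟨𝒩⟩ := hM.nonempty_adaptedNorm_transpose
  have hφm := ht.measurable_refinableHat 𝒩
  have hint := (memLp_two_iff_integrable_sq_norm hφm.aestronglyMeasurable).1 hφ
  obtain ⟨W, D, s, hD, hs, hWm, hW1, hWB, hWs⟩ := ht.exists_gapWeight hM 𝒩 hint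
  obtain ⟨lam, K, hl0, hl1, hK, horb⟩ := exists_orbit_bounds hM 𝒩 hs hWs
  obtain ⟨Kw, hKw, hwb⟩ := hw.bounded
  obtain ⟨L, hL, hwl⟩ := hw.lipschitz_zero
  set p : V d → ℂ := fun ξ => w ξ * refinableHat M t ξ with hp
  have hpm : Measurable p := hw.continuous.measurable.mul hφm
  have hpL : MemLp p 2 := memLp_mul_refinableHat ht 𝒩 hφ hw
  have hNm : Measurable 𝒩.N := 𝒩.continuous.measurable
  -- As `w` vanishes at the origin, `|w|² ≤ L² N²`, and the singular term is compensated by the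
  -- mask. Where `N = 0` the inverse is `0` by convention, which does no harm.
  set u : V d → ℝ := fun ξ => W ξ + (𝒩.N ξ ^ 2)⁻¹ with hu
  have hum : Measurable u := by fun_prop
  have hu1 : ∀ ξ, 1 ≤ u ξ := fun ξ => by
    have : 0 ≤ (𝒩.N ξ ^ 2)⁻¹ := by positivity
    simp only [hu]
    linarith [hW1 ξ]
  have hpB : WeightedBessel p u ((Kw ^ 2 + L ^ 2) * D) := by
    refine hWB.of_le (by positivity) fun ξ => ?_
    have h1 : ‖p ξ‖ ^ 2 = ‖w ξ‖ ^ 2 * ‖refinableHat M t ξ‖ ^ 2 := by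
      rw [hp, norm_mul, mul_pow]
    have h2 : ‖w ξ‖ ^ 2 ≤ Kw ^ 2 := by gcongr; exact hwb ξ
    have h3 : ‖w ξ‖ ^ 2 * (𝒩.N ξ ^ 2)⁻¹ ≤ L ^ 2 := by
      refine mul_inv_le_of_le_mul₀ (by positivity) (by positivity) ?_
      rw [← mul_pow]
      have := hwl ξ
      rw [hw0, sub_zero] at this
      gcongr
      exact this.trans (mul_le_mul_of_nonneg_left (𝒩.norm_le ξ) hL)
    have h4 : ‖w ξ‖ ^ 2 * u ξ ≤ (Kw ^ 2 + L ^ 2) * W ξ := by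
      simp only [hu]
      nlinarith [hW1 ξ, sq_nonneg L, sq_nonneg ‖w ξ‖]
    rw [h1]
    nlinarith [sq_nonneg ‖refinableHat M t ξ‖]
  set D' : ℝ := (Kw ^ 2 + L ^ 2) * D + 1 with hD'
  have hD'0 : 0 < D' := by positivity
  have hpB' := hpB.mono (show (Kw ^ 2 + L ^ 2) * D ≤ D' by linarith)
  set Λ : ℝ := ∑' j : ℤ, lam ^ j.natAbs with hΛ
  have hΛ0 : 0 ≤ Λ := tsum_nonneg fun _ => by positivity
  refine ⟨D' * (K * Λ), by positivity, fun F hF J S => ?_⟩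
  have hF2 := (memLp_two_iff_integrable_sq_norm hF.1).1 hF
  have hu0 : ∀ ξ, 0 < u ξ := fun ξ => zero_lt_one.trans_le (hu1 ξ)
  have hI : ∀ j, Integrable (fun ξ => ‖F ξ‖ ^ 2 / u (scale M j ξ)) := fun j => by
    refine hF2.mono' ?_ (Eventually.of_forall fun ξ => ?_)
    · exact ((hF.1.norm.aemeasurable.pow_const 2).div
        (hum.comp (continuous_scale (M := M) j).measurable).aemeasurable).aestronglyMeasurable
    · rw [Real.norm_of_nonneg (div_nonneg (by positivity) (hu0 _).le)]
      exact div_le_self (by positivity) (hu1 _)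
  have h1 : ∀ j ∈ J, ∑ k ∈ S, ‖coef M p j k F‖ ^ 2 ≤
      D' * ∫ ξ, ‖F ξ‖ ^ 2 / u (scale M j ξ) := fun j _ =>
    hpB'.sum_coef_le hM hD'0 hpm hpL hum hu1 hF j S
  refine (Finset.sum_le_sum h1).trans ?_
  rw [← Finset.mul_sum, mul_assoc, ← integral_finsetSum _ fun j _ => hI j,
    ← integral_const_mul (K * Λ)]
  refine mul_le_mul_of_nonneg_left (integral_mono_ae (integrable_finsetSum _ fun j _ => hI j)
    (hF2.const_mul _) ?_) hD'0.le
  have : Nonempty (Fin d) := ⟨⟨0, hd⟩⟩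
  -- The origin is a null set only because `d > 0`.
  have hne : ∀ᵐ ξ : V d, ξ ≠ 0 := Measure.ae_ne volume 0
  filter_upwards [hne] with ξ hξ
  obtain ⟨j₀, hlt, hge⟩ := horb ξ hξ
  -- `1/u` is at most `1/W` and at most `N²`. The former decays geometrically below `j₀` and the
  -- latter above it, so the sum over all scales is bounded independently of `ξ`.
  have h2 : ∀ j, ‖F ξ‖ ^ 2 / u (scale M j ξ) ≤ ‖F ξ‖ ^ 2 * (K * lam ^ (j - j₀).natAbs) := by
    intro j
    rw [div_eq_mul_one_div]
    refine mul_le_mul_of_nonneg_left ?_ (by positivity)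
    have hNpos : 0 < 𝒩.N (scale M j ξ) :=
      (norm_pos_iff.2 (hM.scale_ne_zero j hξ)).trans_le (𝒩.norm_le _)
    rcases lt_or_ge j j₀ with hj | hj
    · refine le_trans ?_ (hlt j hj)
      refine one_div_le_one_div_of_le (zero_lt_one.trans_le (hW1 _)) ?_
      have : 0 ≤ (𝒩.N (scale M j ξ) ^ 2)⁻¹ := by positivity
      simp only [hu]
      linarith
    · refine le_trans ?_ (hge j hj)
      have h3 : 1 / u (scale M j ξ) ≤ 1 / (𝒩.N (scale M j ξ) ^ 2)⁻¹ := by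
        refine one_div_le_one_div_of_le (by positivity) ?_
        simp only [hu]
        linarith [hW1 (scale M j ξ)]
      simpa using h3
  refine (Finset.sum_le_sum fun j _ => h2 j).trans ?_
  rw [← Finset.mul_sum, ← Finset.mul_sum, mul_comm (K * Λ)]
  refine mul_le_mul_of_nonneg_left (mul_le_mul_of_nonneg_left ?_ hK.le) (by positivity)
  exact sum_le_hasSum J (fun _ _ => by positivity) (hasSum_pow_natAbs_sub hl0 hl1 j₀)

/-- The Bessel inequality for the refinable function, on each scale, and its decay. -/
lemma exists_refinable_bessel (hd : 0 < d) (hM : IsDilation M) (ht : IsRefinableMask t)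
    (hφ : MemLp (refinableHat M t) 2) :
    ∃ (D : ℝ) (W : V d → ℝ), 0 < D ∧ Measurable W ∧ (∀ ξ, 1 ≤ W ξ) ∧
      (∀ᵐ ξ : V d, Tendsto (fun j : ℤ => 1 / W (scale M j ξ)) atBot (𝓝 0)) ∧
      ∀ F : V d → ℂ, MemLp F 2 → ∀ (j : ℤ) (S : Finset (Fin d → ℤ)),
        ∑ k ∈ S, ‖coef M (refinableHat M t) j k F‖ ^ 2 ≤ D * ∫ ξ, ‖F ξ‖ ^ 2 / W (scale M j ξ) := by
  obtain ⟨𝒩⟩ := hM.nonempty_adaptedNorm_transpose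
  have hφm := ht.measurable_refinableHat 𝒩
  have hint := (memLp_two_iff_integrable_sq_norm hφm.aestronglyMeasurable).1 hφ
  obtain ⟨W, D, s, hD, hs, hWm, hW1, hWB, hWs⟩ := ht.exists_gapWeight hM 𝒩 hint
  obtain ⟨lam, K, hl0, hl1, hK, horb⟩ := exists_orbit_bounds hM 𝒩 hs hWs
  refine ⟨D, W, hD, hWm, hW1, ?_, fun F hF j S =>
    hWB.sum_coef_le hM hD hφm hφ hWm hW1 hF j S⟩
  have : Nonempty (Fin d) := ⟨⟨0, hd⟩⟩
  have hne : ∀ᵐ ξ : V d, ξ ≠ 0 := Measure.ae_ne volume 0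
  filter_upwards [hne] with ξ hξ
  obtain ⟨j₀, hlt, -⟩ := horb ξ hξ
  have h1 : Tendsto (fun j : ℤ => K * lam ^ (j - j₀).natAbs) atBot (𝓝 0) := by
    have h2 := (hasSum_pow_natAbs_sub hl0 hl1 j₀).summable.tendsto_cofinite_zero
    rw [Int.cofinite_eq, tendsto_sup] at h2
    simpa using h2.1.const_mul K
  refine squeeze_zero' (Eventually.of_forall fun j => ?_) ?_ h1
  · exact div_nonneg zero_le_one (zero_le_one.trans (hW1 _))
  · filter_upwards [eventually_lt_atBot j₀] with j hj
    exact hlt j hj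

end BesselBounds

/-! ### Parseval's identity on the unit cube. -/

section Parseval

open Filter Topology

variable {d : ℕ}

/-- The unit cube centered at the origin. -/
def unitCube (d : ℕ) : Set (V d) := {ξ | ∀ i, ξ i ∈ Set.Ioc (-1 / 2 : ℝ) (-1 / 2 + 1)}

local instance : MeasureSpace UnitAddCircle := ⟨AddCircle.haarAddCircle⟩

/-- The lift of the torus to the unit cube. -/
def torusLift (x : UnitAddTorus (Fin d)) : V d :=
  WithLp.toLp 2 (UnitAddTorus.measurableEquivPiIoc (fun _ : Fin d => (-1 / 2 : ℝ)) x).1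

lemma measurePreserving_torusLift :
    MeasurePreserving (torusLift (d := d)) volume (volume.restrict (unitCube d)) := by
  have h1 := UnitAddTorus.measurePreserving_equivPiIoc (fun _ : Fin d => (-1 / 2 : ℝ))
  have hS : MeasurableSet {x : Fin d → ℝ | ∀ i, x i ∈ Set.Ioc (-1 / 2 : ℝ) (-1 / 2 + 1)} :=
    MeasurableSet.univ_pi' fun i => measurableSet_Ioc
  have h2 := measurePreserving_subtype_coe (μa := (volume : Measure (Fin d → ℝ))) hS
  have hQ : MeasurableSet (unitCube d) := by
    have : unitCube d = ⋂ i, {ξ : V d | ξ i ∈ Set.Ioc (-1 / 2 : ℝ) (-1 / 2 + 1)} := by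
      ext ξ; simp [unitCube]
    rw [this]
    refine MeasurableSet.iInter fun i => ?_
    have hm : Measurable (fun ξ : V d => ξ i) := (by fun_prop : Continuous _).measurable
    exact hm measurableSet_Ioc
  have h3 := (PiLp.volume_preserving_toLp (Fin d)).restrict_preimage hQ
  exact (h3.comp h2).comp h1

lemma mFourier_eq_expo (k : Fin d → ℤ) (x : UnitAddTorus (Fin d)) :
    UnitAddTorus.mFourier k x = expo k (torusLift x) := by
  have hx : x = fun i => ((torusLift x i : ℝ) : UnitAddCircle) :=
    ((UnitAddTorus.measurableEquivPiIoc (fun _ : Fin d => (-1 / 2 : ℝ))).symm_apply_apply x).symm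
  set ξ := torusLift x
  rw [hx, expo]
  simp only [UnitAddTorus.mFourier, ContinuousMap.coe_mk]
  rw [Complex.ofReal_sum, Finset.mul_sum, Complex.exp_sum]
  refine Finset.prod_congr rfl fun i _ => ?_
  rw [fourier_coe_apply]
  congr 1
  push_cast
  ring

/-- Parseval's identity for functions supported in the unit cube. -/
lemma hasSum_cube_parseval {f g : V d → ℂ} (hf : MemLp f 2) (hg : MemLp g 2)
    (hf0 : ∀ ξ ∉ unitCube d, f ξ = 0) (hg0 : ∀ ξ ∉ unitCube d, g ξ = 0) :
    HasSum (fun k : Fin d → ℤ => (starRingEnd ℂ) (∫ ξ, expo (-k) ξ * f ξ) * ∫ ξ, expo (-k) ξ * g ξ)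
      (∫ ξ, (starRingEnd ℂ) (f ξ) * g ξ) := by
  have hmp := measurePreserving_torusLift (d := d)
  have hint : ∀ h : V d → ℂ, AEStronglyMeasurable h volume → (∀ ξ ∉ unitCube d, h ξ = 0) →
      ∫ x, h (torusLift x) = ∫ ξ, h ξ := by
    intro h hh h0
    rw [← setIntegral_eq_integral_of_forall_compl_eq_zero h0, ← hmp.map_eq, integral_map
      hmp.aemeasurable (by rw [hmp.map_eq]; exact hh.restrict)]
  have hL : ∀ h : V d → ℂ, MemLp h 2 → MemLp (fun x => h (torusLift x)) 2 := fun h hh =>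
    (hh.restrict (unitCube d)).comp_measurePreserving hmp
  have hcoef : ∀ (h : V d → ℂ) (hh : MemLp h 2) (_ : ∀ ξ ∉ unitCube d, h ξ = 0) k,
      UnitAddTorus.mFourierCoeff ((hL h hh).toLp _) k = ∫ ξ, expo (-k) ξ * h ξ := by
    intro h hh h0 k
    rw [← hint (fun ξ => expo (-k) ξ * h ξ)
      ((continuous_expo (-k)).aestronglyMeasurable.mul hh.1)
      (fun ξ hξ => by rw [h0 ξ hξ, mul_zero])]
    refine integral_congr_ae ?_
    filter_upwards [(hL h hh).coeFn_toLp] with x hx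
    rw [hx, mFourier_eq_expo, smul_eq_mul]
  have h1 := UnitAddTorus.hasSum_prod_mFourierCoeff ((hL f hf).toLp _) ((hL g hg).toLp _)
  simp only [hcoef f hf hf0, hcoef g hg hg0] at h1
  convert h1 using 1
  rw [← hint (fun ξ => (starRingEnd ℂ) (f ξ) * g ξ)
    (hf.star.1.mul hg.1) (fun ξ hξ => by rw [hg0 ξ hξ, mul_zero])]
  refine integral_congr_ae ?_
  filter_upwards [(hL f hf).coeFn_toLp, (hL g hg).coeFn_toLp] with x hx hy
  rw [hx, hy]

end Parseval

/-! ### Fine-scale and coarse-scale limits of the refinable sums. -/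

section Limits

open Filter Topology

variable {d : ℕ} {M : Matrix (Fin d) (Fin d) ℤ} {t t' : V d → ℂ}

lemma memLp_comp_scale (hM : IsDilation M) {F : V d → ℂ} (hF : MemLp F 2) (j : ℤ) :
    MemLp (fun ξ => F (scale M j ξ)) 2 := by
  have h1 : AEStronglyMeasurable (fun ξ => F (scale M j ξ)) volume :=
    hF.1.comp_quasiMeasurePreserving (quasiMeasurePreserving_act (hM.det_zpow_ne_zero j))
  rw [memLp_two_iff_integrable_sq_norm h1]
  exact integrable_comp_act (hM.det_zpow_ne_zero j) ((memLp_two_iff_integrable_sq_norm hF.1).1 hF)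

/-- After rescaling, the coefficients on one scale are Fourier coefficients of `conj p ·
F(M^{*j}·)`, to which Parseval's identity applies when the support fits into the unit cube. -/
lemma coef_eq_integral (hM : IsDilation M) (p : V d → ℂ) (j : ℤ) (k : Fin d → ℤ) (F : V d → ℂ) :
    coef M p j k F = (scaleFactor M j * absDet M ^ j : ℝ) *
      ∫ ξ, expo (-k) ξ * ((starRingEnd ℂ) (p ξ) * F (scale M (-j) ξ)) := by
  have h1 := integral_comp_scale hM j
    (fun ξ => expo (-k) ξ * ((starRingEnd ℂ) (p ξ) * F (scale M (-j) ξ)))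
  have h2 : ∀ ξ, (starRingEnd ℂ) (dilHat M p j k ξ) * F ξ = (scaleFactor M j : ℂ) *
      (expo (-k) (scale M j ξ) * ((starRingEnd ℂ) (p (scale M j ξ)) *
        F (scale M (-j) (scale M j ξ)))) := by
    intro ξ
    rw [← hM.scale_add, neg_add_cancel, scale_zero, dilHat, map_mul, map_mul, conj_expo,
      Complex.conj_ofReal]
    ring
  rw [coef]
  simp only [h2]
  rw [integral_const_mul, h1, Complex.real_smul]
  push_cast
  ring

/-- On fine scales the sums with the shifts of the refinable functions are given by Parseval's
identity. -/
lemma eventually_hasSum_refinable (hM : IsDilation M) (ht : IsRefinableMask t)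
    (ht' : IsRefinableMask t') {F G : V d → ℂ} (hF : MemLp F 2) (hG : MemLp G 2) {R : ℝ}
    (hF0 : ∀ ξ, R < ‖ξ‖ → F ξ = 0) (hG0 : ∀ ξ, R < ‖ξ‖ → G ξ = 0) :
    ∀ᶠ n : ℕ in atTop, HasSum (fun k => (starRingEnd ℂ) (coef M (refinableHat M t) n k G) *
      coef M (refinableHat M t') n k F)
      (∫ ξ, refinableHat M t (scale M n ξ) * (starRingEnd ℂ) (refinableHat M t' (scale M n ξ)) *
        ((starRingEnd ℂ) (G ξ) * F ξ)) := by
  obtain ⟨𝒩⟩ := hM.nonempty_adaptedNorm_transpose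
  have hC0 := 𝒩.C_pos
  have hκ0 := 𝒩.κ_pos
  have hlim := (tendsto_pow_atTop_nhds_zero_of_lt_one hκ0.le 𝒩.κ_lt).mul_const (𝒩.C * |R|)
  rw [zero_mul] at hlim
  filter_upwards [hlim.eventually_lt_const (show (0 : ℝ) < 1 / 2 by norm_num)] with n hn
  -- For large `n` the dilated function `F(M^{*n}·)` lives where `N < 1/2`, hence inside the unit
  -- cube.
  have hsupp : ∀ η : V d, 1 / 2 ≤ 𝒩.N η → R < ‖scale M (-n) η‖ := by
    intro η hη
    by_contra h
    have h1 : 𝒩.N η ≤ 𝒩.κ ^ n * 𝒩.N (scale M (-n) η) := by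
      have := 𝒩.act_pow_le n (scale M (-n) η)
      rwa [← scale_natCast, ← hM.scale_add, add_neg_cancel, scale_zero] at this
    have h2 : 𝒩.N (scale M (-n) η) ≤ 𝒩.C * |R| := (𝒩.le_norm _).trans
      (mul_le_mul_of_nonneg_left ((not_lt.1 h).trans (le_abs_self R)) hC0.le)
    have h3 := mul_le_mul_of_nonneg_left h2 (pow_nonneg hκ0.le n)
    linarith
  have hcube : ∀ η ∉ unitCube d, 1 / 2 ≤ 𝒩.N η := by
    intro η hη
    simp only [unitCube, Set.mem_ofPred_eq, not_forall, Set.mem_Ioc, not_and_or, not_lt,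
      not_le] at hη
    obtain ⟨i, hi⟩ := hη
    refine le_trans ?_ ((PiLp.norm_apply_le η i).trans (𝒩.norm_le η))
    rw [Real.norm_eq_abs, le_abs]
    rcases hi with hi | hi
    · right; linarith
    · left; linarith
  have key : ∀ {t₁ F₁ : V d → ℂ}, IsRefinableMask t₁ → MemLp F₁ 2 → (∀ ξ, R < ‖ξ‖ → F₁ ξ = 0) →
      MemLp (fun η => (starRingEnd ℂ) (refinableHat M t₁ η) * F₁ (scale M (-n) η)) 2 ∧
      ∀ η ∉ unitCube d, (starRingEnd ℂ) (refinableHat M t₁ η) * F₁ (scale M (-n) η) = 0 := by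
    intro t₁ F₁ ht₁ hF₁ hF₁0
    obtain ⟨p, hp⟩ := ht₁.exists_growth_refinableHat (M := M) 𝒩
    have hm := ht₁.measurable_refinableHat (M := M) 𝒩
    have hFs := memLp_comp_scale hM hF₁ (-n)
    constructor
    -- On this support `(1 + N)^p ≤ 2^p`, so multiplication by the refinable function preserves
    -- square integrability.
    · refine (hFs.const_mul ((2 : ℂ) ^ p)).mono
        ((Complex.continuous_conj.measurable.comp hm).aestronglyMeasurable.mul hFs.1)
        (Eventually.of_forall fun η => ?_)
      rw [norm_mul, norm_mul, norm_pow, RCLike.norm_conj, Complex.norm_ofNat]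
      rcases le_or_gt (1 / 2) (𝒩.N η) with h | h
      · rw [hF₁0 _ (hsupp η h)]; simp
      · refine mul_le_mul_of_nonneg_right ((hp η).trans ?_) (norm_nonneg _)
        have := 𝒩.nonneg η
        gcongr
        linarith
    · intro η hη
      rw [hF₁0 _ (hsupp η (hcube η hη)), mul_zero]
  obtain ⟨hG1, hG2⟩ := key ht hG hG0
  obtain ⟨hF1, hF2⟩ := key ht' hF hF0
  have h1 := (hasSum_cube_parseval hG1 hF1 hG2 hF2).mul_left
    (((scaleFactor M n * absDet M ^ (n : ℤ)) ^ 2 : ℝ) : ℂ)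
  convert h1 using 1
  · rfl
  · ext k
    rw [coef_eq_integral hM, coef_eq_integral hM, map_mul, Complex.conj_ofReal]
    push_cast
    ring
  · have h2 := integral_comp_scale hM n (fun η =>
      (starRingEnd ℂ) ((starRingEnd ℂ) (refinableHat M t η) * G (scale M (-n) η)) *
        ((starRingEnd ℂ) (refinableHat M t' η) * F (scale M (-n) η)))
    have h3 : (scaleFactor M n * absDet M ^ (n : ℤ)) ^ 2 = absDet M ^ (n : ℤ) := by
      rw [mul_pow, hM.scaleFactor_sq, ← zpow_natCast, ← _root_.zpow_mul,
        ← zpow_add₀ (absDet_pos hM.det_ne_zero).ne']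
      congr 1
      push_cast
      ring
    rw [h3, ← Complex.real_smul, ← h2]
    refine integral_congr_ae (Eventually.of_forall fun ξ => ?_)
    simp only [← hM.scale_add, neg_add_cancel, scale_zero, map_mul, Complex.conj_conj]
    ring

/-- Both infinite products tend to `1` at the origin, and their polynomial growth bounds them on the
support of `F` uniformly in `n`. -/
lemma tendsto_refinable_integral (hM : IsDilation M) (ht : IsRefinableMask t)
    (ht' : IsRefinableMask t') {F G : V d → ℂ} (hF : MemLp F 2) (hG : MemLp G 2) {R : ℝ}
    (hF0 : ∀ ξ, R < ‖ξ‖ → F ξ = 0) :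
    Tendsto (fun n : ℕ => ∫ ξ, refinableHat M t (scale M n ξ) *
      (starRingEnd ℂ) (refinableHat M t' (scale M n ξ)) * ((starRingEnd ℂ) (G ξ) * F ξ)) atTop
      (𝓝 (∫ ξ, (starRingEnd ℂ) (G ξ) * F ξ)) := by
  obtain ⟨𝒩⟩ := hM.nonempty_adaptedNorm_transpose
  have hC0 := 𝒩.C_pos
  have hκ0 := 𝒩.κ_pos
  obtain ⟨p, hp⟩ := ht.exists_growth_refinableHat (M := M) 𝒩
  obtain ⟨p', hp'⟩ := ht'.exists_growth_refinableHat (M := M) 𝒩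
  have hm := ht.measurable_refinableHat (M := M) 𝒩
  have hm' := ht'.measurable_refinableHat (M := M) 𝒩
  have hGF := integrable_conj_mul hG hF
  refine tendsto_integral_of_dominated_convergence
    (fun ξ => (1 + 𝒩.C * |R|) ^ p * (1 + 𝒩.C * |R|) ^ p' * ‖(starRingEnd ℂ) (G ξ) * F ξ‖)
    (fun n => ?_) (hGF.norm.const_mul _) (fun n => Eventually.of_forall fun ξ => ?_)
    (Eventually.of_forall fun ξ => ?_)
  · have hs := (continuous_scale (M := M) n).measurable
    have h1 : Measurable fun ξ => refinableHat M t (scale M n ξ) *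
      (starRingEnd ℂ) (refinableHat M t' (scale M n ξ)) :=
      (hm.comp hs).mul (Complex.continuous_conj.measurable.comp (hm'.comp hs))
    exact h1.aestronglyMeasurable.mul hGF.1
  · rw [norm_mul]
    rcases lt_or_ge R ‖ξ‖ with h | h
    · rw [hF0 ξ h]; simp
    · have h1 : 𝒩.N (scale M n ξ) ≤ 𝒩.C * |R| := by
        rw [scale_natCast]
        refine (𝒩.act_pow_le n ξ).trans ((mul_le_of_le_one_left (𝒩.nonneg _)
          (pow_le_one₀ hκ0.le 𝒩.κ_lt.le)).trans ((𝒩.le_norm ξ).trans ?_))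
        exact mul_le_mul_of_nonneg_left (h.trans (le_abs_self R)) hC0.le
      refine mul_le_mul_of_nonneg_right ?_ (norm_nonneg _)
      rw [norm_mul, RCLike.norm_conj]
      have h2 := 𝒩.nonneg (scale M n ξ)
      have h3 := (hp (scale M n ξ)).trans (pow_le_pow_left₀ (by linarith)
        (by linarith : 1 + 𝒩.N (scale M n ξ) ≤ 1 + 𝒩.C * |R|) p)
      have h4 := (hp' (scale M n ξ)).trans (pow_le_pow_left₀ (by linarith)
        (by linarith : 1 + 𝒩.N (scale M n ξ) ≤ 1 + 𝒩.C * |R|) p')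
      exact mul_le_mul h3 h4 (norm_nonneg _) (by positivity)
  · have h1 : Tendsto (fun n : ℕ => scale M n ξ) atTop (𝓝 0) := by
      refine squeeze_zero_norm (fun n => ?_) (a := fun n => 𝒩.κ ^ n * 𝒩.N ξ) ?_
      · rw [scale_natCast]
        exact (𝒩.norm_le _).trans (𝒩.act_pow_le n ξ)
      · simpa using (tendsto_pow_atTop_nhds_zero_of_lt_one hκ0.le 𝒩.κ_lt).mul_const (𝒩.N ξ)
    have h2 := (ht.tendsto_refinableHat_zero (M := M) 𝒩).comp h1
    have h3 := (Complex.continuous_conj.tendsto _).comp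
      ((ht'.tendsto_refinableHat_zero (M := M) 𝒩).comp h1)
    have h4 := (h2.mul h3).mul_const ((starRingEnd ℂ) (G ξ) * F ξ)
    simpa [Function.comp_def] using h4

/-- On coarse scales the shifts of the refinable function do not contribute. -/
lemma tendsto_sum_coef_sq (hd : 0 < d) (hM : IsDilation M) (ht : IsRefinableMask t)
    (hφ : MemLp (refinableHat M t) 2) {F : V d → ℂ} (hF : MemLp F 2) :
    (∀ j, Summable fun k => ‖coef M (refinableHat M t) j k F‖ ^ 2) ∧
    Tendsto (fun j : ℤ => ∑' k, ‖coef M (refinableHat M t) j k F‖ ^ 2) atBot (𝓝 0) := by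
  obtain ⟨D, W, hD, hWm, hW1, hW0, hB⟩ := exists_refinable_bessel hd hM ht hφ
  have hF2 := (memLp_two_iff_integrable_sq_norm hF.1).1 hF
  have hsum : ∀ j, Summable fun k => ‖coef M (refinableHat M t) j k F‖ ^ 2 := fun j =>
    summable_of_sum_le (fun k => by positivity) (hB F hF j)
  refine ⟨hsum, ?_⟩
  have h1 : Tendsto (fun j : ℤ => ∫ ξ, ‖F ξ‖ ^ 2 / W (scale M j ξ)) atBot
      (𝓝 (∫ _ : V d, (0 : ℝ))) := by
    refine tendsto_integral_filter_of_dominated_convergence (fun ξ => ‖F ξ‖ ^ 2)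
      (Eventually.of_forall fun j => ?_)
      (Eventually.of_forall fun j => Eventually.of_forall fun ξ => ?_) hF2 ?_
    · exact ((hF.1.norm.aemeasurable.pow_const 2).div
        (hWm.comp (continuous_scale (M := M) j).measurable).aemeasurable).aestronglyMeasurable
    · rw [Real.norm_of_nonneg (div_nonneg (by positivity) (zero_le_one.trans (hW1 _)))]
      exact div_le_self (by positivity) (hW1 _)
    · filter_upwards [hW0] with ξ hξ
      simpa [div_eq_mul_inv] using hξ.const_mul (‖F ξ‖ ^ 2)
  have h2 := h1.const_mul D
  rw [integral_zero, mul_zero] at h2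
  exact squeeze_zero (fun j => tsum_nonneg fun k => by positivity)
    (fun j => Real.tsum_le_of_sum_le (fun k => by positivity) (hB F hF j)) h2

end Limits

/-! ### The algebraic identity of the Mixed Extension Principle. -/

section Pairing

variable {d : ℕ} {M : Matrix (Fin d) (Fin d) ℤ}

/-- Families of square summable sequences depending linearly on a trigonometric polynomial, for
which multiplication by exponentials amounts to a shift. -/
structure ShiftCovariant (a : (V d → ℂ) → (Fin d → ℤ) → ℂ) : Prop where
  add : ∀ f g, IsTrigPoly f → IsTrigPoly g → ∀ k, a (fun ξ => f ξ + g ξ) k = a f k + a g k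
  smul : ∀ (c : ℂ) f, IsTrigPoly f → ∀ k, a (fun ξ => c * f ξ) k = c * a f k
  shift : ∀ l f, IsTrigPoly f → ∀ k, a (fun ξ => expo l ξ * f ξ) k = a f (k + l)
  summable : ∀ f, IsTrigPoly f → Summable fun k => ‖a f k‖ ^ 2

lemma summable_mul_conj {A : Type*} {x y : A → ℂ} (hx : Summable fun k => ‖x k‖ ^ 2)
    (hy : Summable fun k => ‖y k‖ ^ 2) : Summable fun k => x k * (starRingEnd ℂ) (y k) := by
  refine Summable.of_norm_bounded (hx.add hy) fun k => ?_
  rw [norm_mul, RCLike.norm_conj]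
  nlinarith [sq_nonneg (‖x k‖ - ‖y k‖), sq_nonneg ‖x k‖, sq_nonneg ‖y k‖]

lemma mulVec_injective_of_det (hM : M.det ≠ 0) : Function.Injective (fun k : Fin d → ℤ => M *ᵥ k) := by
  intro k l h
  have h1 : M *ᵥ (k - l) = 0 := by
    rw [Matrix.mulVec_sub, sub_eq_zero]; exact h
  exact sub_eq_zero.1 (Matrix.eq_zero_of_mulVec_eq_zero hM h1)

/-- The inner product over a sublattice of two families of sequences. -/
def latticePairing (M : Matrix (Fin d) (Fin d) ℤ) (a a' : (V d → ℂ) → (Fin d → ℤ) → ℂ)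
    (f g : V d → ℂ) : ℂ :=
  ∑' k, a f (M *ᵥ k) * (starRingEnd ℂ) (a' g (M *ᵥ k))

variable {a a' : (V d → ℂ) → (Fin d → ℤ) → ℂ} {f f' g g' h : V d → ℂ}

lemma summable_latticePairing (hM : M.det ≠ 0) (ha : ShiftCovariant a) (ha' : ShiftCovariant a')
    (hf : IsTrigPoly f) (hg : IsTrigPoly g) :
    Summable fun k => a f (M *ᵥ k) * (starRingEnd ℂ) (a' g (M *ᵥ k)) :=
  (summable_mul_conj (ha.summable f hf) (ha'.summable g hg)).comp_injective
    (mulVec_injective_of_det hM)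

lemma latticePairing_add_left (hM : M.det ≠ 0) (ha : ShiftCovariant a) (ha' : ShiftCovariant a')
    (hf : IsTrigPoly f) (hf' : IsTrigPoly f') (hg : IsTrigPoly g) :
    latticePairing M a a' (fun ξ => f ξ + f' ξ) g =
      latticePairing M a a' f g + latticePairing M a a' f' g := by
  rw [latticePairing, latticePairing, latticePairing,
    ← (summable_latticePairing hM ha ha' hf hg).tsum_add
      (summable_latticePairing hM ha ha' hf' hg)]
  exact tsum_congr fun k => by rw [ha.add f f' hf hf', add_mul]

lemma latticePairing_add_right (hM : M.det ≠ 0) (ha : ShiftCovariant a) (ha' : ShiftCovariant a')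
    (hf : IsTrigPoly f) (hg : IsTrigPoly g) (hg' : IsTrigPoly g') :
    latticePairing M a a' f (fun ξ => g ξ + g' ξ) =
      latticePairing M a a' f g + latticePairing M a a' f g' := by
  rw [latticePairing, latticePairing, latticePairing,
    ← (summable_latticePairing hM ha ha' hf hg).tsum_add
      (summable_latticePairing hM ha ha' hf hg')]
  exact tsum_congr fun k => by rw [ha'.add g g' hg hg', map_add, mul_add]

lemma latticePairing_smul_left (ha : ShiftCovariant a) (c : ℂ) (hf : IsTrigPoly f) :
    latticePairing M a a' (fun ξ => c * f ξ) g = c * latticePairing M a a' f g := by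
  rw [latticePairing, latticePairing, ← tsum_mul_left]
  exact tsum_congr fun k => by rw [ha.smul c f hf, mul_assoc]

lemma latticePairing_smul_right (ha' : ShiftCovariant a') (c : ℂ) (hg : IsTrigPoly g) :
    latticePairing M a a' f (fun ξ => c * g ξ) =
      (starRingEnd ℂ) c * latticePairing M a a' f g := by
  rw [latticePairing, latticePairing, ← tsum_mul_left]
  exact tsum_congr fun k => by rw [ha'.smul c g hg, map_mul]; ring

lemma latticePairing_sum_left (hM : M.det ≠ 0) (ha : ShiftCovariant a) (ha' : ShiftCovariant a')
    {J : Type*} (s : Finset J) {F : J → V d → ℂ} (hF : ∀ j, IsTrigPoly (F j)) (hg : IsTrigPoly g) :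
    latticePairing M a a' (fun ξ => ∑ j ∈ s, F j ξ) g =
      ∑ j ∈ s, latticePairing M a a' (F j) g := by
  classical
  induction s using Finset.induction_on with
  | empty =>
    have := latticePairing_smul_left (M := M) (a' := a') (g := g) ha 0 (isTrigPoly_const 0)
    simpa using this
  | insert j s hj ih =>
    simp only [Finset.sum_insert hj]
    rw [latticePairing_add_left hM ha ha' (hF j) (IsTrigPoly.sum s fun j _ => hF j) hg, ih]

lemma latticePairing_sum_right (hM : M.det ≠ 0) (ha : ShiftCovariant a) (ha' : ShiftCovariant a')
    {J : Type*} (s : Finset J) {F : J → V d → ℂ} (hF : ∀ j, IsTrigPoly (F j)) (hf : IsTrigPoly f) :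
    latticePairing M a a' f (fun ξ => ∑ j ∈ s, F j ξ) =
      ∑ j ∈ s, latticePairing M a a' f (F j) := by
  classical
  induction s using Finset.induction_on with
  | empty =>
    have := latticePairing_smul_right (M := M) (a := a) (f := f) ha' 0 (isTrigPoly_const 0)
    simpa using this
  | insert j s hj ih =>
    simp only [Finset.sum_insert hj]
    rw [latticePairing_add_right hM ha ha' hf (hF j) (IsTrigPoly.sum s fun j _ => hF j), ih]

lemma latticePairing_expo (ha : ShiftCovariant a) (ha' : ShiftCovariant a')
    (hf : IsTrigPoly f) (hg : IsTrigPoly g) (l : Fin d → ℤ) :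
    latticePairing M a a' (fun ξ => expo (M *ᵥ l) ξ * f ξ) (fun ξ => expo (M *ᵥ l) ξ * g ξ) =
      latticePairing M a a' f g := by
  rw [latticePairing, latticePairing, ← (Equiv.addRight l).tsum_eq
    (fun k => a f (M *ᵥ k) * (starRingEnd ℂ) (a' g (M *ᵥ k)))]
  refine tsum_congr fun k => ?_
  rw [ha.shift _ f hf, ha'.shift _ g hg, Equiv.coe_addRight, Matrix.mulVec_add]

/-- Multiplication by `e(M l)` shifts the sequences by an element of the summation lattice `M ℤ^d`,
so factors of the form `h(M^* ξ)` pass to the other side with a conjugation. -/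
lemma latticePairing_transfer (hM : M.det ≠ 0) (ha : ShiftCovariant a) (ha' : ShiftCovariant a')
    (hf : IsTrigPoly f) (hg : IsTrigPoly g) (hh : IsTrigPoly h) :
    latticePairing M a a' (fun ξ => h (act (toReal M)ᵀ ξ) * f ξ) g =
      latticePairing M a a' f (fun ξ => (starRingEnd ℂ) (h (act (toReal M)ᵀ ξ)) * g ξ) := by
  induction hh using IsTrigPoly.induction with
  | he k =>
    simp only [← expo_mulVec, conj_expo]
    have h1 := latticePairing_expo (M := M) ha ha' hf (hg.mul_expo (-(M *ᵥ k))) k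
    rw [← h1]
    congr 1
    ext ξ
    rw [← mul_assoc, expo_mul_neg, one_mul]
  | hs c h hh ih =>
    simp only [map_mul, mul_assoc]
    rw [latticePairing_smul_left ha c ((hh.comp_act M).mul hf),
      latticePairing_smul_right ha' _ ((hh.comp_act M).conj.mul hg), ih, Complex.conj_conj]
  | ha h₁ h₂ hh₁ hh₂ ih₁ ih₂ =>
    simp only [map_add, add_mul]
    rw [latticePairing_add_left hM ha ha' ((hh₁.comp_act M).mul hf) ((hh₂.comp_act M).mul hf) hg,
      latticePairing_add_right hM ha ha' hf ((hh₁.comp_act M).conj.mul hg)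
        ((hh₂.comp_act M).conj.mul hg), ih₁, ih₂]

/-- The lattice as the union of the cosets of the digits. -/
def digitEquiv {J : Type} {s : J → Fin d → ℤ} (hM : M.det ≠ 0) (hs : IsDigits M s) :
    J × (Fin d → ℤ) ≃ (Fin d → ℤ) :=
  Equiv.ofBijective (fun x => M *ᵥ x.2 + s x.1) (by
    constructor
    · rintro ⟨i, k⟩ ⟨j, l⟩ h
      simp only at h
      obtain ⟨x, _, hx⟩ := hs (M *ᵥ k + s i)
      have hi : i = x := hx i ⟨k, by abel⟩
      have hj : j = x := hx j ⟨l, by rw [h]; abel⟩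
      obtain rfl : i = j := hi.trans hj.symm
      rw [add_left_inj] at h
      rw [mulVec_injective_of_det hM h]
    · intro α
      obtain ⟨i, ⟨k, hk⟩, _⟩ := hs α
      exact ⟨(i, k), by simp only; rw [← hk]; abel⟩)

/-- The identity behind the Mixed Extension Principle. -/
lemma sum_latticePairing {J : Type} [Fintype J] [DecidableEq J] {s : J → Fin d → ℤ}
    (hM : M.det ≠ 0) (hs : IsDigits M s) (ha : ShiftCovariant a) (ha' : ShiftCovariant a')
    {t t' : J → V d → ℂ} {A B : V d → Matrix J J ℂ} (hMEP : IsMEPPair M s t t' A B) :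
    absDet M * ∑ ν, latticePairing M a a' (t ν) (t' ν) =
      ∑' k, a (fun _ => 1) k * (starRingEnd ℂ) (a' (fun _ => 1) k) := by
  obtain ⟨h1, h2, h3⟩ := hMEP
  have hm : (absDet M : ℂ) ≠ 0 := by exact_mod_cast (absDet_pos hM).ne'
  have hmm : (1 / Real.sqrt (absDet M) : ℂ) * (1 / Real.sqrt (absDet M) : ℂ) =
      (absDet M : ℂ)⁻¹ := by
    rw [div_mul_div_comm, one_mul, one_div, ← Complex.ofReal_mul,
      Real.mul_self_sqrt (absDet_pos hM).le]
  set u : J → V d → ℂ := fun ν ξ => ∑ i, expo (s i) ξ * B (act (toReal M)ᵀ ξ) ν i with hu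
  have hBt : ∀ ν i, IsTrigPoly (fun ξ => B (act (toReal M)ᵀ ξ) ν i) := fun ν i =>
    ((h2 ν).1 i).comp_act M
  have hAt : ∀ ν i, IsTrigPoly (fun ξ => A (act (toReal M)ᵀ ξ) ν i) := fun ν i =>
    ((h1 ν).1 i).comp_act M
  have hut : ∀ ν, IsTrigPoly (u ν) := fun ν =>
    IsTrigPoly.sum Finset.univ fun i _ => (hBt ν i).mul_expo (s i)
  have ht : ∀ ν, t ν = fun ξ => (1 / Real.sqrt (absDet M) : ℂ) *
      ∑ i, A (act (toReal M)ᵀ ξ) ν i * expo (s i) ξ := fun ν => funext fun ξ => by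
    rw [(h1 ν).2, fromPolyphase]
    congr 1
    exact Finset.sum_congr rfl fun i _ => mul_comm _ _
  have ht' : ∀ ν, t' ν = fun ξ => (1 / Real.sqrt (absDet M) : ℂ) * u ν ξ := fun ν =>
    funext fun ξ => (h2 ν).2 ξ
  -- The polyphase components of the first mask are functions of `M^* ξ` and can be moved to the
  -- second argument.
  have hpair : ∀ ν, latticePairing M a a' (t ν) (t' ν) = (absDet M : ℂ)⁻¹ *
      ∑ i, latticePairing M a a' (expo (s i))
        (fun ξ => (starRingEnd ℂ) (A (act (toReal M)ᵀ ξ) ν i) * u ν ξ) := by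
    intro ν
    rw [ht, ht', latticePairing_smul_left ha _ (IsTrigPoly.sum Finset.univ fun i _ =>
      (hAt ν i).mul (isTrigPoly_expo (s i))), latticePairing_smul_right ha' _ (hut ν),
      latticePairing_sum_left hM ha ha' Finset.univ
        (fun i => (hAt ν i).mul (isTrigPoly_expo (s i))) (hut ν), ← mul_assoc]
    congr 1
    · rw [← hmm]
      simp
    · exact Finset.sum_congr rfl fun i _ =>
        latticePairing_transfer hM ha ha' (isTrigPoly_expo (s i)) (hut ν) ((h1 ν).1 i)
  -- Here `A^* B = I` enters: summation over the masks leaves only the exponential of the digit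
  -- `s_i`.
  have hcollapse : ∀ i, (fun ξ => ∑ ν, (starRingEnd ℂ) (A (act (toReal M)ᵀ ξ) ν i) * u ν ξ) =
      expo (s i) := by
    intro i
    ext ξ
    have h4 : ∀ i', ∑ ν, (starRingEnd ℂ) (A (act (toReal M)ᵀ ξ) ν i) *
        B (act (toReal M)ᵀ ξ) ν i' = (1 : Matrix J J ℂ) i i' := by
      intro i'
      rw [← h3 (act (toReal M)ᵀ ξ), Matrix.mul_apply]
      rfl
    simp only [hu, Finset.mul_sum]
    rw [Finset.sum_comm]
    calc _ = ∑ i', expo (s i') ξ * (1 : Matrix J J ℂ) i i' := by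
          refine Finset.sum_congr rfl fun i' _ => ?_
          rw [← h4, Finset.mul_sum]
          exact Finset.sum_congr rfl fun ν _ => by ring
      _ = _ := by simp [Matrix.one_apply]
  simp only [hpair]
  rw [← Finset.mul_sum, mul_inv_cancel_left₀ hm, Finset.sum_comm]
  -- What remains for the digit `s_i` is a sum over the coset `M ℤ^d + s_i`; the cosets together
  -- exhaust `ℤ^d`.
  have hdiag : ∀ i, ∑ ν, latticePairing M a a' (expo (s i))
      (fun ξ => (starRingEnd ℂ) (A (act (toReal M)ᵀ ξ) ν i) * u ν ξ) =
      ∑' k, a (fun _ => 1) (M *ᵥ k + s i) * (starRingEnd ℂ) (a' (fun _ => 1) (M *ᵥ k + s i)) := by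
    intro i
    rw [← latticePairing_sum_right hM ha ha' Finset.univ
      (fun ν => (hAt ν i).conj.mul (hut ν)) (isTrigPoly_expo (s i)), hcollapse, latticePairing]
    have he : (expo (s i) : V d → ℂ) = fun ξ => expo (s i) ξ * (fun _ => (1 : ℂ)) ξ := by
      ext ξ; simp
    refine tsum_congr fun k => ?_
    rw [he, ha.shift _ _ (isTrigPoly_const 1), ha'.shift _ _ (isTrigPoly_const 1)]
  simp only [hdiag]
  have hsum := summable_mul_conj (ha.summable _ (isTrigPoly_const 1))
    (ha'.summable _ (isTrigPoly_const 1))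
  rw [← (digitEquiv hM hs).tsum_eq]
  refine Eq.trans ?_ ((digitEquiv hM hs).summable_iff.2 hsum).tsum_prod.symm
  rw [tsum_fintype]
  rfl

end Pairing

/-! ### Telescoping of the wavelet expansion. -/

section Expansion

open Filter Topology

variable {d : ℕ} {M : Matrix (Fin d) (Fin d) ℤ} {t t' w w' : V d → ℂ}

/-- The Fourier transform of the wavelet function with wavelet mask `w`. -/
def waveletHat (M : Matrix (Fin d) (Fin d) ℤ) (t w : V d → ℂ) (ξ : V d) : ℂ :=
  w (act (toReal M)ᵀ⁻¹ ξ) * refinableHat M t (act (toReal M)ᵀ⁻¹ ξ)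

/-- The wavelets on scale `j` are the functions with transform `w φ̂` on scale `j + 1`, restricted
to the sublattice of shifts `M ℤ^d`. -/
lemma dilHat_waveletHat (hM : IsDilation M) (j : ℤ) (k : Fin d → ℤ) (ξ : V d) :
    dilHat M (waveletHat M t w) j k ξ = Real.sqrt (absDet M) *
      dilHat M (fun ξ => w ξ * refinableHat M t ξ) (j + 1) (M *ᵥ k) ξ := by
  rw [dilHat, dilHat, waveletHat, ← hM.scale_add_one, hM.scaleFactor_add_one, expo_mulVec,
    hM.act_scale_add_one]
  push_cast
  ring

lemma coef_waveletHat (hM : IsDilation M) (j : ℤ) (k : Fin d → ℤ) (F : V d → ℂ) :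
    coef M (waveletHat M t w) j k F = Real.sqrt (absDet M) *
      coef M (fun ξ => w ξ * refinableHat M t ξ) (j + 1) (M *ᵥ k) F := by
  rw [coef, coef, ← integral_const_mul]
  refine integral_congr_ae (Eventually.of_forall fun ξ => ?_)
  simp only [dilHat_waveletHat hM, map_mul, Complex.conj_ofReal]
  ring

lemma IsRefinableMask.waveletHat_self (ht : IsRefinableMask t) (hM : IsDilation M) :
    waveletHat M t t = refinableHat M t := by
  obtain ⟨𝒩⟩ := hM.nonempty_adaptedNorm_transpose
  ext ξ
  exact (ht.refinableHat_eq 𝒩 ξ).symm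

lemma memLp_waveletHat (hM : IsDilation M) (ht : IsRefinableMask t)
    (hφ : MemLp (refinableHat M t) 2) (hw : IsTrigPoly w) : MemLp (waveletHat M t w) 2 := by
  obtain ⟨𝒩⟩ := hM.nonempty_adaptedNorm_transpose
  have := memLp_comp_scale hM (memLp_mul_refinableHat ht 𝒩 hφ hw) 1
  simp only [scale_one] at this
  exact this

lemma summable_coef_sq (hM : IsDilation M) (ht : IsRefinableMask t)
    (hφ : MemLp (refinableHat M t) 2) (hw : IsTrigPoly w) {F : V d → ℂ} (hF : MemLp F 2) (j : ℤ) :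
    Summable fun k => ‖coef M (fun ξ => w ξ * refinableHat M t ξ) j k F‖ ^ 2 := by
  obtain ⟨𝒩⟩ := hM.nonempty_adaptedNorm_transpose
  have hφm := ht.measurable_refinableHat 𝒩
  have hint := (memLp_two_iff_integrable_sq_norm hφm.aestronglyMeasurable).1 hφ
  obtain ⟨D, hD, hB⟩ := ht.exists_weightedBessel_one hM hint
  obtain ⟨K, hK, hwb⟩ := hw.bounded
  have h1 : WeightedBessel (fun ξ => w ξ * refinableHat M t ξ) (fun _ => 1) (K ^ 2 * D + 1) := by
    refine (hB.of_le (sq_nonneg K) fun ξ => ?_).mono (by linarith)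
    rw [norm_mul, mul_pow, mul_one, mul_one]
    have := hwb ξ
    gcongr
  exact summable_of_sum_le (fun k => by positivity) (h1.sum_coef_le hM (by positivity)
    (hw.continuous.measurable.mul hφm) (memLp_mul_refinableHat ht 𝒩 hφ hw) measurable_const
    (fun _ => le_rfl) hF j)

/-- `coef` is conjugate linear in its mask, so the conjugated coefficients are the linear family.
This brings the refinable sums into the framework of `sum_latticePairing`. -/
lemma shiftCovariant_coef (hM : IsDilation M) (ht : IsRefinableMask t)
    (hφ : MemLp (refinableHat M t) 2) {F : V d → ℂ} (hF : MemLp F 2) (j : ℤ) :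
    ShiftCovariant (fun f k =>
      (starRingEnd ℂ) (coef M (fun ξ => f ξ * refinableHat M t ξ) j k F)) := by
  obtain ⟨𝒩⟩ := hM.nonempty_adaptedNorm_transpose
  have hφm := ht.measurable_refinableHat 𝒩
  have hi : ∀ f, IsTrigPoly f → ∀ k, Integrable (fun ξ =>
      (starRingEnd ℂ) (dilHat M (fun ξ => f ξ * refinableHat M t ξ) j k ξ) * F ξ) := fun f hf k =>
    integrable_conj_mul (memLp_dilHat hM (hf.continuous.measurable.mul hφm)
      (memLp_mul_refinableHat ht 𝒩 hφ hf) j k) hF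
  refine ⟨fun f g hf hg k => ?_, fun c f hf k => ?_, fun l f hf k => ?_, fun f hf => ?_⟩
  · rw [coef, coef, coef, ← map_add, ← integral_add (hi f hf k) (hi g hg k)]
    congr 1
    refine integral_congr_ae (Eventually.of_forall fun ξ => ?_)
    simp only [dilHat, map_mul, map_add]
    ring
  · rw [coef, coef]
    have h1 : ∀ ξ, (starRingEnd ℂ) (dilHat M (fun ξ => c * f ξ * refinableHat M t ξ) j k ξ) * F ξ =
        (starRingEnd ℂ) c *
          ((starRingEnd ℂ) (dilHat M (fun ξ => f ξ * refinableHat M t ξ) j k ξ) * F ξ) := by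
      intro ξ
      simp only [dilHat, map_mul]
      ring
    simp only [h1]
    rw [integral_const_mul, map_mul, Complex.conj_conj]
  · rw [coef, coef]
    congr 1
    refine integral_congr_ae (Eventually.of_forall fun ξ => ?_)
    simp only [dilHat, expo_add, map_mul]
    ring
  · simpa only [RCLike.norm_conj] using summable_coef_sq hM ht hφ hf hF j

variable {I : Type} [Fintype I] {m m' : I → V d → ℂ}

/-- The Bessel inequality for a finite family of wavelet systems. -/
lemma exists_bessel_waveletHat (hd : 0 < d) (hM : IsDilation M) (ht : IsRefinableMask t)
    (hφ : MemLp (refinableHat M t) 2) (hm : ∀ ν, IsTrigPoly (m ν)) (hm0 : ∀ ν, m ν 0 = 0) :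
    ∃ K, 0 ≤ K ∧ ∀ F : V d → ℂ, MemLp F 2 → ∀ Q : Finset (I × ℤ × (Fin d → ℤ)),
      ∑ i ∈ Q, ‖coef M (waveletHat M t (m i.1)) i.2.1 i.2.2 F‖ ^ 2 ≤ K * ∫ ξ, ‖F ξ‖ ^ 2 := by
  choose K hK hB using fun ν => exists_wavelet_bessel hd hM ht hφ (hm ν) (hm0 ν)
  have hm' := absDet_pos hM.det_ne_zero
  refine ⟨absDet M * ∑ ν, K ν, mul_nonneg hm'.le (Finset.sum_nonneg fun ν _ => hK ν),
    fun F hF Q => ?_⟩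
  classical
  set J : Finset ℤ := Q.image fun i => i.2.1
  set S : Finset (Fin d → ℤ) := Q.image fun i => i.2.2
  have hQ : Q ⊆ Finset.univ ×ˢ (J ×ˢ S) := fun i hi => by
    simp only [Finset.mem_product, Finset.mem_univ, true_and]
    exact ⟨Finset.mem_image_of_mem _ hi, Finset.mem_image_of_mem _ hi⟩
  refine (Finset.sum_le_sum_of_subset_of_nonneg hQ fun _ _ _ => by positivity).trans ?_
  rw [Finset.sum_product, mul_assoc, Finset.sum_mul, Finset.mul_sum]
  refine Finset.sum_le_sum fun ν _ => ?_
  rw [Finset.sum_product]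
  -- Wavelet coefficients with indices `(j, k)` are those of `w φ̂` with indices `(j + 1, M k)`, up
  -- to the factor `√m`.
  have h1 := hB ν F hF (J.map (addRightEmbedding 1)) (S.image fun k => M *ᵥ k)
  rw [Finset.sum_map] at h1
  refine le_trans (le_of_eq ?_) (mul_le_mul_of_nonneg_left h1 hm'.le)
  rw [Finset.mul_sum]
  refine Finset.sum_congr rfl fun j _ => ?_
  rw [Finset.sum_image (mulVec_injective_of_det hM.det_ne_zero).injOn, Finset.mul_sum]
  refine Finset.sum_congr rfl fun k _ => ?_
  rw [coef_waveletHat hM, norm_mul, mul_pow, Complex.norm_real, Real.norm_of_nonneg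
    (Real.sqrt_nonneg _), Real.sq_sqrt hm'.le]
  rfl

variable [DecidableEq I] {s : Unit ⊕ I → Fin d → ℤ}
  {A B : V d → Matrix (Unit ⊕ I) (Unit ⊕ I) ℂ}

/-- The passage from one scale to the next. -/
lemma refinable_sum_succ (hM : IsDilation M) (ht : IsRefinableMask t)
    (ht' : IsRefinableMask t') (hφ : MemLp (refinableHat M t) 2)
    (hφ' : MemLp (refinableHat M t') 2) (hs : IsDigits M s)
    (hMEP : IsMEPPair M s (Sum.elim (fun _ => t) m) (Sum.elim (fun _ => t') m') A B)
    {F G : V d → ℂ} (hF : MemLp F 2) (hG : MemLp G 2) (j : ℤ) :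
    ∑' k, (starRingEnd ℂ) (coef M (refinableHat M t) (j + 1) k G) *
        coef M (refinableHat M t') (j + 1) k F =
      ∑' k, (starRingEnd ℂ) (coef M (refinableHat M t) j k G) * coef M (refinableHat M t') j k F +
      ∑ ν, ∑' k, (starRingEnd ℂ) (coef M (waveletHat M t (m ν)) j k G) *
        coef M (waveletHat M t' (m' ν)) j k F := by
  have h1 := sum_latticePairing hM.det_ne_zero hs (shiftCovariant_coef hM ht hφ hG (j + 1))
    (shiftCovariant_coef hM ht' hφ' hF (j + 1)) hMEP
  simp only [one_mul, Complex.conj_conj] at h1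
  rw [← h1, Fintype.sum_sum_type, mul_add, Finset.mul_sum]
  have h2 : ∀ w w' : V d → ℂ, (absDet M : ℂ) * latticePairing M
      (fun f k => (starRingEnd ℂ) (coef M (fun ξ => f ξ * refinableHat M t ξ) (j + 1) k G))
      (fun f k => (starRingEnd ℂ) (coef M (fun ξ => f ξ * refinableHat M t' ξ) (j + 1) k F)) w w' =
      ∑' k, (starRingEnd ℂ) (coef M (waveletHat M t w) j k G) *
        coef M (waveletHat M t' w') j k F := by
    intro w w'
    rw [latticePairing, ← tsum_mul_left]
    refine tsum_congr fun k => ?_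
    rw [coef_waveletHat hM, coef_waveletHat hM, map_mul, Complex.conj_ofReal, Complex.conj_conj]
    have h3 : (absDet M : ℂ) = Real.sqrt (absDet M) * Real.sqrt (absDet M) := by
      rw [← Complex.ofReal_mul, Real.mul_self_sqrt (absDet_pos hM.det_ne_zero).le]
    rw [h3]
    ring
  congr 1
  · rw [Fintype.sum_unique]
    simp only [Sum.elim_inl]
    rw [h2, ht.waveletHat_self hM, ht'.waveletHat_self hM]
  · rw [Finset.mul_sum]
    refine Finset.sum_congr rfl fun ν _ => ?_
    simp only [Sum.elim_inr]
    rw [h2]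

/-- The wavelet expansion, tested against functions of bounded support. -/
lemma hasSum_waveletHat (hd : 0 < d) (hM : IsDilation M) (ht : IsRefinableMask t)
    (ht' : IsRefinableMask t') (hφ : MemLp (refinableHat M t) 2)
    (hφ' : MemLp (refinableHat M t') 2) (hs : IsDigits M s)
    (hMEP : IsMEPPair M s (Sum.elim (fun _ => t) m) (Sum.elim (fun _ => t') m') A B)
    (hm : ∀ ν, IsTrigPoly (m ν)) (hm0 : ∀ ν, m ν 0 = 0)
    (hm' : ∀ ν, IsTrigPoly (m' ν)) (hm'0 : ∀ ν, m' ν 0 = 0)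
    {F G : V d → ℂ} (hF : MemLp F 2) (hG : MemLp G 2) {R : ℝ}
    (hF0 : ∀ ξ, R < ‖ξ‖ → F ξ = 0) (hG0 : ∀ ξ, R < ‖ξ‖ → G ξ = 0) :
    HasSum (fun i : I × ℤ × (Fin d → ℤ) =>
      (starRingEnd ℂ) (coef M (waveletHat M t (m i.1)) i.2.1 i.2.2 G) *
        coef M (waveletHat M t' (m' i.1)) i.2.1 i.2.2 F) (∫ ξ, (starRingEnd ℂ) (G ξ) * F ξ) := by
  set z : I × ℤ × (Fin d → ℤ) → ℂ := fun i =>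
    (starRingEnd ℂ) (coef M (waveletHat M t (m i.1)) i.2.1 i.2.2 G) *
      coef M (waveletHat M t' (m' i.1)) i.2.1 i.2.2 F with hz
  -- The two Bessel inequalities give absolute convergence, so the terms may be grouped by scales.
  have hzs : Summable z := by
    obtain ⟨K, -, hB⟩ := exists_bessel_waveletHat hd hM ht hφ hm hm0
    obtain ⟨K', -, hB'⟩ := exists_bessel_waveletHat hd hM ht' hφ' hm' hm'0
    refine (summable_mul_conj (summable_of_sum_le (fun i => by positivity) (hB' F hF))
      (summable_of_sum_le (fun i => by positivity) (hB G hG))).congr fun i => ?_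
    exact mul_comm _ _
  set T : ℤ → ℂ := fun j => ∑' k, (starRingEnd ℂ) (coef M (refinableHat M t) j k G) *
    coef M (refinableHat M t') j k F with hT
  let e : I × ℤ × (Fin d → ℤ) ≃ ℤ × I × (Fin d → ℤ) :=
    { toFun := fun i => (i.2.1, i.1, i.2.2)
      invFun := fun i => (i.2.1, i.1, i.2.2)
      left_inv := fun _ => rfl
      right_inv := fun _ => rfl }
  have hzs' : Summable (z ∘ e.symm) := e.symm.summable_iff.2 hzs
  set E : ℤ → ℂ := fun j => ∑' i, (z ∘ e.symm) (j, i) with hE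
  have hEs : Summable E := hzs'.prod
  have hzE : ∑' i, z i = ∑' j, E j := by
    rw [← e.symm.tsum_eq]
    exact hzs'.tsum_prod
  -- The contribution of a scale is a difference of refinable sums, so the series telescopes in both
  -- directions.
  have hET : ∀ j, E j = T (j + 1) - T j := by
    intro j
    have h1 := refinable_sum_succ hM ht ht' hφ hφ' hs hMEP hF hG j
    have h2 : E j = ∑ ν, ∑' k, (starRingEnd ℂ) (coef M (waveletHat M t (m ν)) j k G) *
        coef M (waveletHat M t' (m' ν)) j k F := by
      rw [hE]
      refine ((hzs'.prod_factor j).tsum_prod).trans ?_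
      rw [tsum_fintype]
      rfl
    rw [h2, hT]
    simp only
    rw [h1]
    ring
  have htop : Tendsto (fun n : ℕ => T n) atTop (𝓝 (∫ ξ, (starRingEnd ℂ) (G ξ) * F ξ)) := by
    refine (tendsto_refinable_integral hM ht ht' hF hG hF0).congr' ?_
    filter_upwards [eventually_hasSum_refinable hM ht ht' hF hG hF0 hG0] with n hn
    exact hn.tsum_eq.symm
  have hbot : Tendsto (fun n : ℕ => T (-n)) atTop (𝓝 0) := by
    obtain ⟨hs1, hl1⟩ := tendsto_sum_coef_sq hd hM ht hφ hG
    obtain ⟨hs2, hl2⟩ := tendsto_sum_coef_sq hd hM ht' hφ' hF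
    have h1 : ∀ j, ‖T j‖ ≤ ∑' k, ‖coef M (refinableHat M t) j k G‖ ^ 2 +
        ∑' k, ‖coef M (refinableHat M t') j k F‖ ^ 2 := by
      intro j
      rw [← (hs1 j).tsum_add (hs2 j)]
      refine tsum_of_norm_bounded ((hs1 j).add (hs2 j)).hasSum fun k => ?_
      rw [norm_mul, RCLike.norm_conj]
      nlinarith [sq_nonneg (‖coef M (refinableHat M t) j k G‖ -
        ‖coef M (refinableHat M t') j k F‖), sq_nonneg ‖coef M (refinableHat M t) j k G‖,
        sq_nonneg ‖coef M (refinableHat M t') j k F‖]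
    have h2 : Tendsto (fun n : ℕ => -(n : ℤ)) atTop atBot :=
      tendsto_neg_atTop_atBot.comp tendsto_natCast_atTop_atTop
    have h3 := (hl1.add hl2).comp h2
    rw [add_zero] at h3
    exact squeeze_zero_norm (fun n => h1 _) h3
  have hpos : HasSum (fun n : ℕ => E n) ((∫ ξ, (starRingEnd ℂ) (G ξ) * F ξ) - T 0) := by
    have hsum : Summable fun n : ℕ => E n := hEs.comp_injective Nat.cast_injective
    have h1 : Tendsto (fun N : ℕ => ∑ n ∈ Finset.range N, E n) atTop
        (𝓝 ((∫ ξ, (starRingEnd ℂ) (G ξ) * F ξ) - T 0)) := by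
      refine (htop.sub_const (T 0)).congr fun N => ?_
      have := Finset.sum_range_sub (fun n : ℕ => T n) N
      rw [Nat.cast_zero] at this
      rw [← this]
      refine Finset.sum_congr rfl fun n _ => ?_
      rw [hET, Nat.cast_add, Nat.cast_one]
    have h2 := tendsto_nhds_unique hsum.hasSum.tendsto_sum_nat h1
    rw [← h2]
    exact hsum.hasSum
  have hneg : HasSum (fun n : ℕ => E (-(n + 1 : ℤ))) (T 0 - 0) := by
    have hsum : Summable fun n : ℕ => E (-(n + 1 : ℤ)) :=
      hEs.comp_injective fun a b h => by simpa using h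
    have h1 : Tendsto (fun N : ℕ => ∑ n ∈ Finset.range N, E (-(n + 1 : ℤ))) atTop
        (𝓝 (T 0 - 0)) := by
      refine (hbot.const_sub (T 0)).congr fun N => ?_
      have := Finset.sum_range_sub' (fun n : ℕ => T (-n)) N
      rw [Nat.cast_zero, neg_zero] at this
      rw [← this]
      refine Finset.sum_congr rfl fun n _ => ?_
      rw [hET, Nat.cast_add, Nat.cast_one, neg_add, neg_add_cancel_right]
    have h2 := tendsto_nhds_unique hsum.hasSum.tendsto_sum_nat h1
    rw [← h2]
    exact hsum.hasSum
  have hall := hpos.of_nat_of_neg_add_one hneg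
  rw [sub_zero, sub_add_cancel] at hall
  have h1 := hzs.hasSum
  rwa [hzE, hall.tsum_eq] at h1

end Expansion

/-! ### Dual frames from reproducing Bessel families. -/

section DualFrames

variable {X : Type*} [NormedAddCommGroup X] [InnerProductSpace ℂ X] {A : Type*}

/-- The analysis operator of a Bessel family. -/
def analysis (f : A → X) (b : ℝ)
    (hb : ∀ x, ∀ Q : Finset A, ∑ i ∈ Q, ‖inner ℂ (f i) x‖ ^ 2 ≤ b * ‖x‖ ^ 2) :
    X →L[ℂ] lp (fun _ : A => ℂ) 2 :=
  LinearMap.mkContinuous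
    { toFun := fun x => ⟨fun i => inner ℂ (f i) x, by
        refine memℓp_gen ?_
        simpa using summable_of_sum_le (fun i => by positivity) (hb x)⟩
      map_add' := fun x y => by ext i; exact inner_add_right _ _ _
      map_smul' := fun c x => by ext i; exact inner_smul_right _ _ _ } (Real.sqrt b) (fun x => by
        have h1 := lp.norm_rpow_eq_tsum (p := 2) (by simp) (⟨fun i => inner ℂ (f i) x, by
          refine memℓp_gen ?_
          simpa using summable_of_sum_le (fun i => by positivity) (hb x)⟩ : lp (fun _ : A => ℂ) 2)
        simp only [ENNReal.toReal_ofNat, Real.rpow_ofNat] at h1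
        have h2 := Real.tsum_le_of_sum_le (fun i => by positivity) (hb x)
        refine (sq_le_sq₀ (norm_nonneg _) (by positivity)).1 ?_
        refine (h1.le.trans h2).trans ?_
        rw [mul_pow]
        refine mul_le_mul_of_nonneg_right ?_ (sq_nonneg _)
        rcases le_total 0 b with h | h
        · rw [Real.sq_sqrt h]
        · exact h.trans (sq_nonneg _))

lemma analysis_apply (f : A → X) (b : ℝ)
    (hb : ∀ x, ∀ Q : Finset A, ∑ i ∈ Q, ‖inner ℂ (f i) x‖ ^ 2 ≤ b * ‖x‖ ^ 2) (x : X) (i : A) :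
    analysis f b hb x i = inner ℂ (f i) x := rfl

/-- A pair of Bessel families which reproduces inner products of vectors of a dense set is a pair
of dual frames. -/
lemma isDualFramePair_of_bessel [CompleteSpace X] {f f' : A → X} {b b' : ℝ}
    (hb : ∀ x, ∀ Q : Finset A, ∑ i ∈ Q, ‖inner ℂ (f i) x‖ ^ 2 ≤ b * ‖x‖ ^ 2)
    (hb' : ∀ x, ∀ Q : Finset A, ∑ i ∈ Q, ‖inner ℂ (f' i) x‖ ^ 2 ≤ b' * ‖x‖ ^ 2)
    {s : Set X} (hs : Dense s) (h : ∀ x ∈ s, ∀ y ∈ s,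
      ∑' i, (starRingEnd ℂ) (inner ℂ (f i) x) * inner ℂ (f' i) y = inner ℂ x y) :
    IsDualFramePair f f' := by
  set S := analysis f b hb
  set S' := analysis f' b' hb'
  -- Both sides are continuous in the pair, because the analysis operators are bounded, and they
  -- agree on a dense set.
  have key : ∀ x y, inner ℂ (S x) (S' y) = inner ℂ x y := by
    have h1 : (fun q : X × X => inner ℂ (S q.1) (S' q.2)) = fun q => inner ℂ q.1 q.2 := by
      refine Continuous.ext_on (hs.prod hs) (by fun_prop) (by fun_prop) ?_
      rintro ⟨x, y⟩ ⟨hx, hy⟩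
      simp only
      rw [lp.inner_eq_tsum, ← h x hx y hy]
      exact tsum_congr fun i => by
        rw [RCLike.inner_apply, mul_comm]; rfl
    exact fun x y => congrFun h1 (x, y)
  have hsum : ∀ {g : A → X} {c : ℝ}, (∀ x, ∀ Q : Finset A, ∑ i ∈ Q, ‖inner ℂ (g i) x‖ ^ 2 ≤
      c * ‖x‖ ^ 2) → ∀ x, Summable (fun i => ‖inner ℂ (g i) x‖ ^ 2) ∧
      ∑' i, ‖inner ℂ (g i) x‖ ^ 2 ≤ (|c| + 1) * ‖x‖ ^ 2 := fun hg x =>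
    ⟨summable_of_sum_le (fun i => by positivity) (hg x),
      (Real.tsum_le_of_sum_le (fun i => by positivity) (hg x)).trans
        (mul_le_mul_of_nonneg_right (by linarith [le_abs_self ‹ℝ›]) (sq_nonneg _))⟩
  have hnorm : ∀ {g : A → X} {c : ℝ} (hg : ∀ x, ∀ Q : Finset A, ∑ i ∈ Q, ‖inner ℂ (g i) x‖ ^ 2 ≤
      c * ‖x‖ ^ 2) x, ‖analysis g c hg x‖ ^ 2 = ∑' i, ‖inner ℂ (g i) x‖ ^ 2 := fun hg x => by
    have h1 := lp.norm_rpow_eq_tsum (p := 2) (by simp) (analysis _ _ hg x)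
    simp only [ENNReal.toReal_ofNat, Real.rpow_ofNat] at h1
    exact h1
  -- The lower bound of one family comes from the upper bound of the other, through `‖x‖² ≤ ‖S x‖
  -- ‖S' x‖`. The constants `|c| + 1` are positive even if the given Bessel bounds are not.
  have hlow : ∀ {g g' : A → X} {c c' : ℝ} (hg : ∀ x, ∀ Q : Finset A,
      ∑ i ∈ Q, ‖inner ℂ (g i) x‖ ^ 2 ≤ c * ‖x‖ ^ 2) (hg' : ∀ x, ∀ Q : Finset A,
      ∑ i ∈ Q, ‖inner ℂ (g' i) x‖ ^ 2 ≤ c' * ‖x‖ ^ 2),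
      (∀ x, ‖x‖ ^ 2 ≤ ‖analysis g c hg x‖ * ‖analysis g' c' hg' x‖) → IsFrame g := by
    intro g g' c c' hg hg' hx
    refine ⟨(|c'| + 1)⁻¹, |c| + 1, by positivity, by positivity, fun x => ⟨(hsum hg x).1, ?_,
      (hsum hg x).2⟩⟩
    rw [← hnorm hg x, inv_mul_le_iff₀ (by positivity)]
    have h1 := hx x
    have h2 := (hnorm hg' x).le.trans (hsum hg' x).2
    rcases (norm_nonneg x).eq_or_lt with h0 | h0
    · rw [← h0, zero_pow two_ne_zero]
      positivity
    · have h3 : (‖x‖ ^ 2) ^ 2 ≤ ((|c'| + 1) * ‖analysis g c hg x‖ ^ 2) * ‖x‖ ^ 2 := by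
        calc (‖x‖ ^ 2) ^ 2 ≤ (‖analysis g c hg x‖ * ‖analysis g' c' hg' x‖) ^ 2 := by gcongr
          _ = ‖analysis g c hg x‖ ^ 2 * ‖analysis g' c' hg' x‖ ^ 2 := mul_pow _ _ _
          _ ≤ ‖analysis g c hg x‖ ^ 2 * ((|c'| + 1) * ‖x‖ ^ 2) := by gcongr
          _ = _ := by ring
      rw [sq] at h3
      exact le_of_mul_le_mul_right h3 (by positivity)
  have hx1 : ∀ x, ‖x‖ ^ 2 ≤ ‖S x‖ * ‖S' x‖ := fun x => by
    have h1 := norm_inner_le_norm (𝕜 := ℂ) (S x) (S' x)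
    rw [key, inner_self_eq_norm_sq_to_K, norm_pow, RCLike.norm_ofReal, abs_norm] at h1
    exact h1
  refine ⟨hlow hb hb' hx1, hlow hb' hb fun x => (hx1 x).trans (mul_comm _ _).le, fun x => ?_⟩
  classical
  -- The identity above says `S^* S' = 1`. Applying `S^*` to the coordinate expansion of `S' x`
  -- gives the frame expansion of `x`.
  have h1 := (lp.hasSum_single (p := 2) (by simp) (S' x)).mapL (ContinuousLinearMap.adjoint S)
  have h2 : ContinuousLinearMap.adjoint S (S' x) = x := ext_inner_left ℂ fun y => by
    rw [ContinuousLinearMap.adjoint_inner_right, key]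
  rw [h2] at h1
  refine h1.congr_fun fun i => ?_
  refine ext_inner_left ℂ fun y => ?_
  rw [ContinuousLinearMap.adjoint_inner_right, lp.inner_single_right, inner_smul_right,
    RCLike.inner_apply]
  simp only [S, S', analysis_apply]
  rw [inner_conj_symm]

end DualFrames

/-! ### Fourier transforms of dilated and shifted `L₂` functions. -/

section FourierDilation

open Filter Topology
open scoped SchwartzMap

variable {d : ℕ}

lemma map_affine_volume {A : Matrix (Fin d) (Fin d) ℝ} (hA : A.det ≠ 0) (b : V d) :
    Measure.map (fun x => act A x + b) (volume : Measure (V d)) =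
      ENNReal.ofReal |A.det|⁻¹ • volume := by
  have h1 : (fun x => act A x + b) = (fun x => x + b) ∘ act A := rfl
  rw [h1, ← Measure.map_map (measurable_add_const b) (continuous_act A).measurable,
    map_act_volume hA, Measure.map_smul, map_add_right_eq_self]

lemma quasiMeasurePreserving_affine {A : Matrix (Fin d) (Fin d) ℝ} (hA : A.det ≠ 0) (b : V d) :
    Measure.QuasiMeasurePreserving (fun x => act A x + b) (volume : Measure (V d)) volume := by
  refine ⟨((continuous_act A).add_const b).measurable, ?_⟩
  rw [map_affine_volume hA]
  exact Measure.smul_absolutelyContinuous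

lemma memLp_affine {A : Matrix (Fin d) (Fin d) ℝ} (hA : A.det ≠ 0) (b y : V d) {f : V d → ℂ}
    (hf : MemLp f 2) : MemLp (fun x => ex y x * f (act A x + b)) 2 := by
  have h1 : MemLp (fun x => f (act A x + b)) 2 := by
    refine MemLp.comp_of_map (f := fun x => act A x + b) ?_
      ((continuous_act A).add_const b).aemeasurable
    rw [map_affine_volume hA]
    exact hf.smul_measure ENNReal.ofReal_ne_top
  refine h1.mono ((continuous_ex y).aestronglyMeasurable.mul h1.1) (Eventually.of_forall fun x => ?_)
  rw [norm_mul, norm_ex, one_mul]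

lemma eLpNorm_affine {A : Matrix (Fin d) (Fin d) ℝ} (hA : A.det ≠ 0) (b y : V d) {f : V d → ℂ}
    (hf : MemLp f 2) : eLpNorm (fun x => ex y x * f (act A x + b)) 2 volume =
      ENNReal.ofReal |A.det|⁻¹ ^ (1 / 2 : ENNReal).toReal * eLpNorm f 2 volume := by
  have h1 : eLpNorm (fun x => ex y x * f (act A x + b)) 2 volume =
      eLpNorm (f ∘ fun x => act A x + b) 2 volume :=
    eLpNorm_congr_norm_ae (Eventually.of_forall fun x => by
      rw [norm_mul, norm_ex, one_mul, Function.comp_apply])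
  rw [h1, ← eLpNorm_map_measure _ ((continuous_act A).add_const b).aemeasurable,
    map_affine_volume hA, eLpNorm_smul_measure_of_ne_top (by simp), smul_eq_mul]
  rw [map_affine_volume hA]
  exact hf.1.smul_measure _

/-- The operator `f ↦ ex y · f (A · + b)` on `L₂`. -/
def affineOp {A : Matrix (Fin d) (Fin d) ℝ} (hA : A.det ≠ 0) (b y : V d) : L2 d →L[ℂ] L2 d :=
  LinearMap.mkContinuous
    { toFun := fun f => (memLp_affine hA b y (Lp.memLp f)).toLp _
      map_add' := fun f g => by
        rw [← MemLp.toLp_add]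
        refine MemLp.toLp_congr _ _ ?_
        filter_upwards [(quasiMeasurePreserving_affine hA b).ae (Lp.coeFn_add f g)] with x hx
        rw [hx, Pi.add_apply, Pi.add_apply, mul_add]
      map_smul' := fun c f => by
        rw [RingHom.id_apply, ← MemLp.toLp_const_smul]
        refine MemLp.toLp_congr _ _ ?_
        filter_upwards [(quasiMeasurePreserving_affine hA b).ae (Lp.coeFn_smul c f)] with x hx
        rw [hx, Pi.smul_apply, Pi.smul_apply, smul_eq_mul, smul_eq_mul]
        ring }
    (ENNReal.ofReal |A.det|⁻¹ ^ (1 / 2 : ENNReal).toReal).toReal (fun f => by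
      refine le_of_eq ?_
      change ‖(memLp_affine hA b y (Lp.memLp f)).toLp _‖ = _
      rw [Lp.norm_toLp, eLpNorm_affine hA b y (Lp.memLp f), ENNReal.toReal_mul, Lp.norm_def])

lemma coeFn_affineOp {A : Matrix (Fin d) (Fin d) ℝ} (hA : A.det ≠ 0) (b y : V d) (f : L2 d) :
    affineOp hA b y f =ᵐ[volume] fun x => ex y x * f (act A x + b) :=
  (memLp_affine hA b y (Lp.memLp f)).coeFn_toLp

lemma transpose_inv_det_ne_zero {A : Matrix (Fin d) (Fin d) ℝ} (hA : A.det ≠ 0) :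
    Aᵀ⁻¹.det ≠ 0 :=
  (Matrix.isUnit_nonsing_inv_det _ (by rw [Matrix.det_transpose]; exact hA.isUnit)).ne_zero

lemma fourier_affine {A : Matrix (Fin d) (Fin d) ℝ} (hA : A.det ≠ 0) (b : V d) (f : V d → ℂ)
    (ξ : V d) : 𝓕 (fun x => f (act A x + b)) ξ =
      (|A.det|⁻¹ : ℝ) * (ex (act A⁻¹ b) ξ * 𝓕 f (act Aᵀ⁻¹ ξ)) := by
  have hA' : Aᵀ.det ≠ 0 := by rwa [Matrix.det_transpose]
  rw [Real.fourier_eq, Real.fourier_eq]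
  simp only [Circle.smul_def, fourierChar_neg_inner, smul_eq_mul]
  have h1 : ∀ x, ex (-ξ) x * f (act A x + b) = ex (act A⁻¹ b) ξ *
      (fun x => ex (-act Aᵀ⁻¹ ξ) (x + b) * f (x + b)) (act A x) := by
    intro x
    have h2 : act A x + b = act A (x + act A⁻¹ b) := by rw [act_add, act_act_inv hA]
    have h3 : ex (-act Aᵀ⁻¹ ξ) (act A x + b) = ex (-ξ) x * ex (-ξ) (act A⁻¹ b) := by
      rw [h2, ← act_neg, ex_act, Matrix.transpose_nonsing_inv, Matrix.transpose_transpose,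
        act_inv_act hA, ex_add_right]
    have h4 : ex (act A⁻¹ b) ξ * ex (-ξ) (act A⁻¹ b) = 1 := by
      rw [ex_comm (-ξ), ex_neg_right, ← ex_add_left, add_neg_cancel, ex_zero_left]
    simp only [h3]
    linear_combination (-(ex (-ξ) x * f (act A x + b))) * h4
  simp only [h1]
  rw [integral_const_mul, integral_comp_act hA
    (fun x => ex (-act Aᵀ⁻¹ ξ) (x + b) * f (x + b)),
    integral_add_right_eq_self (fun x => ex (-act Aᵀ⁻¹ ξ) x * f x) b, Complex.real_smul]
  ring

/-- The Fourier transform of `f (A · + b)` for `f ∈ L₂`. -/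
lemma fourier_affineOp {A : Matrix (Fin d) (Fin d) ℝ} (hA : A.det ≠ 0) (b : V d) (f : L2 d) :
    𝓕 (affineOp hA b 0 f) = ((|A.det|⁻¹ : ℝ) : ℂ) •
      affineOp (transpose_inv_det_ne_zero hA) 0 (act A⁻¹ b) (𝓕 f) := by
  have hden : DenseRange (SchwartzMap.toLpCLM ℝ ℂ 2 (volume : Measure (V d))) :=
    SchwartzMap.denseRange_toLpCLM ENNReal.ofNat_ne_top
  have hF : Continuous (fun f : L2 d => 𝓕 f) := (Lp.fourierTransformₗᵢ (V d) ℂ).continuous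
  -- Both sides are continuous in `f`, so the formula for integrals on Schwartz functions suffices.
  refine hden.induction_on (p := fun f => 𝓕 (affineOp hA b 0 f) = ((|A.det|⁻¹ : ℝ) : ℂ) •
      affineOp (transpose_inv_det_ne_zero hA) 0 (act A⁻¹ b) (𝓕 f)) f ?_ fun h => ?_
  · refine isClosed_eq (hF.comp (affineOp hA b 0).continuous) ?_
    exact ((affineOp (transpose_inv_det_ne_zero hA) 0 (act A⁻¹ b)).continuous.comp hF).const_smul
      ((|A.det|⁻¹ : ℝ) : ℂ)
  · let e : V d ≃L[ℝ] V d := LinearEquiv.toContinuousLinearEquiv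
      { toFun := act A
        invFun := act A⁻¹
        left_inv := act_inv_act hA
        right_inv := act_act_inv hA
        map_add' := act_add A
        map_smul' := fun c x => by simp [act_eq_clm] }
    let g : 𝓢(V d, ℂ) := SchwartzMap.compCLMOfContinuousLinearEquiv ℂ e
      (SchwartzMap.compSubConstCLM ℂ (-b) h)
    have hg : ∀ x, g x = h (act A x + b) := fun x => by
      show h (act A x - -b) = _
      rw [sub_neg_eq_add]
    have h1 : affineOp hA b 0 (SchwartzMap.toLpCLM ℝ ℂ 2 volume h) = g.toLp 2 volume := by
      refine Lp.ext ?_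
      filter_upwards [coeFn_affineOp hA b 0 (SchwartzMap.toLpCLM ℝ ℂ 2 volume h),
        g.coeFn_toLp 2 volume, (quasiMeasurePreserving_affine hA b).ae (h.coeFn_toLp 2 volume)]
        with x hx1 hx2 hx3
      rw [hx1, hx2, hg, ex_zero_left, one_mul]
      exact hx3
    rw [h1, SchwartzMap.toLp_fourier_eq, SchwartzMap.toLpCLM_apply, SchwartzMap.toLp_fourier_eq]
    have hA' := transpose_inv_det_ne_zero hA
    refine Lp.ext ?_
    filter_upwards [(𝓕 g).coeFn_toLp 2 volume, Lp.coeFn_smul ((|A.det|⁻¹ : ℝ) : ℂ)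
      (affineOp hA' 0 (act A⁻¹ b) ((𝓕 h).toLp 2 volume)),
      coeFn_affineOp hA' 0 (act A⁻¹ b) ((𝓕 h).toLp 2 volume),
      (quasiMeasurePreserving_affine hA' 0).ae ((𝓕 h).coeFn_toLp 2 volume)] with x hx1 hx2 hx3 hx4
    rw [hx1, hx2, Pi.smul_apply, hx3, hx4, SchwartzMap.fourier_coe, SchwartzMap.fourier_coe,
      smul_eq_mul, add_zero, funext hg, fourier_affine hA]

end FourierDilation

/-! ### Wavelet systems in `L₂` and the Mixed Extension Principle. -/

section Frames

open Filter Topology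

variable {d : ℕ} {M : Matrix (Fin d) (Fin d) ℤ} {t t' : V d → ℂ} {I : Type}

lemma integral_norm_sq_eq (f : L2 d) : ∫ ξ, ‖f ξ‖ ^ 2 = ‖f‖ ^ 2 := by
  have h1 := @inner_self_eq_norm_sq_to_K ℂ (L2 d) _ _ _ f
  rw [L2.inner_def] at h1
  simp only [inner_self_eq_norm_sq_to_K] at h1
  have h2 : ∫ ξ, ((‖f ξ‖ ^ 2 : ℝ) : ℂ) = ((‖f‖ ^ 2 : ℝ) : ℂ) := by
    push_cast
    exact h1
  rw [integral_complex_ofReal] at h2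
  exact_mod_cast h2

/-- The functions whose Fourier transform has bounded support are dense. -/
lemma dense_bandlimited : Dense {x : L2 d | ∃ (F : V d → ℂ) (R : ℝ), MemLp F 2 ∧
    (∀ ξ, R < ‖ξ‖ → F ξ = 0) ∧ (𝓕 x : L2 d) =ᵐ[volume] F} := by
  rw [Metric.dense_iff]
  intro x r hr
  -- By Plancherel's theorem it suffices to approximate `𝓕 x` by a compactly supported function.
  obtain ⟨F, hFc, hFr, -, hF⟩ := (Lp.memLp (𝓕 x : L2 d)).exists_hasCompactSupport_eLpNorm_sub_le
    (by simp) (ε := ENNReal.ofReal (r / 2)) (by simpa using hr)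
  obtain ⟨R, hR⟩ := hFc.isBounded.exists_norm_le
  refine ⟨𝓕⁻ (hF.toLp F), ?_, F, R, hF, fun ξ hξ => ?_, ?_⟩
  · have h1 : 𝓕 (𝓕⁻ (hF.toLp F) : L2 d) = hF.toLp F := FourierTransform.fourier_fourierInv_eq _
    have h2 : ‖(𝓕⁻ (hF.toLp F) : L2 d) - x‖ = ‖hF.toLp F - 𝓕 x‖ := by
      rw [← Lp.norm_fourier_eq, ← h1]
      congr 1
      rw [h1]
      exact (map_sub (Lp.fourierTransformₗᵢ (V d) ℂ) _ _).trans (congrArg (· - _) h1)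
    rw [Metric.mem_ball, dist_eq_norm, h2, norm_sub_rev, Lp.norm_def]
    have h3 : eLpNorm ⇑((𝓕 x : L2 d) - hF.toLp F) 2 volume =
        eLpNorm (⇑(𝓕 x : L2 d) - F) 2 volume := by
      refine eLpNorm_congr_ae ?_
      filter_upwards [Lp.coeFn_sub (𝓕 x) (hF.toLp F), hF.coeFn_toLp] with ξ h4 h5
      rw [h4, Pi.sub_apply, Pi.sub_apply, h5]
    rw [h3]
    exact (ENNReal.toReal_le_of_le_ofReal (by positivity) hFr).trans_lt (by linarith)
  · by_contra h
    exact absurd (hR ξ (subset_tsupport F h)) (not_le.2 hξ)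
  · rw [FourierTransform.fourier_fourierInv_eq]
    exact hF.coeFn_toLp

/-- The wavelet systems exist, and their Fourier transforms are known. -/
lemma exists_waveletSystem (hM : IsDilation M) (ht : IsRefinableMask t)
    (hφ : MemLp (refinableHat M t) 2) {m : I → V d → ℂ} (hm : ∀ ν, IsTrigPoly (m ν)) :
    ∃ (ψ : I → L2 d) (Ψ : I × ℤ × (Fin d → ℤ) → L2 d),
      (∀ ν, IsWaveletFunction M t (m ν) (ψ ν)) ∧ IsWaveletSystem M ψ Ψ ∧
      ∀ (i : I × ℤ × (Fin d → ℤ)) (x : L2 d), inner ℂ (Ψ i) x =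
        coef M (waveletHat M t (m i.1)) i.2.1 i.2.2 (𝓕 x : L2 d) := by
  have hdet : (toReal M).det ≠ 0 := by
    rw [toReal_det]; exact Int.cast_ne_zero.2 hM.det_ne_zero
  have hdetj : ∀ j : ℤ, (toReal M ^ j).det ≠ 0 := fun j => (hdet.isUnit.det_zpow j).ne_zero
  have hψm := fun ν => memLp_waveletHat hM ht hφ (hm ν)
  set ψ : I → L2 d := fun ν => 𝓕⁻ ((hψm ν).toLp _) with hψ
  have hψF : ∀ ν, (𝓕 (ψ ν) : L2 d) =ᵐ[volume] waveletHat M t (m ν) := fun ν => by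
    rw [hψ, FourierTransform.fourier_fourierInv_eq]
    exact (hψm ν).coeFn_toLp
  refine ⟨ψ, fun i => ((absDet M ^ ((i.2.1 : ℝ) / 2) : ℝ) : ℂ) •
    affineOp (hdetj i.2.1) (intVec i.2.2) 0 (ψ i.1), hψF, fun ν j k => ?_, fun i x => ?_⟩
  · filter_upwards [Lp.coeFn_smul ((absDet M ^ ((j : ℝ) / 2) : ℝ) : ℂ)
      (affineOp (hdetj j) (intVec k) 0 (ψ ν)), coeFn_affineOp (hdetj j) (intVec k) 0 (ψ ν)]
      with ξ h1 h2
    rw [h1, Pi.smul_apply, h2, ex_zero_left, one_mul, smul_eq_mul]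
  · obtain ⟨ν, j, k⟩ := i
    -- The transform of a dilated wavelet is `dilHat`: the Jacobian `m^{-j}` and the normalization
    -- `m^{j/2}` combine to `m^{-j/2}`. Plancherel's theorem then identifies the inner products with
    -- `coef`.
    have hF : (𝓕 (((absDet M ^ ((j : ℝ) / 2) : ℝ) : ℂ) •
        affineOp (hdetj j) (intVec k) 0 (ψ ν)) : L2 d) =ᵐ[volume]
        dilHat M (waveletHat M t (m ν)) j k := by
      have hTj : ((toReal M) ^ j)ᵀ⁻¹ = (toReal M)ᵀ⁻¹ ^ j := by
        rw [Matrix.transpose_zpow, Matrix.inv_zpow]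
      have hTj' : ((toReal M) ^ j)⁻¹ᵀ = (toReal M)ᵀ⁻¹ ^ j := by
        rw [Matrix.transpose_nonsing_inv, hTj]
      have hd : |((toReal M) ^ j).det|⁻¹ = absDet M ^ (-j) := by
        rw [← hM.abs_det_zpow, ← hTj', Matrix.det_transpose, Matrix.det_nonsing_inv,
          Ring.inverse_eq_inv', abs_inv]
      rw [FourierTransform.fourier_smul, fourier_affineOp, smul_smul]
      have hA' := transpose_inv_det_ne_zero (hdetj j)
      filter_upwards [Lp.coeFn_smul (((absDet M ^ ((j : ℝ) / 2) : ℝ) : ℂ) *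
        ((|((toReal M) ^ j).det|⁻¹ : ℝ) : ℂ))
        (affineOp hA' 0 (act (toReal M ^ j)⁻¹ (intVec k)) (𝓕 (ψ ν))),
        coeFn_affineOp hA' 0 (act (toReal M ^ j)⁻¹ (intVec k)) (𝓕 (ψ ν)),
        (quasiMeasurePreserving_affine hA' 0).ae (hψF ν)] with ξ h1 h2 h3
      rw [h1, Pi.smul_apply, h2, h3, ex_act, hTj, hTj', add_zero, dilHat, ← expo_eq_ex, smul_eq_mul,
        hd, ← Complex.ofReal_mul]
      have h4 : absDet M ^ ((j : ℝ) / 2) * absDet M ^ (-j) = scaleFactor M j := by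
        rw [scaleFactor, ← Real.rpow_intCast, ← Real.rpow_add (absDet_pos hM.det_ne_zero)]
        congr 1
        push_cast
        ring
      rw [h4]
      rfl
    rw [← Lp.inner_fourier_eq, L2.inner_def, coef]
    refine integral_congr_ae ?_
    filter_upwards [hF] with ξ hξ
    rw [RCLike.inner_apply, hξ, mul_comm]

/-- The Mixed Extension Principle for refinable functions in `L₂` and wavelet masks which vanish
at the origin. -/
theorem givesDualWaveletFrame [Fintype I] [DecidableEq I] (hd : 0 < d) (hM : IsDilation M)
    (ht : IsRefinableMask t) (ht' : IsRefinableMask t') (hφ : MemLp (refinableHat M t) 2)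
    (hφ' : MemLp (refinableHat M t') 2) {s : Unit ⊕ I → Fin d → ℤ} (hs : IsDigits M s)
    {m m' : I → V d → ℂ} {A B : V d → Matrix (Unit ⊕ I) (Unit ⊕ I) ℂ}
    (hMEP : IsMEPPair M s (Sum.elim (fun _ => t) m) (Sum.elim (fun _ => t') m') A B)
    (hm : ∀ ν, IsTrigPoly (m ν)) (hm0 : ∀ ν, m ν 0 = 0)
    (hm' : ∀ ν, IsTrigPoly (m' ν)) (hm'0 : ∀ ν, m' ν 0 = 0) :
    GivesDualWaveletFrame M t t' m m' := by
  obtain ⟨ψ, Ψ, h1, h2, h3⟩ := exists_waveletSystem hM ht hφ hm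
  obtain ⟨ψ', Ψ', h1', h2', h3'⟩ := exists_waveletSystem hM ht' hφ' hm'
  obtain ⟨K, -, hB⟩ := exists_bessel_waveletHat hd hM ht hφ hm hm0
  obtain ⟨K', -, hB'⟩ := exists_bessel_waveletHat hd hM ht' hφ' hm' hm'0
  refine ⟨ψ, ψ', Ψ, Ψ', h1, h1', h2, h2', isDualFramePair_of_bessel (b := K) (b' := K')
    (fun x Q => ?_) (fun x Q => ?_) dense_bandlimited ?_⟩
  · simp only [h3]
    rw [← Lp.norm_fourier_eq x, ← integral_norm_sq_eq]
    exact hB _ (Lp.memLp _) Q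
  · simp only [h3']
    rw [← Lp.norm_fourier_eq x, ← integral_norm_sq_eq]
    exact hB' _ (Lp.memLp _) Q
  · rintro x ⟨G, R, hG, hG0, hxG⟩ y ⟨F, R', hF, hF0, hyF⟩
    have hcoef : ∀ (p : V d → ℂ) j k {H H' : V d → ℂ}, H =ᵐ[volume] H' →
        coef M p j k H = coef M p j k H' := fun p j k H H' h => by
      refine integral_congr_ae ?_
      filter_upwards [h] with ξ hξ
      rw [hξ]
    have h4 := (hasSum_waveletHat hd hM ht ht' hφ hφ' hs hMEP hm hm0 hm' hm'0 hF hG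
      (R := max R R') (fun ξ h => hF0 ξ ((le_max_right _ _).trans_lt h))
      (fun ξ h => hG0 ξ ((le_max_left _ _).trans_lt h))).tsum_eq
    simp only [h3, h3', hcoef _ _ _ hxG, hcoef _ _ _ hyF]
    rw [h4, ← Lp.inner_fourier_eq, L2.inner_def]
    refine integral_congr_ae ?_
    filter_upwards [hxG, hyF] with ξ hx hy
    rw [RCLike.inner_apply, hx, hy, mul_comm]

end Frames

lemma HasVanishingMoments.apply_zero {d n : ℕ} (hn : 0 < n) {t : V d → ℂ}
    (ht : HasVanishingMoments n t) : t 0 = 0 := by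
  have h := ht 0 (by simpa using hn)
  have h1 : ∀ l : List (Fin d), l.foldr
      (fun j g => (pderiv j)^[(0 : Fin d → ℕ) j] g) t = t := fun l => by
    induction l with
    | nil => rfl
    | cons a l ih => rw [List.foldr_cons, ih]; rfl
  rw [← h, multiDeriv, h1]

end SymFrame

end

theorem theorem16 {d : ℕ} (hd : 0 < d) (M : Matrix (Fin d) (Fin d) ℤ)
    (hM : SymFrame.IsDilation M) (Dst : Finset (Fin d → ℤ)) (hDst : SymFrame.IsDigitSet Mᵀ Dst)
    (H : Subgroup (GL (Fin d) ℤ)) (hH : SymFrame.IsSymmetryGroup M H)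
    (hab : ∀ E ∈ H, ∀ F ∈ H, E * F = F * E)
    (S : SymFrame.OrbitSystem M H) (hS : SymFrame.SpecialAssumption S)
    (n : ℕ) (hn : 0 < n) (m₀ : SymFrame.V d → ℂ) (hm₀ : SymFrame.IsRefinableMask m₀)
    (hint : SymFrame.IsInterpolatory M Dst m₀) (hsym : SymFrame.IsHSymmetric H 0 m₀)
    (hsum : SymFrame.HasSumRule M Dst n m₀) :
    (∃ C : SymFrame.CyclicNumbering S, ∀ p j, IsPrimePow (C.N p j : ℕ)) ∧
    ∀ C : SymFrame.CyclicNumbering S, ∃ μ : Unit ⊕ C.WIdx → SymFrame.V d → ℂ,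
      SymFrame.IsPolyphase M C.digit m₀ μ ∧
      SymFrame.IsRefinableMask (C.dualMask μ) ∧
      SymFrame.IsHSymmetric H 0 (C.dualMask μ) ∧
      SymFrame.IsMEPPair M C.digit
        (Sum.elim (fun _ => m₀) (C.waveletMask μ))
        (Sum.elim (fun _ => C.dualMask μ) (C.dualWaveletMask μ))
        (SymFrame.extN M μ C.blockWᴴ) (SymFrame.extNDual M μ C.blockWᴴ) ∧
      (∀ ν, SymFrame.IsTrigPoly (C.waveletMask μ ν) ∧
        SymFrame.IsTrigPoly (C.dualWaveletMask μ ν) ∧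
        SymFrame.HasVanishingMoments n (C.waveletMask μ ν) ∧
        SymFrame.HasVanishingMoments n (C.dualWaveletMask μ ν) ∧
        SymFrame.HasHSymmetryProperty H (C.waveletMask μ ν) ∧
        SymFrame.HasHSymmetryProperty H (C.dualWaveletMask μ ν)) ∧
      ∀ φ φ' : SymFrame.L2 d, SymFrame.IsRefinableFunction M m₀ φ →
        SymFrame.IsRefinableFunction M (C.dualMask μ) φ' →
        SymFrame.GivesDualWaveletFrame M m₀ (C.dualMask μ)
          (C.waveletMask μ) (C.dualWaveletMask μ) := by
  have hdet := hM.det_ne_zero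
  refine ⟨SymFrame.exists_cyclicNumbering hH hab S, fun C => ?_⟩
  have hs := C.isDigits hH
  obtain ⟨μ, hμ⟩ := SymFrame.exists_isPolyphase hdet hs hm₀.1
  have h0 := SymFrame.polyphase_zero_of_interpolatory hdet hs rfl hDst hint hμ
  have hdual : SymFrame.IsRefinableMask (C.dualMask μ) := by
    refine ⟨SymFrame.IsTrigPoly.fromPolyphase _ fun i => ?_,
      SymFrame.fromPolyphase_dualPolyphase_zero hdet hm₀ hDst hint hn hsum hs rfl hμ⟩
    rw [← SymFrame.extNDual_inl (M := M) μ C.blockWᴴ]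
    exact SymFrame.isTrigPoly_extNDual hμ.1 _ _ _
  have hmasks := C.masks_symm hdet hH hab hS hDst hsym hμ h0
  have hMEP := C.isMEPPair hdet hμ h0
  have hw : ∀ ν, SymFrame.IsTrigPoly (C.waveletMask μ ν) := fun ν =>
    SymFrame.IsTrigPoly.fromPolyphase _ fun _ => SymFrame.isTrigPoly_extN hμ.1 _ _ _
  have hw' : ∀ ν, SymFrame.IsTrigPoly (C.dualWaveletMask μ ν) := fun ν =>
    SymFrame.IsTrigPoly.fromPolyphase _ fun _ => SymFrame.isTrigPoly_extNDual hμ.1 _ _ _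
  have hvm := SymFrame.hasVanishingMoments_extN hdet hm₀.1 hDst hint hsum hs rfl hμ C.blockWᴴ
  refine ⟨μ, hμ, hdual, hmasks.1, hMEP, fun ν => ⟨hw ν, hw' ν, (hvm ν).1, (hvm ν).2,
    (hmasks.2 ν).1, (hmasks.2 ν).2⟩, fun φ φ' hφ hφ' => ?_⟩
  -- The refinable functions enter only through the square integrability of the two infinite
  -- products. Since `n > 0`, vanishing moments give wavelet masks that are zero at the origin.
  exact SymFrame.givesDualWaveletFrame hd hM hm₀ hdual
    ((Lp.memLp (𝓕 φ)).ae_eq hφ) ((Lp.memLp (𝓕 φ')).ae_eq hφ') hs hMEP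
    hw (fun ν => (hvm ν).1.apply_zero hn) hw' (fun ν => (hvm ν).2.apply_zero hn)
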